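/- Let $\mathbb K$ be $\mathbb R$ or $\mathbb C$, and let $p$ be a computable real with $p\ge 1$ and $p\ne 2$. Let $\mathcal B=\ell^p\oplus L^p[0,1]$ over $\mathbb K$, with norm $\|(u,f)\|=(\|u\|_p^p+\|f\|_p^p)^{1/p}$. A presentation of a Banach space $\mathcal A$ is a pair $\mathcal A^\#=(\mathcal A,R)$ with $R:\mathbb N\to\mathcal A$ a sequence whose range has dense linear span. Its rational vectors are the sums $\sum_{j\le M}\alpha_jR(j)$ with $\alpha_j\in\mathbb Q(i)$ (with $\alpha_j\in\mathbb Q$ if $\mathbb K=\mathbb R$), and its rational balls are the open balls whose centre is a rational vector and whose radius is a positive rational. The presentation is computable if there is an algorithm that, given $\alpha_0,\dots,\alpha_M$ and $k\in\mathbb N$, produces a rational $q$ with $\bigl|\,\|\sum_{j\le M}\alpha_jR(j)\|-q\bigr|<2^{-k}$. The standard presentation of $\mathcal B$ lists the vectors $(e_n,0)$, where $(e_n)$ is the standard basis of $\ell^p$, and $(0,\chi_I)$, where $I$ runs effectively through the dyadic subintervals $[j2^{-k},(j+1)2^{-k}]$ of $[0,1]$. An oracle $X\subseteq\mathbb N$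 computes a map $T$ from $\mathcal A_0^\#$ to $\mathcal A_1^\#$ if there is an algorithm with oracle $X$ that, given a (code of a) rational ball $B$ of $\mathcal A_0^\#$, either does not halt or produces a rational ball $P(B)$ of $\mathcal A_1^\#$, such that $T[B]\subseteq P(B)$ whenever it halts on $B$, and such that for every $v\in\mathcal A_0$ and every neighbourhood $U$ of $T(v)$ there is a rational ball $B\ni v$ on which it halts with $P(B)\subseteq U$. **Theorem.** There is a computable presentation $\mathcal B^\#$ of $\mathcal B$ such that every oracle $X\subseteq\mathbb N$ that computes some linear isometric isomorphism of $\mathcal B$, with its standard presentation, onto $\mathcal B^\#$ also computes $\emptyset''$, the second Turing jump of the empty set. -/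

import Mathlib

open MeasureTheory Topology
open scoped ENNReal

noncomputable section

/-! ### Codes for rational numbers, and computable reals -/

/-- A code for a rational number, made of natural numbers. -/
abbrev RatCode : Type := ℕ × ℕ × ℕ

/-- The code `(a, b, c)` stands for the rational number `(a - b) / (c + 1)`. -/
def RatCode.val (q : RatCode) : ℚ := ((q.1 : ℚ) - (q.2.1 : ℚ)) / ((q.2.2 : ℚ) + 1)

/-- A real `x` is computable if an algorithm produces, given `k`, a rational number that is
within `2⁻ᵏ` of `x`. -/
def IsComputableReal (x : ℝ) : Prop :=
  ∃ f : ℕ → RatCode, Computable f ∧ ∀ k : ℕ, |((f k).val : ℝ) - x| < ((2 : ℝ) ^ k)⁻¹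

/-! ### Sets of natural numbers as oracles, and the Turing jump -/

open Classical in
/-- The characteristic function of a set of natural numbers. -/
def charFun (A : Set ℕ) (n : ℕ) : ℕ := if n ∈ A then 1 else 0

/-- The set `X` computes the set `A`, that is, `A` is Turing reducible to `X`. -/
def Computes (X A : Set ℕ) : Prop :=
  TuringReducible (fun n => Part.some (charFun A n)) (fun n => Part.some (charFun X n))

/-- Programs for oracle computations: those for partial recursive functions
(as in `Nat.Partrec.Code`) with an additional instruction that queries the oracle. -/
inductive OracleCode : Type
  | zero : OracleCode
  | succ : OracleCode
  | left : OracleCode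
  | right : OracleCode
  | oracle : OracleCode
  | pair : OracleCode → OracleCode → OracleCode
  | comp : OracleCode → OracleCode → OracleCode
  | prec : OracleCode → OracleCode → OracleCode
  | rfind' : OracleCode → OracleCode

/-- The partial function computed by a program with oracle `g`. -/
def OracleCode.eval (g : ℕ → ℕ) : OracleCode → ℕ →. ℕ
  | zero => fun _ => Part.some 0
  | succ => fun n => Part.some (n + 1)
  | left => fun n => Part.some n.unpair.1
  | right => fun n => Part.some n.unpair.2
  | oracle => fun n => Part.some (g n)
  | pair cf cg => fun n => Nat.pair <$> eval g cf n <*> eval g cg n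
  | comp cf cg => fun n => eval g cg n >>= eval g cf
  | prec cf cg =>
    Nat.unpaired fun a n =>
      n.rec (eval g cf a) fun y IH => do
        let i ← IH
        eval g cg (Nat.pair a (Nat.pair y i))
  | rfind' cf =>
    Nat.unpaired fun a m =>
      (Nat.rfind fun n => (fun m => m = 0) <$> eval g cf (Nat.pair a (n + m))).map (· + m)

/-- The effective numbering of the programs for oracle computations: `ofNat e` is the
`e`-th program. -/
def OracleCode.ofNat : ℕ → OracleCode
  | 0 => zero
  | 1 => succ
  | 2 => left
  | 3 => right
  | 4 => oracle
  | n + 5 =>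
    have h₀ : n / 4 < n + 5 := by omega
    have h₁ : (n / 4).unpair.1 < n + 5 := lt_of_le_of_lt (Nat.unpair_left_le _) h₀
    have h₂ : (n / 4).unpair.2 < n + 5 := lt_of_le_of_lt (Nat.unpair_right_le _) h₀
    match n % 4 with
    | 0 => pair (ofNat (n / 4).unpair.1) (ofNat (n / 4).unpair.2)
    | 1 => comp (ofNat (n / 4).unpair.1) (ofNat (n / 4).unpair.2)
    | 2 => prec (ofNat (n / 4).unpair.1) (ofNat (n / 4).unpair.2)
    | _ => rfind' (ofNat (n / 4))

/-- The Turing jump `A'` of `A`: the set of all `e` such that the `e`-th program with oracle `A`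
halts on input `e`. -/
def turingJump (A : Set ℕ) : Set ℕ :=
  {e | ((OracleCode.ofNat e).eval (charFun A) e).Dom}

/-! ### Presentations of Banach spaces -/

/-- A code for a rational scalar, given by codes of its real and imaginary parts. -/
abbrev ScalarCode : Type := RatCode × RatCode

/-- A code for a rational vector, given by the list of its coefficients. -/
abbrev VectorCode : Type := List ScalarCode

/-- A code for a rational ball, given by the centre and the radius. -/
abbrev BallCode : Type := VectorCode × ℕ × ℕ

section Presentations

/-- The scalar `a + b i` with rational `a` and `b`; over the reals, where `RCLike.I = 0`,
this is just `a`. -/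
def ScalarCode.val (𝕜 : Type*) [RCLike 𝕜] (z : ScalarCode) : 𝕜 :=
  (z.1.val : 𝕜) + (z.2.val : 𝕜) * RCLike.I

variable (𝕜 : Type*) [RCLike 𝕜] {E F : Type*}
  [NormedAddCommGroup E] [NormedSpace 𝕜 E] [NormedAddCommGroup F] [NormedSpace 𝕜 F]

/-- `(E, R)` is a presentation of the Banach space `E`: the range of `R` is linearly dense. -/
def IsPresentation (R : ℕ → E) : Prop :=
  Dense (Submodule.span 𝕜 (Set.range R) : Set E)

/-- The rational vector `∑ j, αⱼ • R j` of `(E, R)`, where `α` is the list of coefficients. -/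
def ratVec (R : ℕ → E) (α : VectorCode) : E :=
  ∑ j : Fin α.length, ScalarCode.val 𝕜 (α.get j) • R j

/-- `(E, R)` is a computable presentation: it is a presentation, and an algorithm produces, given
(the coefficients of) a rational vector and `k`, a rational number that is within `2⁻ᵏ` of the norm
of the vector. -/
def IsComputablePresentation (R : ℕ → E) : Prop :=
  IsPresentation 𝕜 R ∧
    ∃ f : VectorCode × ℕ → RatCode, Computable f ∧
      ∀ (α : VectorCode) (k : ℕ), |‖ratVec 𝕜 R α‖ - ((f (α, k)).val : ℝ)| < ((2 : ℝ) ^ k)⁻¹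

/-- The open rational ball of `(E, R)` with a given code; a pair `(a, b)` stands for the positive
rational radius `(a + 1) / (b + 1)`. -/
def ratBall (R : ℕ → E) (B : BallCode) : Set E :=
  Metric.ball (ratVec 𝕜 R B.1) (((B.2.1 : ℝ) + 1) / ((B.2.2 : ℝ) + 1))

/-- The oracle `X` computes the map `T` of `(E, R)` into `(F, S)`: with the help of `X`, an
algorithm that takes a rational ball of `(E, R)` and may or may not halt, but produces a rational
ball of `(F, S)` if it halts, satisfies the following.
* Approximation: the ball that it produces from `B` contains `T[B]`.
* Convergence: if `U` is a neighbourhood of `T v`, then `v` is in a rational ball from which it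
  produces a ball included in `U`. -/
def OracleComputesMap (X : Set ℕ) (R : ℕ → E) (S : ℕ → F) (T : E → F) : Prop :=
  ∃ P : BallCode →. BallCode,
    RecursiveIn {fun n => Part.some (charFun X n)} P ∧
    (∀ B C, C ∈ P B → T '' ratBall 𝕜 R B ⊆ ratBall 𝕜 S C) ∧
    ∀ v, ∀ U ∈ 𝓝 (T v), ∃ B C, C ∈ P B ∧ v ∈ ratBall 𝕜 R B ∧ ratBall 𝕜 S C ⊆ U

end Presentations

/-! ### The space `ℓᵖ ⊕ Lᵖ[0,1]` and its standard presentation -/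

section Space

/-- Lebesgue measure on `[0,1]`. -/
abbrev unitMeasure : Measure ℝ := volume.restrict (Set.Icc 0 1)

/-- The Banach space `ℓᵖ ⊕ Lᵖ[0,1]`, with norm `‖(u, f)‖ = (‖u‖ᵖ + ‖f‖ᵖ)^(1/p)`. -/
abbrev LpSum (𝕜 : Type*) [RCLike 𝕜] (p : ℝ≥0∞) [Fact (1 ≤ p)] : Type _ :=
  WithLp p (lp (fun _ : ℕ => 𝕜) p × Lp 𝕜 p unitMeasure)

/-- The `n`-th dyadic subinterval of `[0,1]`: if `n + 1 = 2ᵏ + j` with `j < 2ᵏ`, then it is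
`[j / 2ᵏ, (j + 1) / 2ᵏ]`. -/
def dyadicInterval (n : ℕ) : Set ℝ :=
  let k := Nat.log 2 (n + 1)
  let j := n + 1 - 2 ^ k
  Set.Icc ((j : ℝ) / 2 ^ k) (((j : ℝ) + 1) / 2 ^ k)

theorem measurableSet_dyadicInterval (n : ℕ) : MeasurableSet (dyadicInterval n) :=
  measurableSet_Icc

/-- The standard presentation of `ℓᵖ ⊕ Lᵖ[0,1]`: it lists the standard basis vectors of `ℓᵖ` in
the even places, and the characteristic functions of the dyadic subintervals in the odd places. -/
def standardSeq (𝕜 : Type*) [RCLike 𝕜] (p : ℝ≥0∞) [Fact (1 ≤ p)] (n : ℕ) : LpSum 𝕜 p :=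
  if n % 2 = 0 then
    WithLp.toLp p (lp.single p (n / 2) (1 : 𝕜), 0)
  else
    WithLp.toLp p (0, indicatorConstLp p (measurableSet_dyadicInterval (n / 2))
      (measure_ne_top unitMeasure _) (1 : 𝕜))

end Space

end

/-! The norms of the new presentation do not reveal whether a vector lies in `ℓᵖ` or in `Lᵖ`, and
this hidden alternative encodes a `Σ₂` question.

Each number `c` has a component, a binary tree of vectors. Its root has norm one, and every increase
of a computable counter `level c s` splits each current leaf into two disjoint vectors of equal
norm. If the counter is bounded, the component is spanned by finitely many basis vectors of `ℓᵖ`; if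
it is unbounded, the component fills `Lᵖ` of a dyadic block of `[0,1]`. In both cases a node of
level `k` has `p`-th power norm `2⁻ᵏ`, and different nodes of one level are disjoint
(`norm_node_rpow`, `disj_node`). The norm of a rational vector is therefore found by refining it to
the leaves of one finite stage, without knowing which case holds (`norm_ratVec_nodeSeq`).

Membership in `∅''` is a `Σ₂` property, so there is a computable counter that is bounded exactly
when `e ∈ ∅''` (`mem_turingJump_turingJump_iff_candidate`). It drives the component `3 * e`; the
remaining components supply infinitely many of each kind, so that the sum is all of `ℓᵖ ⊕ Lᵖ[0,1]`
(`isPresentation_nodeSeq`).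

For `p ≠ 2`, equality in a `p`-th power parallelogram inequality characterizes disjointness
(`LpSum.disj_iff`), so surjective linear isometries preserve it. They also preserve
indecomposability into disjoint parts, hence map each of the two summands into itself
(`map_snd_eq_zero`, `map_fst_eq_zero`). If `T` is an isomorphism onto the presentation, then the
`ℓᵖ` part of the preimage of the root of component `3 * e` has norm one or zero according to whether
`e ∈ ∅''` (`norm_fst_symm_rootIndex`). With an oracle for `T`, one searches for a ball that is sent
to a small ball near that root. As `T` is isometric, the centre of the ball found is near the
preimage, and the norm of the `ℓᵖ` part of the centre is computable. Such a search consults only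
finite pieces of the oracle, which is how it is formalized (`RecursiveIn.exists_evalList`,
`recursiveIn_of_initialSegments`). -/

/-! ### Oracle computations with initial segments of the oracle -/

section

open Encodable Denumerable
open Nat.Partrec (Code)

namespace OracleCode

/-- Replace the oracle instruction by a program `o`. -/
def toCode (o : Code) : OracleCode → Code
  | zero => .zero
  | succ => .succ
  | left => .left
  | right => .right
  | oracle => o
  | pair cf cg => .pair (toCode o cf) (toCode o cg)
  | comp cf cg => .comp (toCode o cf) (toCode o cg)
  | prec cf cg => .prec (toCode o cf) (toCode o cg)
  | rfind' cf => .rfind' (toCode o cf)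

theorem eval_prec_zero (g : ℕ → ℕ) (cf cg : OracleCode) (a : ℕ) :
    eval g (prec cf cg) (Nat.pair a 0) = eval g cf a := by
  simp [eval, Nat.unpaired, Nat.unpair_pair]

theorem mem_eval_pair {g : ℕ → ℕ} {cf cg : OracleCode} {x y : ℕ} :
    y ∈ eval g (pair cf cg) x ↔ ∃ a ∈ eval g cf x, ∃ b ∈ eval g cg x, Nat.pair a b = y := by
  simp [eval, Seq.seq]

theorem mem_eval_comp {g : ℕ → ℕ} {cf cg : OracleCode} {x y : ℕ} :
    y ∈ eval g (comp cf cg) x ↔ ∃ a ∈ eval g cg x, y ∈ eval g cf a :=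
  Part.mem_bind_iff

theorem mem_eval_prec_succ {g : ℕ → ℕ} {cf cg : OracleCode} {a k y : ℕ} :
    y ∈ eval g (prec cf cg) (Nat.pair a (k + 1)) ↔
      ∃ i ∈ eval g (prec cf cg) (Nat.pair a k), y ∈ eval g cg (Nat.pair a (Nat.pair k i)) := by
  simp [eval, Nat.unpaired, Nat.unpair_pair]

theorem mem_eval_rfind' {g : ℕ → ℕ} {cf : OracleCode} {x y : ℕ} :
    y ∈ eval g (rfind' cf) x ↔ ∃ n, (0 ∈ eval g cf (Nat.pair x.unpair.1 (n + x.unpair.2)) ∧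
      ∀ m < n, ∃ v ∈ eval g cf (Nat.pair x.unpair.1 (m + x.unpair.2)), v ≠ 0) ∧
        n + x.unpair.2 = y := by
  refine (Part.mem_map_iff _).trans <| exists_congr fun n =>
    and_congr (Nat.mem_rfind.trans ?_) Iff.rfl
  simp

end OracleCode

namespace Nat.Partrec.Code

theorem mem_eval_pair {cf cg : Code} {x y : ℕ} :
    y ∈ eval (pair cf cg) x ↔ ∃ a ∈ eval cf x, ∃ b ∈ eval cg x, Nat.pair a b = y := by
  simp [eval, Seq.seq]

theorem mem_eval_comp {cf cg : Code} {x y : ℕ} :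
    y ∈ eval (comp cf cg) x ↔ ∃ a ∈ eval cg x, y ∈ eval cf a :=
  Part.mem_bind_iff

theorem mem_eval_prec_succ {cf cg : Code} {a k y : ℕ} :
    y ∈ eval (prec cf cg) (Nat.pair a (k + 1)) ↔
      ∃ i ∈ eval (prec cf cg) (Nat.pair a k), y ∈ eval cg (Nat.pair a (Nat.pair k i)) := by
  simp [eval, Nat.unpaired, Nat.unpair_pair]

theorem mem_eval_rfind' {cf : Code} {x y : ℕ} :
    y ∈ eval (rfind' cf) x ↔ ∃ n, (0 ∈ eval cf (Nat.pair x.unpair.1 (n + x.unpair.2)) ∧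
      ∀ m < n, ∃ v ∈ eval cf (Nat.pair x.unpair.1 (m + x.unpair.2)), v ≠ 0) ∧
        n + x.unpair.2 = y := by
  refine (Part.mem_map_iff _).trans <| exists_congr fun n =>
    and_congr (Nat.mem_rfind.trans ?_) Iff.rfl
  simp

end Nat.Partrec.Code

namespace OracleCode

/-- A run that halts has received an answer to each of its queries, and all these answers are
correct. The program `o` may diverge on other queries, so only this direction holds for a fixed `o`.
-/
theorem mem_eval_of_mem_eval_toCode {g : ℕ → ℕ} {o : Code}
    (ho : ∀ n y, y ∈ o.eval n → y = g n) (c : OracleCode) :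
    ∀ x y, y ∈ (toCode o c).eval x → y ∈ eval g c x := by
  induction c with
  | zero | succ | left | right => exact fun x y h => h
  | oracle => exact fun x y h => by simpa [eval] using ho x y h
  | pair cf cg hf hg =>
    intro x y h
    obtain ⟨a, ha, b, hb, rfl⟩ := Code.mem_eval_pair.1 h
    exact mem_eval_pair.2 ⟨a, hf _ _ ha, b, hg _ _ hb, rfl⟩
  | comp cf cg hf hg =>
    intro x y h
    obtain ⟨a, ha, hb⟩ := Code.mem_eval_comp.1 h
    exact mem_eval_comp.2 ⟨a, hg _ _ ha, hf _ _ hb⟩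
  | prec cf cg hf hg =>
    intro x
    obtain ⟨a, n, rfl⟩ : ∃ a n, x = Nat.pair a n := ⟨_, _, (Nat.pair_unpair x).symm⟩
    induction n with
    | zero =>
      intro y h
      rw [toCode, Code.eval_prec_zero] at h
      rw [eval_prec_zero]
      exact hf _ _ h
    | succ n ih =>
      intro y h
      obtain ⟨i, hi, hy⟩ := Code.mem_eval_prec_succ.1 h
      exact mem_eval_prec_succ.2 ⟨i, ih _ hi, hg _ _ hy⟩
  | rfind' cf hf =>
    intro x y h
    obtain ⟨n, ⟨h0, hn⟩, hy⟩ := Code.mem_eval_rfind'.1 h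
    refine mem_eval_rfind'.2 ⟨n, ⟨hf _ _ h0, fun m hm => ?_⟩, hy⟩
    obtain ⟨w, hw, hw0⟩ := hn m hm
    exact ⟨w, hf _ _ hw, hw0⟩

-- The use principle: a halting run asks finitely many queries, so every sufficiently long initial
-- segment answers them. Stating it eventually, not just for some `n`, lets the bounds for
-- subprograms be combined.
open Filter in
theorem eventually_mem_eval_toCode {g : ℕ → ℕ} {o : ℕ → Code}
    (ho : ∀ n, ∀ i < n, g i ∈ (o n).eval i) (c : OracleCode) :
    ∀ x y, y ∈ eval g c x → ∀ᶠ n in atTop, y ∈ (toCode (o n) c).eval x := by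
  induction c with
  | zero | succ | left | right => exact fun x y h => Eventually.of_forall fun _ => h
  | oracle =>
    intro x y h
    have h' : y = g x := by simpa [eval] using h
    filter_upwards [eventually_gt_atTop x] with n hn
    exact h' ▸ ho n x hn
  | pair cf cg hf hg =>
    intro x y h
    obtain ⟨a, ha, b, hb, rfl⟩ := mem_eval_pair.1 h
    filter_upwards [hf _ _ ha, hg _ _ hb] with n h1 h2
    exact Code.mem_eval_pair.2 ⟨a, h1, b, h2, rfl⟩
  | comp cf cg hf hg =>
    intro x y h
    obtain ⟨a, ha, hb⟩ := mem_eval_comp.1 h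
    filter_upwards [hg _ _ ha, hf _ _ hb] with n h1 h2
    exact Code.mem_eval_comp.2 ⟨a, h1, h2⟩
  | prec cf cg hf hg =>
    intro x
    obtain ⟨a, n, rfl⟩ : ∃ a n, x = Nat.pair a n := ⟨_, _, (Nat.pair_unpair x).symm⟩
    induction n with
    | zero =>
      intro y h
      rw [eval_prec_zero] at h
      simp only [toCode, Code.eval_prec_zero]
      exact hf _ _ h
    | succ n ih =>
      intro y h
      obtain ⟨i, hi, hy⟩ := mem_eval_prec_succ.1 h
      filter_upwards [ih _ hi, hg _ _ hy] with m h1 h2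
      exact Code.mem_eval_prec_succ.2 ⟨i, h1, h2⟩
  | rfind' cf hf =>
    intro x y h
    obtain ⟨n, ⟨h0, hn⟩, hy⟩ := mem_eval_rfind'.1 h
    choose! v hv hv0 using hn
    have key := (Set.finite_Iio n).eventually_all.2 fun m hm => hf _ _ (hv m hm)
    filter_upwards [hf _ _ h0, key] with k h1 h2
    exact Code.mem_eval_rfind'.2 ⟨n, ⟨h1, fun m hm => ⟨v m, h2 m hm, hv0 m hm⟩⟩, hy⟩

theorem ofNat_surjective : Function.Surjective ofNat := by
  have key : ∀ m r : ℕ, r < 4 → (4 * m + r) / 4 = m ∧ (4 * m + r) % 4 = r := by omega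
  intro c
  induction c with
  | zero => exact ⟨0, by rw [ofNat]⟩
  | succ => exact ⟨1, by rw [ofNat]⟩
  | left => exact ⟨2, by rw [ofNat]⟩
  | right => exact ⟨3, by rw [ofNat]⟩
  | oracle => exact ⟨4, by rw [ofNat]⟩
  | pair cf cg hf hg =>
    obtain ⟨a, rfl⟩ := hf
    obtain ⟨b, rfl⟩ := hg
    refine ⟨4 * Nat.pair a b + 0 + 5, ?_⟩
    simp [ofNat]
  | comp cf cg hf hg =>
    obtain ⟨a, rfl⟩ := hf
    obtain ⟨b, rfl⟩ := hg
    refine ⟨4 * Nat.pair a b + 1 + 5, ?_⟩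
    rw [ofNat, (key (Nat.pair a b) 1 (by norm_num)).1, (key (Nat.pair a b) 1 (by norm_num)).2]
    simp
  | prec cf cg hf hg =>
    obtain ⟨a, rfl⟩ := hf
    obtain ⟨b, rfl⟩ := hg
    refine ⟨4 * Nat.pair a b + 2 + 5, ?_⟩
    rw [ofNat, (key (Nat.pair a b) 2 (by norm_num)).1, (key (Nat.pair a b) 2 (by norm_num)).2]
    simp
  | rfind' cf hf =>
    obtain ⟨a, rfl⟩ := hf
    refine ⟨4 * a + 3 + 5, ?_⟩
    rw [ofNat, (key a 3 (by norm_num)).1, (key a 3 (by norm_num)).2]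
    rfl

/-- One step of the course-of-values recursion that computes `toCode o (ofNat e)` from the list of
the earlier values. -/
def toCodeStep (o : Code) (L : List Code) : Option Code :=
  let n := L.length - 5
  let a := L.getD (n / 4).unpair.1 o
  let b := L.getD (n / 4).unpair.2 o
  some <| if L.length = 0 then .zero else if L.length = 1 then .succ
    else if L.length = 2 then .left else if L.length = 3 then .right
    else if L.length = 4 then o
    else if n % 4 = 0 then .pair a b else if n % 4 = 1 then .comp a b
    else if n % 4 = 2 then .prec a b else .rfind' (L.getD (n / 4) o)

theorem primrec_toCodeStep : Primrec₂ toCodeStep := by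
  have hl : Primrec fun p : Code × List Code => p.2.length := Primrec.list_length.comp .snd
  have hn : Primrec fun p : Code × List Code => p.2.length - 5 :=
    Primrec.nat_sub.comp hl (.const 5)
  have hd : Primrec fun p : Code × List Code => (p.2.length - 5) / 4 :=
    Primrec.nat_div.comp hn (.const 4)
  have hm : Primrec fun p : Code × List Code => (p.2.length - 5) % 4 :=
    Primrec.nat_mod.comp hn (.const 4)
  have hget : ∀ f : Code × List Code → ℕ, Primrec f → Primrec fun p : Code × List Code => p.2.getD (f p) p.1 := by
    intro f hf
    refine (Primrec.option_getD.comp (Primrec.list_getElem?.comp .snd hf) .fst).of_eq ?_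
    intro p
    simp [List.getD_eq_getElem?_getD]
  have ha := hget _ (Primrec.fst.comp (Primrec.unpair.comp hd))
  have hb := hget _ (Primrec.snd.comp (Primrec.unpair.comp hd))
  have hc := hget _ hd
  have eq : ∀ {f : Code × List Code → ℕ} (_ : Primrec f) (k : ℕ), PrimrecPred fun p => f p = k :=
    fun hf k => Primrec.eq.comp hf (.const k)
  refine Primrec.option_some.comp ?_
  exact .ite (eq hl 0) (.const _) <| .ite (eq hl 1) (.const _) <| .ite (eq hl 2) (.const _) <|
    .ite (eq hl 3) (.const _) <| .ite (eq hl 4) .fst <|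
    .ite (eq hm 0) (Code.primrec₂_pair.comp ha hb) <|
    .ite (eq hm 1) (Code.primrec₂_comp.comp ha hb) <|
    .ite (eq hm 2) (Code.primrec₂_prec.comp ha hb) (Code.primrec_rfind'.comp hc)

/-- Oracle programs can thus be run by the universal evaluator for ordinary programs, uniformly in
the index and in the table of oracle answers. -/
theorem primrec_toCode : Primrec₂ fun (o : Code) (e : ℕ) => toCode o (ofNat e) := by
  refine Primrec.nat_strong_rec _ primrec_toCodeStep fun o e => ?_
  match e with
  | 0 | 1 | 2 | 3 | 4 => simp [toCodeStep, ofNat, toCode]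
  | n + 5 =>
    have h₀ : n / 4 < n + 5 := by omega
    have h₁ : (n / 4).unpair.1 < n + 5 := lt_of_le_of_lt (Nat.unpair_left_le _) h₀
    have h₂ : (n / 4).unpair.2 < n + 5 := lt_of_le_of_lt (Nat.unpair_right_le _) h₀
    have h4 : n % 4 < 4 := Nat.mod_lt _ (by norm_num)
    simp only [toCodeStep, List.length_map, List.length_range, Nat.add_sub_cancel,
      List.getD_eq_getElem?_getD, List.getElem?_map, List.getElem?_range, h₀, h₁, h₂,
      Option.map_some, Option.getD_some]
    rw [ofNat]
    generalize n / 4 = q at *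
    interval_cases n % 4 <;> simp [toCode]

end OracleCode

/-! ### Bounded runs with a finite list as oracle -/

namespace OracleCode

/-- A lookup beyond the end of the list diverges: a missing answer blocks the run and never yields a
wrong one. -/
theorem exists_lookupCode : ∃ c : Code, ∀ (l : List ℕ) (i : ℕ),
    c.eval (Nat.pair (encode l) i) = (l[i]? : Part ℕ) := by
  have h : Partrec fun n : ℕ => (((Denumerable.ofNat (List ℕ) n.unpair.1)[n.unpair.2]? : Option ℕ) : Part ℕ) :=
    Computable.ofOption <| (Primrec.list_getElem?.comp
      ((Primrec.ofNat _).comp (Primrec.fst.comp Primrec.unpair))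
      (Primrec.snd.comp Primrec.unpair)).to_comp
  obtain ⟨c, hc⟩ := Code.exists_code.1 (Partrec.nat_iff.1 h)
  exact ⟨c, fun l i => by simp [hc]⟩

/-- A program that looks up the entries of a list. -/
noncomputable def lookupCode : Code := exists_lookupCode.choose

theorem eval_lookupCode (l : List ℕ) (i : ℕ) :
    (Code.curry lookupCode (encode l)).eval i = (l[i]? : Part ℕ) := by
  rw [Code.eval_curry]
  exact exists_lookupCode.choose_spec l i

/-- Run the `e`-th program on `x` for a number of steps bounded by the length of `l`, with oracle
answers taken from initial segments of `l`. -/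
noncomputable def evalList (e x : ℕ) (l : List ℕ) : Option ℕ :=
  ((List.range (l.length + 1)).filterMap fun n =>
    Code.evaln l.length (toCode (Code.curry lookupCode (encode (l.take n))) (ofNat e)) x).head?

theorem primrec_list_take {α : Type*} [Primcodable α] :
    Primrec₂ fun (l : List α) (n : ℕ) => l.take n := by
  have h : Primrec fun p : List α × ℕ => (List.range p.2).filterMap fun i => p.1[i]? :=
    Primrec.listFilterMap (Primrec.list_range.comp .snd)
      (Primrec.list_getElem?.comp (Primrec.fst.comp .fst) .snd).to₂
  refine h.of_eq fun p => ?_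
  obtain ⟨l, n⟩ := p
  induction n with
  | zero => simp
  | succ n ih =>
    simp only at ih ⊢
    rw [List.range_succ, List.filterMap_append, ih, List.take_add_one]
    cases h : l[n]? <;> simp [h]

theorem primrec_evalList : Primrec fun p : (ℕ × ℕ) × List ℕ => evalList p.1.1 p.1.2 p.2 := by
  refine Primrec.list_head?.comp <| Primrec.listFilterMap
    (Primrec.list_range.comp <| Primrec.succ.comp <| Primrec.list_length.comp .snd) ?_
  have h1 : Primrec fun q : ((ℕ × ℕ) × List ℕ) × ℕ =>
      toCode (Code.curry lookupCode (encode (q.1.2.take q.2))) (ofNat q.1.1.1) :=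
    primrec_toCode.comp (Code.primrec₂_curry.comp (.const _)
      (Primrec.encode.comp (primrec_list_take.comp (Primrec.snd.comp .fst) .snd)))
      (Primrec.fst.comp (Primrec.fst.comp .fst))
  exact (Code.primrec_evaln.comp (((Primrec.list_length.comp (Primrec.snd.comp .fst)).pair h1).pair
    (Primrec.snd.comp (Primrec.fst.comp .fst)))).to₂

theorem evalList_isSome_iff {e x : ℕ} {l : List ℕ} : (evalList e x l).isSome ↔
    ∃ n ≤ l.length, ∃ y, y ∈ Code.evaln l.length
      (toCode (Code.curry lookupCode (encode (l.take n))) (ofNat e)) x := by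
  rw [evalList, List.isSome_head?, ne_eq, List.filterMap_eq_nil_iff]
  simp [Option.eq_none_iff_forall_ne_some]

/-- A longer table is a different program, which may need more steps, so extending the table alone
would not be monotone. Since `evalList` tries all shorter tables, the successful one is still among
them, now with a larger step bound. -/
theorem evalList_isSome_of_prefix {e x : ℕ} {l l' : List ℕ} (h : l <+: l')
    (hl : (evalList e x l).isSome) : (evalList e x l').isSome := by
  rw [evalList_isSome_iff] at hl ⊢
  obtain ⟨n, hn, y, hy⟩ := hl
  have htake : l'.take n = l.take n := by
    obtain ⟨r, rfl⟩ := h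
    exact List.take_append_of_le_length hn
  exact ⟨n, hn.trans h.length_le, y, by rw [htake]; exact Code.evaln_mono h.length_le hy⟩

theorem mem_eval_of_evalList {g : ℕ → ℕ} {e x y n : ℕ}
    (h : evalList e x ((List.range n).map g) = some y) : y ∈ eval g (ofNat e) x := by
  have := List.mem_of_mem_head? (Option.mem_def.2 h)
  obtain ⟨m, -, hm⟩ := List.mem_filterMap.1 this
  refine mem_eval_of_mem_eval_toCode (fun i z hz => ?_) _ _ _ (Code.evaln_sound hm)
  rw [eval_lookupCode] at hz
  simp only [Part.mem_coe, Option.mem_def, List.getElem?_take, List.getElem?_map] at hz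
  split_ifs at hz
  rcases lt_or_ge i n with hi | hi
  · simpa [List.getElem?_range hi, eq_comm] using hz
  · simp [List.getElem?_eq_none (l := List.range n) (by simpa using hi)] at hz

theorem mem_eval_iff_exists_evalList {g : ℕ → ℕ} {e x y : ℕ} :
    y ∈ eval g (ofNat e) x ↔ ∃ n, evalList e x ((List.range n).map g) = some y := by
  refine ⟨fun h => ?_, fun ⟨n, hn⟩ => mem_eval_of_evalList hn⟩
  have ho : ∀ n, ∀ i < n, g i ∈
      (Code.curry lookupCode (encode ((List.range n).map g))).eval i := by
    intro n i hi
    rw [eval_lookupCode]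
    simp [List.getElem?_range hi]
  obtain ⟨n, hn⟩ := (eventually_mem_eval_toCode ho _ _ _ h).exists
  obtain ⟨k, hk⟩ := Code.evaln_complete.1 hn
  -- The table length `n` and the number of steps `k` are unrelated; a list of length `max n k`
  -- allows for both.
  have hs : (evalList e x ((List.range (max n k)).map g)).isSome := by
    rw [evalList_isSome_iff]
    refine ⟨n, by simp, y, ?_⟩
    rw [← List.map_take, List.take_range, min_eq_left (le_max_left n k)]
    exact Code.evaln_mono (by simp) hk
  obtain ⟨z, hz⟩ := Option.isSome_iff_exists.1 hs
  exact ⟨_, hz.trans (congrArg some (Part.mem_unique (mem_eval_of_evalList hz) h))⟩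

/-! ### Relative computability through initial segments -/

theorem exists_eval_eq {g : ℕ → ℕ} {f : ℕ →. ℕ}
    (hf : Nat.RecursiveIn {fun n => Part.some (g n)} f) : ∃ e, eval g (ofNat e) = f := by
  suffices h : ∃ c, eval g c = f by
    obtain ⟨c, rfl⟩ := h
    obtain ⟨e, rfl⟩ := ofNat_surjective c
    exact ⟨e, rfl⟩
  induction hf with
  | zero => exact ⟨zero, rfl⟩
  | succ => exact ⟨succ, rfl⟩
  | left => exact ⟨left, rfl⟩
  | right => exact ⟨right, rfl⟩
  | oracle h hh => exact ⟨oracle, (Set.mem_singleton_iff.1 hh).symm⟩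
  | pair _ _ ihf ihg =>
    obtain ⟨c, rfl⟩ := ihf
    obtain ⟨d, rfl⟩ := ihg
    exact ⟨pair c d, rfl⟩
  | comp _ _ ihf ihg =>
    obtain ⟨c, rfl⟩ := ihf
    obtain ⟨d, rfl⟩ := ihg
    exact ⟨comp c d, rfl⟩
  | prec _ _ ihf ihg =>
    obtain ⟨c, rfl⟩ := ihf
    obtain ⟨d, rfl⟩ := ihg
    exact ⟨prec c d, rfl⟩
  | rfind _ ih =>
    obtain ⟨c, rfl⟩ := ih
    -- The program `pair left right` is the identity, so the search starts from `Nat.pair a 0`.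
    refine ⟨comp (rfind' c) (pair (pair left right) zero), funext fun a => Part.ext fun y => ?_⟩
    have hid : ∀ z, z ∈ eval g (pair (pair left right) zero) a ↔ z = Nat.pair a 0 := by
      intro z
      simp [eval, Seq.seq]
    rw [mem_eval_comp]
    simp only [hid, exists_eq_left, mem_eval_rfind', Nat.unpair_pair, add_zero, exists_eq_right]
    refine Iff.trans ?_ Nat.mem_rfind.symm
    simp

theorem _root_.RecursiveIn.exists_evalList {α β : Type*} [Primcodable α] [Primcodable β]
    {g : ℕ → ℕ} {P : α →. β} (hP : RecursiveIn {fun n => Part.some (g n)} P) :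
    ∃ e, ∀ a b, b ∈ P a ↔ ∃ n, evalList e (encode a) ((List.range n).map g) = some (encode b) := by
  obtain ⟨e, he⟩ := exists_eval_eq hP
  refine ⟨e, fun a b => ?_⟩
  rw [← mem_eval_iff_exists_evalList, he]
  simp

theorem recursiveIn_encode_initialSegment (g : ℕ → ℕ) :
    Nat.RecursiveIn {fun n => Part.some (g n)}
      (fun n => Part.some (encode ((List.range n).map g))) := by
  have h1 : Nat.RecursiveIn {fun n => Part.some (g n)}
      (fun n : ℕ => Part.some (g n.unpair.2.unpair.1)) := by
    have := Nat.RecursiveIn.comp (.oracle (O := {fun n => Part.some (g n)}) _ rfl)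
      (Nat.RecursiveIn.comp .left .right)
    exact this.of_eq fun n => by simp [Part.bind_some]
  have h2 : Nat.RecursiveIn {fun n => Part.some (g n)}
      (fun n : ℕ => Part.some n.unpair.2.unpair.2) := by
    have := Nat.RecursiveIn.comp (O := {fun n => Part.some (g n)}) .right .right
    exact this.of_eq fun n => by simp [Part.bind_some]
  have h3 : Nat.RecursiveIn {fun n => Part.some (g n)}
      (fun n : ℕ => Part.some (encode (Denumerable.ofNat (List ℕ) n.unpair.1 ++ [n.unpair.2]))) := by
    refine Nat.Partrec.recursiveIn (Nat.Partrec.of_primrec (Primrec.nat_iff.1 ?_))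
    exact Primrec.encode.comp (Primrec.list_concat.comp
      ((Primrec.ofNat _).comp (Primrec.fst.comp Primrec.unpair)) (Primrec.snd.comp Primrec.unpair))
  have h4 := Nat.RecursiveIn.comp h3 (h2.pair h1)
  have h5 : Nat.RecursiveIn {fun n => Part.some (g n)} (fun _ => Part.some (encode ([] : List ℕ))) :=
    Nat.Partrec.recursiveIn (Nat.Partrec.of_primrec (Nat.Primrec.const _))
  have h6 : Nat.RecursiveIn {fun n => Part.some (g n)} (fun n => Part.some (Nat.pair 0 n)) :=
    Nat.Partrec.recursiveIn (Nat.Partrec.of_primrec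
      (Primrec.nat_iff.1 (Primrec₂.natPair.comp (.const 0) .id)))
  refine (Nat.RecursiveIn.comp (h5.prec h4) h6).of_eq fun n => ?_
  rw [Part.bind_eq_bind, Part.bind_some]
  simp only [Nat.unpair_pair]
  induction n with
  | zero => simp
  | succ n ih =>
    dsimp only
    rw [ih]
    simp [List.range_succ, Seq.seq]

/-- Search for the first initial segment on which `F` gives an answer. Every answer is correct, so
it does not matter which one is found, and no monotonicity of `F` is needed. -/
theorem recursiveIn_of_initialSegments {g f : ℕ → ℕ} {F : ℕ → List ℕ → Option ℕ}
    (hF : Computable₂ F) (hex : ∀ e, ∃ n, (F e ((List.range n).map g)).isSome)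
    (hcorrect : ∀ e n v, F e ((List.range n).map g) = some v → v = f e) :
    Nat.RecursiveIn {fun n => Part.some (g n)} (fun e => Part.some (f e)) := by
  set O : Set (ℕ →. ℕ) := {fun n => Part.some (g n)}
  have hseg : Nat.RecursiveIn O (fun p : ℕ => Part.some
      (Nat.pair p.unpair.1 (encode ((List.range p.unpair.2).map g)))) := by
    have := Nat.RecursiveIn.pair (O := O) .left
      ((recursiveIn_encode_initialSegment g).comp .right)
    exact this.of_eq fun n => by simp [Part.bind_some, Seq.seq]
  have hF' : Computable fun p : ℕ => F p.unpair.1 (Denumerable.ofNat (List ℕ) p.unpair.2) :=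
    hF.comp (Computable.fst.comp Computable.unpair)
      ((Computable.ofNat _).comp (Computable.snd.comp Computable.unpair))
  have hG : Nat.RecursiveIn O (fun p : ℕ => Part.some
      (bif (F p.unpair.1 (Denumerable.ofNat (List ℕ) p.unpair.2)).isSome then 0 else 1)) :=
    Nat.Partrec.recursiveIn <| Partrec.nat_iff.1 <| Computable.partrec <|
      Computable.cond (Primrec.option_isSome.to_comp.comp hF') (.const 0) (.const 1)
  have hH : Nat.RecursiveIn O (fun p : ℕ => Part.some
      ((F p.unpair.1 (Denumerable.ofNat (List ℕ) p.unpair.2)).getD 0)) :=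
    Nat.Partrec.recursiveIn <| Partrec.nat_iff.1 <| Computable.partrec <|
      Computable.option_getD hF' (.const 0)
  have hI : Nat.RecursiveIn O (fun n => Part.some n) :=
    Nat.Partrec.recursiveIn (Nat.Partrec.of_primrec Nat.Primrec.id)
  have hK := (hH.comp hseg).comp (hI.pair (hG.comp hseg).rfind)
  refine hK.of_eq fun e => ?_
  have hdom : (Nat.rfind fun n => (fun m => decide (m = 0)) <$>
      ((Part.some (Nat.pair (Nat.pair e n).unpair.1
        (encode ((List.range (Nat.pair e n).unpair.2).map g)))) >>= fun p : ℕ => Part.some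
      (bif (F p.unpair.1 (Denumerable.ofNat (List ℕ) p.unpair.2)).isSome then 0 else 1))).Dom := by
    refine Nat.rfind_dom.2 ?_
    obtain ⟨n, hn⟩ := hex e
    exact ⟨n, by simp [hn, Part.bind_some], fun {m} _ => by simp [Part.bind_some]⟩
  obtain ⟨n, hn⟩ := Part.dom_iff_mem.1 hdom
  have hspec := Nat.rfind_spec hn
  simp only [Nat.unpair_pair, Part.bind_eq_bind, Part.bind_some, ofNat_encode, Part.map_eq_map,
    Part.map_some, Part.mem_some_iff] at hspec
  have hsome : (F e ((List.range n).map g)).isSome := by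
    cases h : (F e ((List.range n).map g)).isSome
    · simp [h] at hspec
    · rfl
  obtain ⟨v, hv⟩ := Option.isSome_iff_exists.1 hsome
  simp only [Part.eq_some_iff.2 hn]
  simp [Seq.seq, Part.bind_some, hv, hcorrect e n v hv]

end OracleCode

end

/-! ### Components whose atomicity codes the second jump -/

section

open Encodable Denumerable OracleCode

/-- The approximation to the halting problem after `s` steps. -/
noncomputable def haltApprox (s i : ℕ) : ℕ :=
  bif (evalList i i (List.replicate s 0)).isSome then 1 else 0

theorem primrec_haltApprox : Primrec₂ haltApprox := by
  refine Primrec.cond (Primrec.option_isSome.comp (primrec_evalList.comp ((Primrec.snd.pair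
    Primrec.snd).pair ?_))) (.const 1) (.const 0)
  have : Primrec fun p : ℕ × ℕ => (List.range p.1).map fun _ => (0 : ℕ) :=
    Primrec.list_map (Primrec.list_range.comp .fst) (Primrec₂.const 0)
  exact this.of_eq fun p => by simp

theorem mem_turingJump_iff {A : Set ℕ} {e : ℕ} : e ∈ turingJump A ↔
    ∃ n, (evalList e e ((List.range n).map (_root_.charFun A))).isSome := by
  simp only [turingJump, Set.mem_ofPred_eq, Part.dom_iff_mem, mem_eval_iff_exists_evalList,
    Option.isSome_iff_exists]
  exact exists_comm

theorem haltApprox_mono {s t i : ℕ} (h : s ≤ t) : haltApprox s i ≤ haltApprox t i := by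
  unfold haltApprox
  cases hs : (evalList i i (List.replicate s 0)).isSome
  · simp
  · have : List.replicate s 0 <+: List.replicate t 0 :=
      ⟨List.replicate (t - s) 0, by rw [← List.replicate_add, Nat.add_sub_cancel' h]⟩
    simp [evalList_isSome_of_prefix this hs]

-- All answers of the empty oracle are zero, so a list of zeros serves both as its initial segment
-- and as the clock. The approximation changes at most once, from `0` to `1`.
open Filter in
theorem eventually_haltApprox_eq (i : ℕ) :
    ∀ᶠ s in atTop, haltApprox s i = _root_.charFun (turingJump ∅) i := by
  have h0 : ∀ n, (List.range n).map (_root_.charFun ∅) = List.replicate n 0 := fun n =>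
    List.eq_replicate_iff.2 (by simp [_root_.charFun])
  by_cases h : i ∈ turingJump ∅
  · obtain ⟨n, hn⟩ := mem_turingJump_iff.1 h
    rw [h0] at hn
    filter_upwards [eventually_ge_atTop n] with s hs
    have h1 : 1 ≤ haltApprox s i :=
      le_trans (by simp [haltApprox, hn]) (haltApprox_mono hs)
    have h2 : haltApprox s i ≤ 1 := by
      unfold haltApprox
      cases (evalList i i (List.replicate s 0)).isSome <;> simp
    simp [_root_.charFun, h, le_antisymm h2 h1]
  · refine Eventually.of_forall fun s => ?_
    have hn : ¬ (evalList i i (List.replicate s 0)).isSome := fun hs =>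
      h (mem_turingJump_iff.2 ⟨s, by rwa [h0]⟩)
    simp [haltApprox, _root_.charFun, h, Option.not_isSome_iff_eq_none.1 hn]

/-- At stage `t`, the pair `w = ⟨n, s⟩` still looks like a witness for `e ∈ ∅''`: the initial
segment of length `n` of the halting problem has not changed since stage `s`, and the `e`-th program
halts with this initial segment as oracle. -/
noncomputable def jumpWitness (e w t : ℕ) : Bool :=
  ((List.range w.unpair.1).map (haltApprox w.unpair.2) ==
    (List.range w.unpair.1).map (haltApprox (w.unpair.2 + t))) &&
  (evalList e e ((List.range w.unpair.1).map (haltApprox w.unpair.2))).isSome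

theorem primrec_jumpWitness : Primrec fun p : (ℕ × ℕ) × ℕ => jumpWitness p.1.1 p.1.2 p.2 := by
  have hn : Primrec fun p : (ℕ × ℕ) × ℕ => p.1.2.unpair.1 :=
    Primrec.fst.comp (Primrec.unpair.comp (Primrec.snd.comp .fst))
  have hs : Primrec fun p : (ℕ × ℕ) × ℕ => p.1.2.unpair.2 :=
    Primrec.snd.comp (Primrec.unpair.comp (Primrec.snd.comp .fst))
  have he : Primrec fun p : (ℕ × ℕ) × ℕ => p.1.1 := Primrec.fst.comp .fst
  have hl : ∀ f : (ℕ × ℕ) × ℕ → ℕ, Primrec f →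
      Primrec fun p => (List.range p.1.2.unpair.1).map (haltApprox (f p)) := fun f hf =>
    Primrec.list_map (Primrec.list_range.comp hn) (primrec_haltApprox.comp (hf.comp .fst) .snd).to₂
  have h1 := Primrec.beq.comp (hl _ hs) (hl _ (Primrec.nat_add.comp hs .snd))
  have h2 := Primrec.option_isSome.comp (primrec_evalList.comp ((he.pair he).pair (hl _ hs)))
  exact (Primrec.and.comp h1 h2).of_eq fun p => by rw [Bool.eq_iff_iff]; simp [jumpWitness]

theorem jumpWitness_antitone {e w s t : ℕ} (h : s ≤ t) (ht : jumpWitness e w t = true) :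
    jumpWitness e w s = true := by
  simp only [jumpWitness, Bool.and_eq_true, beq_iff_eq, List.map_inj_left, List.mem_range] at ht ⊢
  refine ⟨fun i hi => le_antisymm (haltApprox_mono (by omega)) ?_, ht.2⟩
  rw [ht.1 i hi]
  exact haltApprox_mono (by omega)

-- This is the `Σ₂` form of the second jump. A halting run uses finitely many values of the halting
-- problem, and these settle from some stage on; conversely, an approximation that never changes
-- again is correct.
open Filter in
theorem mem_turingJump_turingJump_iff {e : ℕ} :
    e ∈ turingJump (turingJump ∅) ↔ ∃ w, ∀ t, jumpWitness e w t = true := by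
  rw [mem_turingJump_iff]
  constructor
  · rintro ⟨n, hn⟩
    obtain ⟨s, hs⟩ := eventually_atTop.1 ((Set.finite_Iio n).eventually_all.2 fun i _ =>
      eventually_haltApprox_eq i)
    have h : ∀ t ≥ s, (List.range n).map (haltApprox t) =
        (List.range n).map (_root_.charFun (turingJump ∅)) := fun t ht =>
      List.map_congr_left fun i hi => hs t ht i (List.mem_range.1 hi)
    refine ⟨Nat.pair n s, fun t => ?_⟩
    simp [jumpWitness, h s le_rfl, h (s + t) (Nat.le_add_right s t), hn]
  · rintro ⟨w, hw⟩
    simp only [jumpWitness, Bool.and_eq_true, beq_iff_eq, List.map_inj_left, List.mem_range] at hw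
    refine ⟨w.unpair.1, ?_⟩
    rw [← List.map_congr_left fun i hi => ?_]
    · exact (hw 0).2
    · obtain ⟨s, hs⟩ := eventually_atTop.1 (eventually_haltApprox_eq i)
      rw [(hw s).1 i (List.mem_range.1 hi), hs _ (Nat.le_add_left _ _)]

/-! ### A computable counter that is bounded exactly on the second jump -/

theorem exists_forall_le_of_bounded {f : ℕ → ℕ} {K : ℕ} (hK : ∀ s, f s ≤ K) :
    ∃ s, ∀ t, f t ≤ f s := by
  have hb : BddAbove (Set.range f) := ⟨K, by rintro _ ⟨s, rfl⟩; exact hK s⟩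
  obtain ⟨s, hs⟩ := Nat.sSup_mem (Set.range_nonempty f) hb
  exact ⟨s, fun t => hs ▸ le_csSup hb ⟨t, rfl⟩⟩

/-- The witness for `e ∈ ∅''` that is under consideration at stage `s`. -/
noncomputable def candidate (e s : ℕ) : ℕ :=
  Nat.rec 0 (fun t w => bif jumpWitness e w t then w else w + 1) s

theorem candidate_succ (e s : ℕ) : candidate e (s + 1) =
    bif jumpWitness e (candidate e s) s then candidate e s else candidate e s + 1 := rfl

theorem primrec_candidate : Primrec₂ candidate := by
  have h : Primrec fun p : ℕ × ℕ × ℕ => p.2.2 := Primrec.snd.comp .snd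
  have hs : Primrec fun p : ℕ × ℕ × ℕ => p.2.2 + 1 := Primrec.succ.comp h
  have hq : Primrec fun p : ℕ × ℕ × ℕ => (((p.1, p.2.2), p.2.1) : (ℕ × ℕ) × ℕ) :=
    (Primrec.fst.pair h).pair (Primrec.fst.comp .snd)
  have hj := primrec_jumpWitness.comp hq
  have h2 : Primrec₂ fun (e : ℕ) (q : ℕ × ℕ) =>
      bif jumpWitness e q.2 q.1 then q.2 else q.2 + 1 := Primrec.cond hj h hs
  exact Primrec.nat_rec (Primrec.const 0) h2

theorem candidate_le_succ (e s : ℕ) : candidate e s ≤ candidate e (s + 1) := by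
  rw [candidate_succ]
  cases jumpWitness e (candidate e s) s <;> simp

/-- The counter cannot pass a true witness, which is never refuted. If it is bounded, it stabilizes
at a number that survives all later tests, and by antitonicity all earlier ones too. -/
theorem mem_turingJump_turingJump_iff_candidate {e : ℕ} :
    e ∈ turingJump (turingJump ∅) ↔ ∃ K, ∀ s, candidate e s ≤ K := by
  rw [mem_turingJump_turingJump_iff]
  constructor
  · rintro ⟨w, hw⟩
    refine ⟨w, fun s => ?_⟩
    induction s with
    | zero => exact Nat.zero_le _
    | succ s ih =>
      rw [candidate_succ]
      rcases ih.lt_or_eq with h | h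
      · cases jumpWitness e (candidate e s) s
        · exact h
        · exact ih
      · simp [h, hw]
  · rintro ⟨K, hK⟩
    have hmono : Monotone (candidate e) := monotone_nat_of_le_succ (candidate_le_succ e)
    obtain ⟨s, hs⟩ : ∃ s, ∀ t ≥ s, candidate e t = candidate e s := by
      obtain ⟨s, hs⟩ := exists_forall_le_of_bounded hK
      exact ⟨s, fun t ht => le_antisymm (hs t) (hmono ht)⟩
    refine ⟨candidate e s, fun t => jumpWitness_antitone (Nat.le_add_left t s) ?_⟩
    have h := candidate_succ e (s + t)
    rw [hs (s + t) (Nat.le_add_right s t), hs (s + t + 1) (by omega)] at h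
    cases hj : jumpWitness e (candidate e s) (s + t)
    · simp [hj] at h
    · rfl

/-- The number of splittings that the `c`-th component of the space has undergone at stage `s`.
The components `3 * e` decide `∅''`; the others ensure that there are infinitely many components of
either kind. -/
noncomputable def level (c s : ℕ) : ℕ :=
  if c % 3 = 0 then candidate (c / 3) s else if c % 3 = 1 then s else 0

theorem primrec_level : Primrec₂ level := by
  have hm : Primrec fun p : ℕ × ℕ => p.1 % 3 := Primrec.nat_mod.comp .fst (.const 3)
  exact .ite (Primrec.eq.comp hm (.const 0))
    (primrec_candidate.comp (Primrec.nat_div.comp .fst (.const 3)) .snd)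
    (.ite (Primrec.eq.comp hm (.const 1)) .snd (.const 0))

theorem level_zero (c : ℕ) : level c 0 = 0 := by
  simp [level, candidate]

theorem level_mono (c : ℕ) : Monotone (level c) := by
  refine monotone_nat_of_le_succ fun s => ?_
  unfold level
  split_ifs
  · exact candidate_le_succ _ _
  · exact Nat.le_succ s
  · exact le_rfl

theorem level_succ_le (c s : ℕ) : level c (s + 1) ≤ level c s + 1 := by
  unfold level
  split_ifs
  · rw [candidate_succ]
    cases jumpWitness (c / 3) (candidate (c / 3) s) s <;> simp
  · exact le_rfl
  · exact Nat.zero_le _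

/-- Levels are never skipped. Hence the presentation contains the nodes of every level of a diffuse
component, which the density argument needs. -/
theorem exists_level_eq {c k s : ℕ} (h : k ≤ level c s) : ∃ t, level c t = k := by
  induction s with
  | zero => exact ⟨0, by rw [level_zero] at h ⊢; omega⟩
  | succ s ih =>
    rcases h.lt_or_eq with h | h
    · exact ih (Nat.le_of_lt_succ (h.trans_le (level_succ_le c s)))
    · exact ⟨s + 1, h.symm⟩

/-- The components that are split only finitely often. -/
def IsAtomicComponent (c : ℕ) : Prop := ∃ K, ∀ s, level c s ≤ K

theorem isAtomicComponent_three_mul {e : ℕ} :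
    IsAtomicComponent (3 * e) ↔ e ∈ turingJump (turingJump ∅) := by
  simp [mem_turingJump_turingJump_iff_candidate, IsAtomicComponent, level]

theorem infinite_isAtomicComponent : {c | IsAtomicComponent c}.Infinite := by
  refine Set.infinite_of_injective_forall_mem (f := fun n => 3 * n + 2)
    (fun a b h => by simpa using h) fun n => ⟨0, fun s => ?_⟩
  rw [level, if_neg (by omega), if_neg (by omega)]

theorem infinite_not_isAtomicComponent : {c | ¬ IsAtomicComponent c}.Infinite := by
  refine Set.infinite_of_injective_forall_mem (f := fun n => 3 * n + 1)
    (fun a b h => by simpa using h) fun n => ?_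
  rintro ⟨K, hK⟩
  have := hK (K + 1)
  rw [level, if_neg (by omega), if_pos (by omega)] at this
  omega

theorem IsAtomicComponent.exists_level_eq_max {c : ℕ} (hc : IsAtomicComponent c) :
    ∃ K, (∀ s, level c s ≤ K) ∧ ∃ s, level c s = K := by
  obtain ⟨K, hK⟩ := hc
  obtain ⟨s, hs⟩ := exists_forall_le_of_bounded hK
  exact ⟨_, hs, s, rfl⟩

end

/-! ### Computable real functions -/

section

open Encodable Denumerable

theorem Primrec.nat_pow : Primrec₂ ((· ^ ·) : ℕ → ℕ → ℕ) :=
  Primrec₂.unpaired'.1 Nat.Primrec.pow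

/-- The fold is a recursion on the position in the list, with the entry looked up at each step. -/
theorem Computable.list_foldl {α β σ : Type*} [Primcodable α] [Primcodable β] [Primcodable σ]
    {f : α → List β} {g : α → σ} {h : α → σ × β → σ} (hf : Computable f) (hg : Computable g)
    (hh : Computable₂ h) : Computable fun a => (f a).foldl (fun s b => h a (s, b)) (g a) := by
  have h1 : Computable fun p : α × ℕ × σ => (f p.1)[p.2.1]? :=
    Computable.list_getElem?.comp (hf.comp .fst) (Computable.fst.comp .snd)
  have h2 : Computable₂ fun (p : α × ℕ × σ) (b : β) => h p.1 (p.2.2, b) := by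
    have h3 : Computable fun q : (α × ℕ × σ) × β => (q.1.2.2, q.2) :=
      (Computable.snd.comp (Computable.snd.comp .fst)).pair .snd
    have h4 := hh.comp (Computable.fst.comp .fst) h3
    exact h4
  have h5 : Computable₂ fun (a : α) (p : ℕ × σ) =>
      Option.casesOn (motive := fun _ => σ) ((f a)[p.1]?) p.2 fun b => h a (p.2, b) := by
    have := Computable.option_casesOn h1 (Computable.snd.comp .snd) h2
    exact this
  refine (Computable.nat_rec (Computable.list_length.comp hf) hg h5).of_eq fun a => ?_
  have key : ∀ n ≤ (f a).length, (Nat.rec (g a) (fun y IH =>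
      Option.casesOn (motive := fun _ => σ) ((f a)[y]?) IH fun b => h a (IH, b)) n : σ) =
      ((f a).take n).foldl (fun s b => h a (s, b)) (g a) := by
    intro n hn
    induction n with
    | zero => simp
    | succ n ih =>
      have hn' : n < (f a).length := hn
      simp only [ih hn'.le, List.getElem?_eq_getElem hn']
      rw [List.take_add_one, List.foldl_append, List.getElem?_eq_getElem hn']
      rfl
  simpa using key _ le_rfl

/-! ### Arithmetic of codes for rational numbers -/

namespace RatCode

/-- A code for the sum of two rational numbers. -/
def add (x y : RatCode) : RatCode :=
  (x.1 * (y.2.2 + 1) + y.1 * (x.2.2 + 1), x.2.1 * (y.2.2 + 1) + y.2.1 * (x.2.2 + 1),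
    x.2.2 * y.2.2 + x.2.2 + y.2.2)

/-- A code for the product of two rational numbers. -/
def mul (x y : RatCode) : RatCode :=
  (x.1 * y.1 + x.2.1 * y.2.1, x.1 * y.2.1 + x.2.1 * y.1, x.2.2 * y.2.2 + x.2.2 + y.2.2)

/-- A code for the quotient of a rational number by `2 ^ n`. -/
def divTwoPow (x : RatCode) (n : ℕ) : RatCode :=
  (x.1, x.2.1, (x.2.2 + 1) * 2 ^ n - 1)

theorem val_add (x y : RatCode) : (add x y).val = x.val + y.val := by
  simp only [val, add]
  push_cast
  field_simp
  ring

theorem val_mul (x y : RatCode) : (mul x y).val = x.val * y.val := by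
  simp only [val, mul]
  push_cast
  field_simp
  ring

theorem val_divTwoPow (x : RatCode) (n : ℕ) : (divTwoPow x n).val = x.val / 2 ^ n := by
  simp only [val, divTwoPow]
  rw [Nat.cast_sub (Nat.mul_pos (Nat.succ_pos _) (pow_pos two_pos n))]
  push_cast
  field_simp
  ring

theorem primrec_add : Primrec₂ add := by
  have a1 : Primrec fun p : RatCode × RatCode => p.1.1 := Primrec.fst.comp .fst
  have b1 : Primrec fun p : RatCode × RatCode => p.1.2.1 :=
    Primrec.fst.comp (Primrec.snd.comp .fst)
  have c1 : Primrec fun p : RatCode × RatCode => p.1.2.2 :=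
    Primrec.snd.comp (Primrec.snd.comp .fst)
  have a2 : Primrec fun p : RatCode × RatCode => p.2.1 := Primrec.fst.comp .snd
  have b2 : Primrec fun p : RatCode × RatCode => p.2.2.1 :=
    Primrec.fst.comp (Primrec.snd.comp .snd)
  have c2 : Primrec fun p : RatCode × RatCode => p.2.2.2 :=
    Primrec.snd.comp (Primrec.snd.comp .snd)
  have d1 := Primrec.succ.comp c1
  have d2 := Primrec.succ.comp c2
  have h := (Primrec.nat_add.comp (Primrec.nat_mul.comp a1 d2) (Primrec.nat_mul.comp a2 d1)).pair
    ((Primrec.nat_add.comp (Primrec.nat_mul.comp b1 d2) (Primrec.nat_mul.comp b2 d1)).pair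
    (Primrec.nat_add.comp (Primrec.nat_add.comp (Primrec.nat_mul.comp c1 c2) c1) c2))
  exact h

theorem primrec_mul : Primrec₂ mul := by
  have a1 : Primrec fun p : RatCode × RatCode => p.1.1 := Primrec.fst.comp .fst
  have b1 : Primrec fun p : RatCode × RatCode => p.1.2.1 :=
    Primrec.fst.comp (Primrec.snd.comp .fst)
  have c1 : Primrec fun p : RatCode × RatCode => p.1.2.2 :=
    Primrec.snd.comp (Primrec.snd.comp .fst)
  have a2 : Primrec fun p : RatCode × RatCode => p.2.1 := Primrec.fst.comp .snd
  have b2 : Primrec fun p : RatCode × RatCode => p.2.2.1 :=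
    Primrec.fst.comp (Primrec.snd.comp .snd)
  have c2 : Primrec fun p : RatCode × RatCode => p.2.2.2 :=
    Primrec.snd.comp (Primrec.snd.comp .snd)
  have h := (Primrec.nat_add.comp (Primrec.nat_mul.comp a1 a2) (Primrec.nat_mul.comp b1 b2)).pair
    ((Primrec.nat_add.comp (Primrec.nat_mul.comp a1 b2) (Primrec.nat_mul.comp b1 a2)).pair
    (Primrec.nat_add.comp (Primrec.nat_add.comp (Primrec.nat_mul.comp c1 c2) c1) c2))
  exact h

theorem primrec_divTwoPow : Primrec₂ divTwoPow := by
  have h := (Primrec.fst.comp (Primrec.fst (α := RatCode) (β := ℕ))).pair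
    ((Primrec.fst.comp (Primrec.snd.comp (Primrec.fst (α := RatCode) (β := ℕ)))).pair
    (Primrec.nat_sub.comp (Primrec.nat_mul.comp
      (Primrec.succ.comp (Primrec.snd.comp (Primrec.snd.comp Primrec.fst)))
      (Primrec.nat_pow.comp (.const 2) .snd)) (.const 1)))
  exact h

end RatCode

/-- A real-valued function is computable if an algorithm produces, given `a` and `k`, a rational
number that is within `2⁻ᵏ` of `f a`. -/
def ComputableRealFun {α : Type*} [Primcodable α] (f : α → ℝ) : Prop :=
  ∃ q : α × ℕ → RatCode, Computable q ∧
    ∀ a k, |((q (a, k)).val : ℝ) - f a| < ((2 : ℝ) ^ k)⁻¹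

theorem IsComputableReal.half {x : ℝ} (hx : IsComputableReal x) : IsComputableReal (x / 2) := by
  obtain ⟨f, hf, h⟩ := hx
  refine ⟨fun k => (f k).divTwoPow 1, RatCode.primrec_divTwoPow.to_comp.comp hf (.const 1),
    fun k => ?_⟩
  rw [RatCode.val_divTwoPow]
  have := h k
  push_cast
  rw [pow_one, ← sub_div, abs_div, abs_two]
  have := abs_nonneg ((f k).val - x : ℝ)
  linarith

theorem IsComputableReal.inv {x : ℝ} (hx : IsComputableReal x) (h1 : 1 ≤ x) :
    IsComputableReal x⁻¹ := by
  obtain ⟨f, hf, h⟩ := hx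
  have hf' : Computable fun k => f (k + 2) := hf.comp (Computable.succ.comp Computable.succ)
  -- Numerator and denominator are exchanged, the last entry of a code being one less than its
  -- denominator. As `1 ≤ x`, the approximation exceeds `3/4`, so inversion enlarges the error by a
  -- factor of at most `4/3`, which two extra bits absorb.
  refine ⟨fun k => ((f (k + 2)).2.2 + 1, 0, (f (k + 2)).1 - (f (k + 2)).2.1 - 1), ?_, fun k => ?_⟩
  · have h1 : Primrec fun q : RatCode => ((q.2.2 + 1, 0, q.1 - q.2.1 - 1) : RatCode) :=
      (Primrec.succ.comp (Primrec.snd.comp .snd)).pair ((Primrec.const 0).pair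
        (Primrec.nat_sub.comp (Primrec.nat_sub.comp .fst (Primrec.fst.comp .snd)) (.const 1)))
    have := h1.to_comp.comp hf'
    exact this
  · have hk := h (k + 2)
    have hle : ((2 : ℝ) ^ (k + 2))⁻¹ ≤ 1 / 4 := by
      rw [pow_add, mul_inv]
      have : ((2 : ℝ) ^ k)⁻¹ ≤ 1 := inv_le_one_of_one_le₀ (one_le_pow₀ one_le_two)
      norm_num
      linarith
    set s : ℝ := ((f (k + 2)).val : ℝ) with hs
    have hs1 : 3 / 4 < s := by
      have := (abs_lt.1 hk).1
      linarith
    have hval : s = (((f (k + 2)).1 : ℝ) - (f (k + 2)).2.1) / ((f (k + 2)).2.2 + 1) := by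
      rw [hs, RatCode.val]
      push_cast
      rfl
    have hlt : (f (k + 2)).2.1 < (f (k + 2)).1 := by
      by_contra hcon
      have h3 : ((f (k + 2)).1 : ℝ) ≤ (f (k + 2)).2.1 := by exact_mod_cast not_lt.1 hcon
      have : s ≤ 0 := by
        rw [hval]
        exact div_nonpos_of_nonpos_of_nonneg (by linarith) (by positivity)
      linarith
    have hinv : (RatCode.val ((f (k + 2)).2.2 + 1, 0, (f (k + 2)).1 - (f (k + 2)).2.1 - 1) : ℝ)
        = s⁻¹ := by
      rw [hval, RatCode.val, inv_div, Nat.cast_sub (by omega), Nat.cast_sub hlt.le]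
      push_cast
      ring
    have hx0 : x ≠ 0 := by linarith
    have hs0 : s ≠ 0 := by linarith
    rw [hinv, inv_sub_inv hs0 hx0, abs_div, abs_sub_comm, div_lt_iff₀ (by positivity), abs_mul,
      abs_of_pos (by linarith : 0 < s), abs_of_pos (by linarith : 0 < x)]
    have h34 : 3 / 4 ≤ s * x := by nlinarith
    refine hk.trans_le ?_
    rw [pow_add, mul_inv]
    have : 0 < ((2 : ℝ) ^ k)⁻¹ := by positivity
    nlinarith

namespace ComputableRealFun

variable {α β : Type*} [Primcodable α] [Primcodable β]

theorem of_eq {f g : α → ℝ} (hf : ComputableRealFun f) (h : ∀ a, f a = g a) :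
    ComputableRealFun g :=
  funext h ▸ hf

theorem comp {f : β → ℝ} (hf : ComputableRealFun f) {g : α → β} (hg : Computable g) :
    ComputableRealFun fun a => f (g a) := by
  obtain ⟨q, hq, h⟩ := hf
  exact ⟨fun p => q (g p.1, p.2), hq.comp ((hg.comp .fst).pair .snd), fun a k => h _ k⟩

theorem of_rat {f : α → RatCode} (hf : Computable f) :
    ComputableRealFun fun a => ((f a).val : ℝ) :=
  ⟨fun p => f p.1, hf.comp .fst, fun a k => by simp⟩

theorem div_two_pow {f : α → ℝ} (hf : ComputableRealFun f) {n : α → ℕ} (hn : Computable n) :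
    ComputableRealFun fun a => f a / 2 ^ n a := by
  obtain ⟨q, hq, h⟩ := hf
  refine ⟨fun p => (q p).divTwoPow (n p.1),
    RatCode.primrec_divTwoPow.to_comp.comp hq (hn.comp .fst), fun a k => ?_⟩
  rw [RatCode.val_divTwoPow]
  push_cast
  rw [← sub_div, abs_div, abs_of_pos (by positivity : (0 : ℝ) < 2 ^ n a)]
  exact (div_le_self (abs_nonneg _) (one_le_pow₀ one_le_two)).trans_lt (h a k)

theorem list_sum {l : α → List β} (hl : Computable l) {f : α → β → ℝ}
    (hf : ComputableRealFun fun p : α × β => f p.1 p.2) :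
    ComputableRealFun fun a => ((l a).map (f a)).sum := by
  obtain ⟨q, hq, h⟩ := hf
  -- Each of the `n` summands is approximated with `n` extra bits; the total error is at most `n *
  -- 2⁻⁽ᵏ⁺ⁿ⁾ < 2⁻ᵏ`.
  have h1 : Computable fun p : (α × ℕ) × RatCode × β =>
      (((p.1.1, p.2.2), p.1.2 + (l p.1.1).length) : (α × β) × ℕ) :=
    ((Computable.fst.comp .fst).pair (Computable.snd.comp .snd)).pair
      (Primrec.nat_add.to_comp.comp (Computable.snd.comp .fst)
        (Computable.list_length.comp (hl.comp (Computable.fst.comp .fst))))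
  have h2 : Computable₂ fun (p : α × ℕ) (r : RatCode × β) =>
      r.1.add (q ((p.1, r.2), p.2 + (l p.1).length)) := by
    have := RatCode.primrec_add.to_comp.comp (Computable.fst.comp Computable.snd) (hq.comp h1)
    exact this
  refine ⟨_, Computable.list_foldl (hl.comp .fst) (Computable.const ((0, 0, 0) : RatCode)) h2,
    fun a k => ?_⟩
  dsimp only
  have key : ∀ (n : ℕ) (L : List β) (x : RatCode),
      |((L.foldl (fun s b => s.add (q ((a, b), n))) x).val : ℝ) - (x.val + (L.map (f a)).sum)| ≤
        L.length * ((2 : ℝ) ^ n)⁻¹ := by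
    intro n L
    induction L with
    | nil => simp
    | cons b L ih =>
      intro x
      have h3 := ih (x.add (q ((a, b), n)))
      have h4 := h (a, b) n
      rw [RatCode.val_add] at h3
      push_cast at h3
      simp only [List.foldl_cons, List.map_cons, List.sum_cons, List.length_cons]
      push_cast
      rw [abs_le] at h3 ⊢
      rw [abs_lt] at h4
      constructor <;> linarith [h3.1, h3.2, h4.1, h4.2]
  have h5 := key (k + (l a).length) (l a) (0, 0, 0)
  have h0 : (RatCode.val (0, 0, 0) : ℝ) = 0 := by simp [RatCode.val]
  rw [h0, zero_add] at h5
  refine h5.trans_lt ?_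
  rw [pow_add, mul_inv, mul_left_comm]
  refine mul_lt_of_lt_one_right (by positivity) ?_
  rw [← div_eq_mul_inv, div_lt_one (by positivity)]
  exact_mod_cast Nat.lt_two_pow_self

theorem of_search {f : α → ℝ} {F : α × ℕ → ℕ → Option RatCode} (hF : Computable₂ F)
    (hsound : ∀ a k n q, F (a, k) n = some q → |(q.val : ℝ) - f a| < ((2 : ℝ) ^ k)⁻¹)
    (hex : ∀ a k, ∃ n, (F (a, k) n).isSome) : ComputableRealFun f := by
  have hdom : ∀ p : α × ℕ, (Nat.rfindOpt (F p)).Dom := fun p => by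
    obtain ⟨n, hn⟩ := hex p.1 p.2
    obtain ⟨q, hq⟩ := Option.isSome_iff_exists.1 hn
    exact Nat.rfindOpt_dom.2 ⟨n, q, hq⟩
  refine ⟨fun p => (Nat.rfindOpt (F p)).get (hdom p),
    (Partrec.rfindOpt hF).of_eq_tot fun p => Part.get_mem _, fun a k => ?_⟩
  obtain ⟨n, hn⟩ := Nat.rfindOpt_spec (Part.get_mem (hdom (a, k)))
  exact hsound a k n _ hn

end ComputableRealFun

/-! ### Real powers by inequalities between natural numbers -/

namespace RatCode

/-- The numerator of a nonnegative lower bound for a real number within `2⁻ᵐ` of `x.val`. -/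
def lowerNum (x : RatCode) (m : ℕ) : ℕ := x.1 * 2 ^ m - (x.2.1 * 2 ^ m + (x.2.2 + 1))

/-- The numerator of an upper bound for a real number within `2⁻ᵐ` of `x.val`. -/
def upperNum (x : RatCode) (m : ℕ) : ℕ := x.1 * 2 ^ m + (x.2.2 + 1) - x.2.1 * 2 ^ m

/-- The common denominator of the two bounds. -/
def boundDen (x : RatCode) (m : ℕ) : ℕ := (x.2.2 + 1) * 2 ^ m

theorem boundDen_pos (x : RatCode) (m : ℕ) : 0 < boundDen x m :=
  Nat.mul_pos (Nat.succ_pos _) (pow_pos two_pos m)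

theorem cast_tsub_eq_max (a b : ℕ) : ((a - b : ℕ) : ℝ) = max ((a : ℝ) - b) 0 := by
  rcases le_total b a with h | h
  · rw [Nat.cast_sub h, max_eq_left (by simpa using h)]
  · rw [Nat.sub_eq_zero_of_le h, max_eq_right (by simpa using h), Nat.cast_zero]

theorem lowerNum_div (x : RatCode) (m : ℕ) :
    (lowerNum x m : ℝ) / boundDen x m = max ((x.val : ℝ) - ((2 : ℝ) ^ m)⁻¹) 0 := by
  have h : (0 : ℝ) < boundDen x m := Nat.cast_pos.2 (boundDen_pos x m)
  rw [lowerNum, cast_tsub_eq_max, ← max_div_div_right h.le, zero_div]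
  congr 1
  simp only [boundDen, val]
  push_cast
  field_simp
  ring

theorem upperNum_div (x : RatCode) (m : ℕ) :
    (upperNum x m : ℝ) / boundDen x m = max ((x.val : ℝ) + ((2 : ℝ) ^ m)⁻¹) 0 := by
  have h : (0 : ℝ) < boundDen x m := Nat.cast_pos.2 (boundDen_pos x m)
  rw [upperNum, cast_tsub_eq_max, ← max_div_div_right h.le, zero_div]
  congr 1
  simp only [boundDen, val]
  push_cast
  field_simp
  ring

theorem primrec_bounds : Primrec₂ lowerNum ∧ Primrec₂ upperNum ∧ Primrec₂ boundDen := by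
  have a : Primrec fun p : RatCode × ℕ => p.1.1 := Primrec.fst.comp .fst
  have b : Primrec fun p : RatCode × ℕ => p.1.2.1 := Primrec.fst.comp (Primrec.snd.comp .fst)
  have c : Primrec fun p : RatCode × ℕ => p.1.2.2 + 1 :=
    Primrec.succ.comp (Primrec.snd.comp (Primrec.snd.comp .fst))
  have e : Primrec fun p : RatCode × ℕ => 2 ^ p.2 := Primrec.nat_pow.comp (.const 2) .snd
  have ae := Primrec.nat_mul.comp a e
  have be := Primrec.nat_mul.comp b e
  exact ⟨Primrec.nat_sub.comp ae (Primrec.nat_add.comp be c),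
    Primrec.nat_sub.comp (Primrec.nat_add.comp ae c) be, Primrec.nat_mul.comp c e⟩

end RatCode

/-- Raising both sides to the power `n` removes the root, and the comparison becomes decidable. -/
theorem div_rpow_div_le_div_iff {a b m n c d : ℕ} (hb : 0 < b) (hn : 0 < n) (hd : 0 < d) :
    ((a : ℝ) / b) ^ ((m : ℝ) / n) ≤ c / d ↔ a ^ m * d ^ n ≤ c ^ n * b ^ m := by
  have hb' : (0 : ℝ) < b := Nat.cast_pos.2 hb
  have hd' : (0 : ℝ) < d := Nat.cast_pos.2 hd
  have h0 : (0 : ℝ) ≤ (a : ℝ) / b := by positivity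
  rw [← pow_le_pow_iff_left₀ (by positivity) (by positivity) hn.ne', ← Real.rpow_natCast,
    ← Real.rpow_mul h0, div_mul_cancel₀ _ (by positivity), Real.rpow_natCast, div_pow, div_pow,
    div_le_div_iff₀ (by positivity) (by positivity)]
  exact_mod_cast Iff.rfl

theorem div_le_div_rpow_div_iff {a b m n c d : ℕ} (hb : 0 < b) (hn : 0 < n) (hd : 0 < d) :
    (c : ℝ) / d ≤ ((a : ℝ) / b) ^ ((m : ℝ) / n) ↔ c ^ n * b ^ m ≤ a ^ m * d ^ n := by
  have hb' : (0 : ℝ) < b := Nat.cast_pos.2 hb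
  have hd' : (0 : ℝ) < d := Nat.cast_pos.2 hd
  have h0 : (0 : ℝ) ≤ (a : ℝ) / b := by positivity
  rw [← pow_le_pow_iff_left₀ (by positivity) (by positivity) hn.ne', ← Real.rpow_natCast (_ ^ _),
    ← Real.rpow_mul h0, div_mul_cancel₀ _ (by positivity), Real.rpow_natCast, div_pow, div_pow,
    div_le_div_iff₀ (by positivity) (by positivity)]
  exact_mod_cast Iff.rfl

/-- The function `t ↦ y ^ t` increases or decreases according to the position of `y` relative to
`1`. Testing both ends of the exponent interval avoids having to decide which. -/
theorem Real.rpow_le_max_of_mem_Icc {x y s t u : ℝ} (hx : 0 ≤ x) (hxy : x ≤ y) (ht : 0 < t)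
    (hst : s ≤ t) (htu : t ≤ u) : x ^ t ≤ max (y ^ s) (y ^ u) := by
  have hy := hx.trans hxy
  rcases le_total 1 y with h | h
  · exact (Real.rpow_le_rpow hx hxy ht.le).trans
      ((Real.rpow_le_rpow_of_exponent_le h htu).trans (le_max_right _ _))
  · rcases hy.eq_or_lt with h0 | h0
    · have : x = 0 := le_antisymm (h0 ▸ hxy) hx
      rw [this, Real.zero_rpow ht.ne']
      exact le_max_of_le_left (Real.rpow_nonneg hy _)
    · exact (Real.rpow_le_rpow hx hxy ht.le).trans
        ((Real.rpow_le_rpow_of_exponent_ge h0 h hst).trans (le_max_left _ _))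

theorem Real.min_le_rpow_of_mem_Icc {x y s t u : ℝ} (hy : 0 ≤ y) (hyx : y ≤ x)
    (ht : 0 < t) (hst : s ≤ t) (htu : t ≤ u) : min (y ^ s) (y ^ u) ≤ x ^ t := by
  have hx := hy.trans hyx
  refine le_trans ?_ (Real.rpow_le_rpow hy hyx ht.le)
  rcases le_total 1 y with h | h
  · exact (min_le_left _ _).trans (Real.rpow_le_rpow_of_exponent_le h hst)
  · rcases hy.eq_or_lt with h0 | h0
    -- For base zero the lower exponent `s` may be zero, where `0 ^ 0 = 1`; the minimum is
    -- controlled by the upper exponent, which is positive.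
    · rw [← h0, Real.zero_rpow ht.ne', Real.zero_rpow (ht.trans_le htu).ne']
      exact min_le_right _ _
    · exact (min_le_right _ _).trans (Real.rpow_le_rpow_of_exponent_ge h0 h htu)

namespace ComputableRealFun

variable {α : Type*} [Primcodable α]

/-- The test that certifies that `j / 2 ^ (k + 1)` is close to the power of a real number within
`2⁻ᵐ` of `x.val` with an exponent within `2⁻ᵐ` of `s.val`. -/
def powTest (x s : RatCode) (k m j : ℕ) : Prop :=
  (x.upperNum m ^ s.lowerNum m * (2 ^ (k + 1)) ^ s.boundDen m ≤
      (j + 1) ^ s.boundDen m * x.boundDen m ^ s.lowerNum m ∧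
    x.upperNum m ^ s.upperNum m * (2 ^ (k + 1)) ^ s.boundDen m ≤
      (j + 1) ^ s.boundDen m * x.boundDen m ^ s.upperNum m) ∧
  ((j - 1) ^ s.boundDen m * x.boundDen m ^ s.lowerNum m ≤
      x.lowerNum m ^ s.lowerNum m * (2 ^ (k + 1)) ^ s.boundDen m ∧
    (j - 1) ^ s.boundDen m * x.boundDen m ^ s.upperNum m ≤
      x.lowerNum m ^ s.upperNum m * (2 ^ (k + 1)) ^ s.boundDen m)

instance (x s : RatCode) (k m j : ℕ) : Decidable (powTest x s k m j) := by
  unfold powTest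
  infer_instance

theorem powTest_iff {x s : RatCode} {k m j : ℕ} : powTest x s k m j ↔
    (max ((x.val : ℝ) + ((2 : ℝ) ^ m)⁻¹) 0 ^ max ((s.val : ℝ) - ((2 : ℝ) ^ m)⁻¹) 0 ≤
        (j + 1) / 2 ^ (k + 1) ∧
      max ((x.val : ℝ) + ((2 : ℝ) ^ m)⁻¹) 0 ^ max ((s.val : ℝ) + ((2 : ℝ) ^ m)⁻¹) 0 ≤
        (j + 1) / 2 ^ (k + 1)) ∧
    (((j - 1 : ℕ) : ℝ) / 2 ^ (k + 1) ≤
        max ((x.val : ℝ) - ((2 : ℝ) ^ m)⁻¹) 0 ^ max ((s.val : ℝ) - ((2 : ℝ) ^ m)⁻¹) 0 ∧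
      ((j - 1 : ℕ) : ℝ) / 2 ^ (k + 1) ≤
        max ((x.val : ℝ) - ((2 : ℝ) ^ m)⁻¹) 0 ^ max ((s.val : ℝ) + ((2 : ℝ) ^ m)⁻¹) 0) := by
  have hx := x.boundDen_pos m
  have hs := s.boundDen_pos m
  have h2 : 0 < 2 ^ (k + 1) := by positivity
  have e2 : ((2 ^ (k + 1) : ℕ) : ℝ) = 2 ^ (k + 1) := by push_cast; rfl
  have e1 : ((j + 1 : ℕ) : ℝ) = (j : ℝ) + 1 := by push_cast; rfl
  rw [powTest, ← RatCode.lowerNum_div, ← RatCode.lowerNum_div, ← RatCode.upperNum_div,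
    ← RatCode.upperNum_div, ← e2, ← e1, div_rpow_div_le_div_iff hx hs h2,
    div_rpow_div_le_div_iff hx hs h2, div_le_div_rpow_div_iff hx hs h2,
    div_le_div_rpow_div_iff hx hs h2]

theorem primrec_powTest : PrimrecPred fun p : (RatCode × RatCode) × ℕ × ℕ × ℕ =>
    powTest p.1.1 p.1.2 p.2.1 p.2.2.1 p.2.2.2 := by
  obtain ⟨hl, hu, hd⟩ := RatCode.primrec_bounds
  have x : Primrec fun p : (RatCode × RatCode) × ℕ × ℕ × ℕ => p.1.1 := Primrec.fst.comp .fst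
  have s : Primrec fun p : (RatCode × RatCode) × ℕ × ℕ × ℕ => p.1.2 := Primrec.snd.comp .fst
  have k : Primrec fun p : (RatCode × RatCode) × ℕ × ℕ × ℕ => p.2.1 := Primrec.fst.comp .snd
  have m : Primrec fun p : (RatCode × RatCode) × ℕ × ℕ × ℕ => p.2.2.1 :=
    Primrec.fst.comp (Primrec.snd.comp .snd)
  have j : Primrec fun p : (RatCode × RatCode) × ℕ × ℕ × ℕ => p.2.2.2 :=
    Primrec.snd.comp (Primrec.snd.comp .snd)
  have xl := hl.comp x m
  have xu := hu.comp x m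
  have xd := hd.comp x m
  have sl := hl.comp s m
  have su := hu.comp s m
  have sd := hd.comp s m
  have e := Primrec.nat_pow.comp (Primrec.nat_pow.comp (.const 2) (Primrec.succ.comp k)) sd
  have j1 := Primrec.nat_pow.comp (Primrec.succ.comp j) sd
  have j2 := Primrec.nat_pow.comp (Primrec.nat_sub.comp j (.const 1)) sd
  have pw : ∀ {f g h : (RatCode × RatCode) × ℕ × ℕ × ℕ → ℕ}, Primrec f → Primrec g → Primrec h →
      Primrec fun p => f p ^ g p * h p := fun hf hg hh =>
    Primrec.nat_mul.comp (Primrec.nat_pow.comp hf hg) hh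
  have c1 := Primrec.nat_le.comp (pw xu sl e) (Primrec.nat_mul.comp j1 (Primrec.nat_pow.comp xd sl))
  have c2 := Primrec.nat_le.comp (pw xu su e) (Primrec.nat_mul.comp j1 (Primrec.nat_pow.comp xd su))
  have c3 := Primrec.nat_le.comp (Primrec.nat_mul.comp j2 (Primrec.nat_pow.comp xd sl)) (pw xl sl e)
  have c4 := Primrec.nat_le.comp (Primrec.nat_mul.comp j2 (Primrec.nat_pow.comp xd su)) (pw xl su e)
  exact (c1.and c2).and (c3.and c4)

theorem rpow {f : α → ℝ} (hf : ComputableRealFun f) (hf0 : ∀ a, 0 ≤ f a) {t : ℝ}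
    (ht : IsComputableReal t) (ht0 : 0 < t) : ComputableRealFun fun a => f a ^ t := by
  obtain ⟨q, hq, hqf⟩ := hf
  obtain ⟨r, hr, hrt⟩ := ht
  have hF : Computable₂ fun (p : α × ℕ) (n : ℕ) =>
      if powTest (q (p.1, n.unpair.1)) (r n.unpair.1) p.2 n.unpair.1 n.unpair.2 then
        some (RatCode.divTwoPow (n.unpair.2, 0, 0) (p.2 + 1)) else none := by
    have hm : Computable fun p : (α × ℕ) × ℕ => p.2.unpair.1 :=
      Computable.fst.comp (Computable.unpair.comp .snd)
    have hj : Computable fun p : (α × ℕ) × ℕ => p.2.unpair.2 :=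
      Computable.snd.comp (Computable.unpair.comp .snd)
    have hk : Computable fun p : (α × ℕ) × ℕ => p.1.2 := Computable.snd.comp .fst
    have hqc := hq.comp ((Computable.fst.comp .fst).pair hm)
    have h1 := primrec_powTest.decide.to_comp.comp
      ((hqc.pair (hr.comp hm)).pair (hk.pair (hm.pair hj)))
    have h2 := RatCode.primrec_divTwoPow.to_comp.comp
      (hj.pair (Computable.const ((0, 0) : ℕ × ℕ))) (Computable.succ.comp hk)
    refine (Computable.cond h1 (Computable.option_some.comp h2) (.const none)).of_eq fun p => ?_
    dsimp only
    rw [Bool.cond_decide]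
  refine of_search hF (fun a k n y hy => ?_) fun a k => ?_
  · dsimp only at hy
    split_ifs at hy with htest
    obtain ⟨⟨u1, u2⟩, l1, l2⟩ := powTest_iff.1 htest
    rw [Option.some.injEq] at hy
    rw [← hy, RatCode.val_divTwoPow]
    have hx := abs_lt.1 (hqf a n.unpair.1)
    have hs := abs_lt.1 (hrt n.unpair.1)
    generalize ((2 : ℝ) ^ n.unpair.1)⁻¹ = ε at *
    have hup := Real.rpow_le_max_of_mem_Icc (hf0 a)
      (le_max_of_le_left (by linarith) : f a ≤ max (((q (a, n.unpair.1)).val : ℝ) + ε) 0)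
      ht0
      (max_le (by linarith) ht0.le : max (((r n.unpair.1).val : ℝ) - ε) 0 ≤ t)
      (le_max_of_le_left (by linarith) : t ≤ max (((r n.unpair.1).val : ℝ) + ε) 0)
    have hlow := Real.min_le_rpow_of_mem_Icc (le_max_right _ _ :
        0 ≤ max (((q (a, n.unpair.1)).val : ℝ) - ε) 0) (max_le (by linarith) (hf0 a) : _ ≤ f a) ht0
      (max_le (by linarith) ht0.le : max (((r n.unpair.1).val : ℝ) - ε) 0 ≤ t)
      (le_max_of_le_left (by linarith) : t ≤ max (((r n.unpair.1).val : ℝ) + ε) 0)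
    have hU := hup.trans (max_le u1 u2)
    have hL := (le_min l1 l2).trans hlow
    have hj : (n.unpair.2 : ℝ) - 1 ≤ ((n.unpair.2 - 1 : ℕ) : ℝ) := by
      rw [RatCode.cast_tsub_eq_max]
      simp
    have hL' : ((n.unpair.2 : ℝ) - 1) / 2 ^ (k + 1) ≤ f a ^ t :=
      (div_le_div_of_nonneg_right hj (by positivity)).trans hL
    have hval : (((RatCode.val (n.unpair.2, 0, 0)) / 2 ^ (k + 1) : ℚ) : ℝ) =
        (n.unpair.2 : ℝ) / 2 ^ (k + 1) := by
      simp [RatCode.val]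
    rw [hval]
    have hk : (1 : ℝ) / 2 ^ (k + 1) < ((2 : ℝ) ^ k)⁻¹ := by
      rw [one_div]
      exact inv_strictAnti₀ (by positivity) (pow_lt_pow_right₀ one_lt_two (Nat.lt_succ_self k))
    rw [add_div] at hU
    rw [sub_div] at hL'
    rw [abs_lt]
    constructor <;> linarith
  · set y := f a ^ t with hy
    have hy0 : 0 ≤ y := Real.rpow_nonneg (hf0 a) _
    -- The test leaves a slack of one unit `2⁻⁽ᵏ⁺¹⁾` on each side. For this `j` the required
    -- inequalities are strict in the limit, so they hold at some finite precision; the case `j =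
    -- 0`, where `j - 1` is truncated, is trivial.
    set j := ⌊y * 2 ^ (k + 1)⌋₊ with hj
    have hP : (0 : ℝ) < 2 ^ (k + 1) := by positivity
    have hju : y < (j + 1) / 2 ^ (k + 1) := by
      rw [lt_div_iff₀ hP]
      exact Nat.lt_floor_add_one _
    have hpow : Filter.Tendsto (fun m : ℕ => ((2 : ℝ) ^ m)⁻¹) Filter.atTop (𝓝 0) :=
      tendsto_inv_atTop_zero.comp (tendsto_pow_atTop_atTop_of_one_lt one_lt_two)
    have hqlim : Filter.Tendsto (fun m : ℕ => ((q (a, m)).val : ℝ)) Filter.atTop (𝓝 (f a)) := by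
      rw [tendsto_iff_dist_tendsto_zero]
      exact squeeze_zero (fun _ => dist_nonneg) (fun m => (hqf a m).le) hpow
    have hrlim : Filter.Tendsto (fun m : ℕ => ((r m).val : ℝ)) Filter.atTop (𝓝 t) := by
      rw [tendsto_iff_dist_tendsto_zero]
      exact squeeze_zero (fun _ => dist_nonneg) (fun m => (hrt m).le) hpow
    have hql := (hqlim.sub hpow).max (tendsto_const_nhds (x := (0 : ℝ)))
    have hqu := (hqlim.add hpow).max (tendsto_const_nhds (x := (0 : ℝ)))
    have hrl := (hrlim.sub hpow).max (tendsto_const_nhds (x := (0 : ℝ)))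
    have hru := (hrlim.add hpow).max (tendsto_const_nhds (x := (0 : ℝ)))
    rw [sub_zero, max_eq_left (hf0 a)] at hql
    rw [add_zero, max_eq_left (hf0 a)] at hqu
    rw [sub_zero, max_eq_left ht0.le] at hrl
    rw [add_zero, max_eq_left ht0.le] at hru
    have hlow : ∀ᶠ m in Filter.atTop, ((j - 1 : ℕ) : ℝ) / 2 ^ (k + 1) ≤
          max (((q (a, m)).val : ℝ) - ((2 : ℝ) ^ m)⁻¹) 0 ^
            max (((r m).val : ℝ) - ((2 : ℝ) ^ m)⁻¹) 0 ∧
        ((j - 1 : ℕ) : ℝ) / 2 ^ (k + 1) ≤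
          max (((q (a, m)).val : ℝ) - ((2 : ℝ) ^ m)⁻¹) 0 ^
            max (((r m).val : ℝ) + ((2 : ℝ) ^ m)⁻¹) 0 := by
      rcases Nat.eq_zero_or_pos j with h0 | h0
      · refine Filter.Eventually.of_forall fun m => ?_
        rw [h0]
        simp only [zero_tsub, Nat.cast_zero, zero_div]
        exact ⟨Real.rpow_nonneg (le_max_right _ _) _, Real.rpow_nonneg (le_max_right _ _) _⟩
      · have hjl : ((j - 1 : ℕ) : ℝ) / 2 ^ (k + 1) < y := by
          rw [div_lt_iff₀ hP]
          refine lt_of_lt_of_le ?_ (Nat.floor_le (by positivity))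
          exact Nat.cast_lt.2 (Nat.sub_lt h0 one_pos)
        filter_upwards [(hql.rpow hrl (Or.inr ht0)).eventually_const_lt hjl,
          (hql.rpow hru (Or.inr ht0)).eventually_const_lt hjl] with m h1 h2
        exact ⟨h1.le, h2.le⟩
    obtain ⟨m, ⟨h1, h2⟩, h3⟩ := (((((hqu.rpow hrl (Or.inr ht0)).eventually_lt_const hju).and
      ((hqu.rpow hru (Or.inr ht0)).eventually_lt_const hju))).and hlow).exists
    refine ⟨Nat.pair m j, ?_⟩
    simp only [Nat.unpair_pair]
    rw [if_pos (powTest_iff.2 ⟨⟨h1.le, h2.le⟩, h3⟩)]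
    rfl

end ComputableRealFun

/-! ### Weighted norms of lists of scalars -/

/-- The sum of `2⁻ᴸ ‖z‖ᵖ` over the pairs `(z, L)` in a list, to the power `1/p`. -/
noncomputable def weightedNorm (𝕜 : Type*) [RCLike 𝕜] (p : ℝ) (l : List (ScalarCode × ℕ)) : ℝ :=
  (l.map fun z => ‖z.1.val 𝕜‖ ^ p / 2 ^ z.2).sum ^ p⁻¹

/-- The modulus of a rational scalar need not be rational, but its square is; powers of the modulus
are then taken with exponent `p / 2`. The constant `κ` is `0` or `1` and treats the real and the
complex case together. -/
theorem sq_norm_scalarCode_val (𝕜 : Type*) [RCLike 𝕜] :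
    ∃ κ : RatCode, ∀ z : ScalarCode, ‖z.val 𝕜‖ ^ 2 =
      (((z.1.mul z.1).add (κ.mul (z.2.mul z.2))).val : ℝ) := by
  have hI : ∃ κ : RatCode, (RCLike.im (RCLike.I : 𝕜)) ^ 2 = (κ.val : ℝ) ∧
      RCLike.re (RCLike.I : 𝕜) = 0 := by
    rcases RCLike.I_eq_zero_or_im_I_eq_one (K := 𝕜) with h | h
    · exact ⟨(0, 0, 0), by simp [h, RatCode.val], RCLike.I_re⟩
    · exact ⟨(1, 0, 0), by simp [h, RatCode.val], RCLike.I_re⟩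
  obtain ⟨κ, h1, h2⟩ := hI
  refine ⟨κ, fun z => ?_⟩
  have hre : ∀ q : ℚ, RCLike.re (q : 𝕜) = (q : ℝ) := fun q => by
    rw [← RCLike.ofReal_ratCast, RCLike.ofReal_re]
  have him : ∀ q : ℚ, RCLike.im (q : 𝕜) = 0 := fun q => by
    rw [← RCLike.ofReal_ratCast, RCLike.ofReal_im]
  rw [RCLike.norm_sq_eq_def, ScalarCode.val]
  simp only [map_add, RCLike.mul_re, RCLike.mul_im, hre, him, h2, RatCode.val_add, RatCode.val_mul]
  push_cast
  rw [← h1]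
  ring

theorem computableRealFun_weightedNorm (𝕜 : Type*) [RCLike 𝕜] {p : ℝ} (hp : IsComputableReal p)
    (hp1 : 1 ≤ p) : ComputableRealFun (weightedNorm 𝕜 p) := by
  have hp0 : 0 < p := by linarith
  obtain ⟨κ, hκ⟩ := sq_norm_scalarCode_val 𝕜
  have hsq : Computable fun z : ScalarCode × ℕ =>
      (z.1.1.mul z.1.1).add (κ.mul (z.1.2.mul z.1.2)) := by
    have a : Primrec fun z : ScalarCode × ℕ => z.1.1 := Primrec.fst.comp .fst
    have b : Primrec fun z : ScalarCode × ℕ => z.1.2 := Primrec.snd.comp .fst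
    exact (RatCode.primrec_add.comp (RatCode.primrec_mul.comp a a)
      (RatCode.primrec_mul.comp (Primrec.const κ) (RatCode.primrec_mul.comp b b))).to_comp
  have h1 : ComputableRealFun fun z : ScalarCode × ℕ => ‖z.1.val 𝕜‖ ^ 2 :=
    (ComputableRealFun.of_rat hsq).of_eq fun z => (hκ z.1).symm
  have h2 := (h1.rpow (fun z => by positivity) hp.half (by positivity)).div_two_pow
    (n := fun z : ScalarCode × ℕ => z.2) .snd
  have h3 : ComputableRealFun fun q : List (ScalarCode × ℕ) × (ScalarCode × ℕ) =>
      ‖q.2.1.val 𝕜‖ ^ p / 2 ^ q.2.2 := by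
    refine (h2.comp (g := fun q : List (ScalarCode × ℕ) × (ScalarCode × ℕ) => q.2) .snd).of_eq
      fun q => ?_
    rw [← Real.rpow_natCast, ← Real.rpow_mul (norm_nonneg _)]
    congr 2
    push_cast
    ring
  refine (ComputableRealFun.list_sum (α := List (ScalarCode × ℕ)) (l := fun l => l) .id
    (f := fun _ z => ‖z.1.val 𝕜‖ ^ p / 2 ^ z.2) h3).rpow (fun l => ?_) (hp.inv hp1) (by positivity)
  exact List.sum_nonneg fun x hx => by
    obtain ⟨z, -, rfl⟩ := List.mem_map.1 hx
    positivity

end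

/-! ### Linear isometries preserve disjointness -/

/-- Write `z ^ r = z * z ^ (r - 1)`: the second factor is strictly decreasing in `z`, so it is
smaller at `x + y` than at `x` and at `y`. -/
theorem Real.rpow_add_lt_add_rpow {x y r : ℝ} (hx : 0 < x) (hy : 0 < y) (hr : r < 1) :
    (x + y) ^ r < x ^ r + y ^ r := by
  have key : ∀ z : ℝ, 0 < z → z ^ r = z * z ^ (r - 1) := fun z hz => by
    rw [Real.rpow_sub_one hz.ne', mul_div_cancel₀ _ hz.ne']
  rw [key _ (add_pos hx hy), key _ hx, key _ hy, add_mul]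
  exact add_lt_add
    (mul_lt_mul_of_pos_left (Real.rpow_lt_rpow_of_neg hx (by linarith) (by linarith)) hx)
    (mul_lt_mul_of_pos_left (Real.rpow_lt_rpow_of_neg hy (by linarith) (by linarith)) hy)

theorem Real.add_rpow_lt_rpow_add {x y r : ℝ} (hx : 0 < x) (hy : 0 < y) (hr : 1 < r) :
    x ^ r + y ^ r < (x + y) ^ r := by
  have key : ∀ z : ℝ, 0 < z → z ^ r = z * z ^ (r - 1) := fun z hz => by
    rw [Real.rpow_sub_one hz.ne', mul_div_cancel₀ _ hz.ne']
  rw [key _ (add_pos hx hy), key _ hx, key _ hy, add_mul]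
  exact add_lt_add
    (mul_lt_mul_of_pos_left (Real.rpow_lt_rpow hx.le (by linarith) (by linarith)) hx)
    (mul_lt_mul_of_pos_left (Real.rpow_lt_rpow hy.le (by linarith) (by linarith)) hy)

/-! ### The parallelogram inequality for `p`-th powers -/

section Scalar

variable {𝕜 : Type*} [RCLike 𝕜]

/-- The defect in the `p`-th power version of the parallelogram law. -/
noncomputable def parallelogramGap (p : ℝ) (a b : 𝕜) : ℝ :=
  2 * (‖a‖ ^ p + ‖b‖ ^ p) - (‖a + b‖ ^ p + ‖a - b‖ ^ p)

theorem norm_rpow_eq_sq_rpow_half (p : ℝ) (a : 𝕜) : ‖a‖ ^ p = (‖a‖ ^ 2) ^ (p / 2) := by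
  rw [← Real.rpow_natCast, ← Real.rpow_mul (norm_nonneg _)]
  congr 1
  push_cast
  ring

theorem sq_norm_add_add_sq_norm_sub (a b : 𝕜) :
    ‖a + b‖ ^ 2 + ‖a - b‖ ^ 2 = 2 * (‖a‖ ^ 2 + ‖b‖ ^ 2) := by
  simp only [RCLike.norm_sq_eq_def, map_add, map_sub]
  ring

/-- By concavity of `t ↦ t ^ (p / 2)` and the parallelogram law, `‖a + b‖ᵖ + ‖a - b‖ᵖ` is at most `2
(‖a‖² + ‖b‖²) ^ (p / 2)`. Strict subadditivity of this power gives the rest, including the case of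
equality. -/
theorem parallelogramGap_of_lt_two {p : ℝ} (hp : 0 < p) (hp2 : p < 2) (a b : 𝕜) :
    0 ≤ parallelogramGap p a b ∧ (parallelogramGap p a b = 0 → a = 0 ∨ b = 0) := by
  have h := (Real.concaveOn_rpow (p := p / 2) (by linarith) (by linarith)).2
    (Set.mem_Ici.2 (sq_nonneg ‖a + b‖)) (Set.mem_Ici.2 (sq_nonneg ‖a - b‖))
    (by norm_num : (0 : ℝ) ≤ 1 / 2) (by norm_num : (0 : ℝ) ≤ 1 / 2) (by norm_num)
  simp only [smul_eq_mul] at h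
  rw [← mul_add, ← mul_add, sq_norm_add_add_sq_norm_sub, ← mul_assoc,
    show (1 / 2 * 2 : ℝ) = 1 by norm_num, one_mul] at h
  have h2 := Real.rpow_add_le_add_rpow (sq_nonneg ‖a‖) (sq_nonneg ‖b‖)
    (by linarith : 0 ≤ p / 2) (by linarith)
  unfold parallelogramGap
  simp only [norm_rpow_eq_sq_rpow_half p]
  refine ⟨by linarith, fun h0 => ?_⟩
  by_contra! hab
  have h3 := Real.rpow_add_lt_add_rpow (pow_pos (norm_pos_iff.2 hab.1) 2)
    (pow_pos (norm_pos_iff.2 hab.2) 2) (by linarith : p / 2 < 1)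
  linarith

theorem parallelogramGap_of_two_lt {p : ℝ} (hp2 : 2 < p) (a b : 𝕜) :
    0 ≤ -parallelogramGap p a b ∧ (-parallelogramGap p a b = 0 → a = 0 ∨ b = 0) := by
  have h := (convexOn_rpow (p := p / 2) (by linarith)).2
    (Set.mem_Ici.2 (sq_nonneg ‖a + b‖)) (Set.mem_Ici.2 (sq_nonneg ‖a - b‖))
    (by norm_num : (0 : ℝ) ≤ 1 / 2) (by norm_num : (0 : ℝ) ≤ 1 / 2) (by norm_num)
  simp only [smul_eq_mul] at h
  rw [← mul_add, ← mul_add, sq_norm_add_add_sq_norm_sub, ← mul_assoc,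
    show (1 / 2 * 2 : ℝ) = 1 by norm_num, one_mul] at h
  have h2 := Real.add_rpow_le_rpow_add (sq_nonneg ‖a‖) (sq_nonneg ‖b‖)
    (by linarith : 1 ≤ p / 2)
  unfold parallelogramGap
  simp only [norm_rpow_eq_sq_rpow_half p]
  refine ⟨by linarith, fun h0 => ?_⟩
  by_contra! hab
  have h3 := Real.add_rpow_lt_rpow_add (pow_pos (norm_pos_iff.2 hab.1) 2)
    (pow_pos (norm_pos_iff.2 hab.2) 2) (by linarith : 1 < p / 2)
  linarith

/-- The sign of the gap depends only on `p`, so `ε = ±1` treats `p < 2` and `p > 2` together. -/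
theorem exists_mul_parallelogramGap_nonneg {p : ℝ} (hp : 0 < p) (hp2 : p ≠ 2) :
    ∃ ε : ℝ, ∀ a b : 𝕜, 0 ≤ ε * parallelogramGap p a b ∧
      (ε * parallelogramGap p a b = 0 → a = 0 ∨ b = 0) := by
  rcases hp2.lt_or_gt with h | h
  · exact ⟨1, fun a b => by simpa using parallelogramGap_of_lt_two hp h a b⟩
  · exact ⟨-1, fun a b => by simpa using parallelogramGap_of_two_lt h a b⟩

theorem norm_add_rpow_of_eq_zero_or {p : ℝ} (hp : 0 < p) {a b : 𝕜} (h : a = 0 ∨ b = 0) :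
    ‖a + b‖ ^ p = ‖a‖ ^ p + ‖b‖ ^ p := by
  rcases h with rfl | rfl <;> simp [Real.zero_rpow hp.ne']

end Scalar

namespace LpSum

variable {𝕜 : Type*} [RCLike 𝕜] {p : ℝ≥0∞} [Fact (1 ≤ p)]

theorem toReal_pos (hp : p ≠ ∞) : 0 < p.toReal :=
  ENNReal.toReal_pos (zero_lt_one.trans_le (Fact.out : 1 ≤ p)).ne' hp

theorem toReal_ne_two (hp_two : p ≠ 2) : p.toReal ≠ 2 := fun h => by
  apply hp_two
  have hp : p ≠ ∞ := by
    rintro rfl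
    simp at h
  rw [← ENNReal.ofReal_toReal hp, h]
  norm_num

theorem norm_rpow_eq (hp : p ≠ ∞) (x : LpSum 𝕜 p) : ‖x‖ ^ p.toReal =
    ∑' n, ‖x.fst n‖ ^ p.toReal + ∫ t, ‖x.snd t‖ ^ p.toReal ∂unitMeasure := by
  have h0 := toReal_pos hp
  have h1 : ‖x.snd‖ ^ p.toReal = ∫ t, ‖x.snd t‖ ^ p.toReal ∂unitMeasure := by
    rw [Lp.norm_def, (Lp.memLp x.snd).eLpNorm_eq_integral_rpow_norm
      (zero_lt_one.trans_le (Fact.out : 1 ≤ p)).ne' hp, ENNReal.toReal_ofReal (by positivity),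
      Real.rpow_inv_rpow (by positivity) h0.ne']
  rw [WithLp.prod_norm_eq_add h0, one_div, Real.rpow_inv_rpow (by positivity) h0.ne',
    lp.norm_rpow_eq_tsum h0, h1]

theorem summable_rpow (hp : p ≠ ∞) (x : LpSum 𝕜 p) :
    Summable fun n => ‖x.fst n‖ ^ p.toReal :=
  (lp.memℓp x.fst).summable (toReal_pos hp)

theorem integrable_rpow (hp : p ≠ ∞) (x : LpSum 𝕜 p) :
    Integrable (fun t => ‖x.snd t‖ ^ p.toReal) unitMeasure :=
  (Lp.memLp x.snd).integrable_norm_rpow (zero_lt_one.trans_le (Fact.out : 1 ≤ p)).ne' hp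

/-- Two elements of `ℓᵖ ⊕ Lᵖ[0,1]` are disjoint if at most one of them is nonzero at (almost) any
point. -/
def Disj (x y : LpSum 𝕜 p) : Prop :=
  (∀ n, x.fst n = 0 ∨ y.fst n = 0) ∧ ∀ᵐ t ∂unitMeasure, x.snd t = 0 ∨ y.snd t = 0

theorem Disj.norm_add_rpow (hp : p ≠ ∞) {x y : LpSum 𝕜 p} (h : Disj x y) :
    ‖x + y‖ ^ p.toReal = ‖x‖ ^ p.toReal + ‖y‖ ^ p.toReal := by
  have h0 := toReal_pos hp
  rw [norm_rpow_eq hp, norm_rpow_eq hp, norm_rpow_eq hp, add_add_add_comm,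
    ← (summable_rpow hp x).tsum_add (summable_rpow hp y),
    ← integral_add (integrable_rpow hp x) (integrable_rpow hp y)]
  congr 1
  · refine tsum_congr fun n => ?_
    rw [WithLp.add_fst, lp.coeFn_add, Pi.add_apply, norm_add_rpow_of_eq_zero_or h0 (h.1 n)]
  · refine integral_congr_ae ?_
    filter_upwards [h.2, Lp.coeFn_add x.snd y.snd] with t ht hadd
    rw [WithLp.add_snd, hadd, Pi.add_apply, norm_add_rpow_of_eq_zero_or h0 ht]

theorem Disj.neg_right {x y : LpSum 𝕜 p} (h : Disj x y) : Disj x (-y) := by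
  refine ⟨fun n => (h.1 n).imp id fun hn => ?_, ?_⟩
  · rw [WithLp.neg_fst, lp.coeFn_neg, Pi.neg_apply, hn, neg_zero]
  · filter_upwards [h.2, Lp.coeFn_neg y.snd] with t ht hneg
    rw [WithLp.neg_snd, hneg, Pi.neg_apply, neg_eq_zero]
    exact ht

/-- The right-hand side mentions only norms, so disjointness is an isometric invariant. It says that
the gap has total sum and integral zero; as the gap has constant sign, it vanishes pointwise. -/
theorem disj_iff (hp : p ≠ ∞) (hp_two : p ≠ 2) {x y : LpSum 𝕜 p} : Disj x y ↔
    ‖x + y‖ ^ p.toReal + ‖x - y‖ ^ p.toReal = 2 * (‖x‖ ^ p.toReal + ‖y‖ ^ p.toReal) := by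
  constructor
  · intro h
    rw [h.norm_add_rpow hp, sub_eq_add_neg, h.neg_right.norm_add_rpow hp, norm_neg]
    ring
  intro h
  obtain ⟨ε, hε⟩ := exists_mul_parallelogramGap_nonneg (𝕜 := 𝕜) (toReal_pos hp)
    (toReal_ne_two hp_two)
  have hs : HasSum (fun n => ε * parallelogramGap p.toReal (x.fst n) (y.fst n))
      (ε * (2 * (∑' n, ‖x.fst n‖ ^ p.toReal + ∑' n, ‖y.fst n‖ ^ p.toReal) -
        (∑' n, ‖(x + y).fst n‖ ^ p.toReal + ∑' n, ‖(x - y).fst n‖ ^ p.toReal))) := by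
    have := ((((summable_rpow hp x).hasSum.add (summable_rpow hp y).hasSum).mul_left 2).sub
      ((summable_rpow hp (x + y)).hasSum.add (summable_rpow hp (x - y)).hasSum)).mul_left ε
    exact this
  have hae : (fun t => ε * (2 * (‖x.snd t‖ ^ p.toReal + ‖y.snd t‖ ^ p.toReal) -
      (‖(x + y).snd t‖ ^ p.toReal + ‖(x - y).snd t‖ ^ p.toReal))) =ᵐ[unitMeasure]
      fun t => ε * parallelogramGap p.toReal (x.snd t) (y.snd t) := by
    filter_upwards [Lp.coeFn_add x.snd y.snd, Lp.coeFn_sub x.snd y.snd] with t h1 h2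
    rw [WithLp.add_snd, WithLp.sub_snd, h1, h2]
    rfl
  have hint : Integrable (fun t => ε * (2 * (‖x.snd t‖ ^ p.toReal + ‖y.snd t‖ ^ p.toReal) -
      (‖(x + y).snd t‖ ^ p.toReal + ‖(x - y).snd t‖ ^ p.toReal))) unitMeasure :=
    ((((integrable_rpow hp x).add (integrable_rpow hp y)).const_mul 2).sub
      ((integrable_rpow hp (x + y)).add (integrable_rpow hp (x - y)))).const_mul ε
  have hi : ∫ t, ε * parallelogramGap p.toReal (x.snd t) (y.snd t) ∂unitMeasure =
      ε * (2 * (∫ t, ‖x.snd t‖ ^ p.toReal ∂unitMeasure + ∫ t, ‖y.snd t‖ ^ p.toReal ∂unitMeasure) -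
        (∫ t, ‖(x + y).snd t‖ ^ p.toReal ∂unitMeasure +
          ∫ t, ‖(x - y).snd t‖ ^ p.toReal ∂unitMeasure)) := by
    rw [← integral_congr_ae hae, integral_const_mul, integral_sub, integral_const_mul,
      integral_add (integrable_rpow hp x) (integrable_rpow hp y),
      integral_add (integrable_rpow hp (x + y)) (integrable_rpow hp (x - y))]
    · exact ((integrable_rpow hp x).add (integrable_rpow hp y)).const_mul 2
    · exact (integrable_rpow hp (x + y)).add (integrable_rpow hp (x - y))
  have hsum0 : ∑' n, ε * parallelogramGap p.toReal (x.fst n) (y.fst n) +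
      ∫ t, ε * parallelogramGap p.toReal (x.snd t) (y.snd t) ∂unitMeasure = 0 := by
    rw [hs.tsum_eq, hi, ← mul_add]
    rw [norm_rpow_eq hp, norm_rpow_eq hp, norm_rpow_eq hp, norm_rpow_eq hp] at h
    refine mul_eq_zero_of_right _ ?_
    linarith
  have h1 : 0 ≤ ∑' n, ε * parallelogramGap p.toReal (x.fst n) (y.fst n) :=
    tsum_nonneg fun n => (hε _ _).1
  have h2 : 0 ≤ ∫ t, ε * parallelogramGap p.toReal (x.snd t) (y.snd t) ∂unitMeasure :=
    integral_nonneg fun t => (hε _ _).1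
  constructor
  · intro n
    have h3 := (hasSum_zero_iff_of_nonneg fun n => (hε (x.fst n) (y.fst n)).1).1
      ((by linarith : ∑' n, ε * parallelogramGap p.toReal (x.fst n) (y.fst n) = 0) ▸
        hs.summable.hasSum)
    exact (hε _ _).2 (congrFun h3 n)
  · have h3 := (integral_eq_zero_iff_of_nonneg
      (f := fun t => ε * parallelogramGap p.toReal (x.snd t) (y.snd t))
      (fun t => (hε _ _).1) (hint.congr hae)).1 (by linarith)
    filter_upwards [h3] with t ht
    exact (hε _ _).2 ht

theorem Disj.map (hp : p ≠ ∞) (hp_two : p ≠ 2) {x y : LpSum 𝕜 p} (h : Disj x y)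
    (T : LpSum 𝕜 p ≃ₗᵢ[𝕜] LpSum 𝕜 p) : Disj (T x) (T y) := by
  rw [disj_iff hp hp_two] at h ⊢
  rwa [← map_add, ← map_sub, T.norm_map, T.norm_map, T.norm_map, T.norm_map]

end LpSum

/-! ### Splitting in the atomless summand -/

theorem exists_measure_inter_Iic_pos {S : Set ℝ} (hS : unitMeasure S ≠ 0) :
    ∃ t, unitMeasure (S ∩ Set.Iic t) ≠ 0 ∧ unitMeasure (S ∩ Set.Ioi t) ≠ 0 := by
  set φ : ℝ → ℝ := fun t => unitMeasure.real (S ∩ Set.Iic t) with hφ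
  -- Lebesgue measure has no atoms, so the distribution function of `S` is continuous and takes half
  -- of its final value.
  have hlip : LipschitzWith 1 φ := by
    refine LipschitzWith.of_le_add fun x y => ?_
    have hsub : S ∩ Set.Iic x ⊆ (S ∩ Set.Iic y) ∪ Set.Ioc y x := by
      rintro t ⟨ht, htx⟩
      rcases le_or_gt t y with h | h
      · exact Or.inl ⟨ht, h⟩
      · exact Or.inr ⟨h, htx⟩
    have hI : unitMeasure.real (Set.Ioc y x) ≤ dist x y := by
      have h1 : unitMeasure (Set.Ioc y x) ≤ ENNReal.ofReal (x - y) :=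
        (Measure.restrict_apply_le _ _).trans Real.volume_Ioc.le
      refine (ENNReal.toReal_mono ENNReal.ofReal_ne_top h1).trans ?_
      rw [ENNReal.toReal_ofReal', Real.dist_eq]
      exact max_le (le_abs_self _) (abs_nonneg _)
    exact (measureReal_mono hsub).trans ((measureReal_union_le _ _).trans (by gcongr))
  have hS0 : 0 < unitMeasure.real S :=
    (measureReal_ne_zero_iff).2 hS |>.lt_of_le' measureReal_nonneg
  have h0 : φ 0 = 0 := by
    have : unitMeasure (S ∩ Set.Iic 0) = 0 := by
      refine measure_mono_null Set.inter_subset_right ?_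
      rw [Measure.restrict_apply measurableSet_Iic]
      refine measure_mono_null (t := {0}) (fun t ht => le_antisymm ht.1 ht.2.1) (by simp)
    rw [hφ]
    exact (congrArg ENNReal.toReal this).trans ENNReal.toReal_zero
  have h1 : φ 1 = unitMeasure.real S := by
    refine congrArg ENNReal.toReal (measure_congr ?_)
    have : ∀ᵐ t ∂unitMeasure, t ∈ Set.Icc (0 : ℝ) 1 := ae_restrict_mem measurableSet_Icc
    filter_upwards [this] with t ht
    exact propext ⟨fun h => h.1, fun h => ⟨h, ht.2⟩⟩
  obtain ⟨t, -, ht⟩ := intermediate_value_Icc (zero_le_one (α := ℝ)) hlip.continuous.continuousOn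
    (show unitMeasure.real S / 2 ∈ Set.Icc (φ 0) (φ 1) by
      rw [h0, h1]
      constructor <;> linarith)
  have hsum : unitMeasure.real (S ∩ Set.Iic t) + unitMeasure.real (S ∩ Set.Ioi t) =
      unitMeasure.real S := by
    rw [← measureReal_inter_add_sdiff (s := S) (measurableSet_Iic (a := t)), Set.sdiff_eq,
      Set.compl_Iic]
  have ht' : unitMeasure.real (S ∩ Set.Iic t) = unitMeasure.real S / 2 := ht
  refine ⟨t, measureReal_ne_zero_iff (μ := unitMeasure) |>.1 ?_,
    measureReal_ne_zero_iff (μ := unitMeasure) |>.1 ?_⟩ <;> linarith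

theorem exists_ae_eq_indicator {𝕜 : Type*} [RCLike 𝕜] {p : ℝ≥0∞} {μ : Measure ℝ} (f : Lp 𝕜 p μ)
    {A : Set ℝ} (hA : MeasurableSet A) : ∃ g : Lp 𝕜 p μ, g =ᵐ[μ] A.indicator f := by
  have h : MemLp (A.indicator f) p μ := (Lp.memLp f).indicator hA
  exact ⟨h.toLp (A.indicator f), h.coeFn_toLp⟩

theorem exists_disjoint_splitting {𝕜 : Type*} [RCLike 𝕜] {p : ℝ≥0∞} {f : Lp 𝕜 p unitMeasure}
    (hf : f ≠ 0) : ∃ g h : Lp 𝕜 p unitMeasure, g + h = f ∧ g ≠ 0 ∧ h ≠ 0 ∧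
      ∀ᵐ t ∂unitMeasure, g t = 0 ∨ h t = 0 := by
  have hS : unitMeasure {t | f t ≠ 0} ≠ 0 := fun h => hf ((Lp.eq_zero_iff_ae_eq_zero).2 h)
  obtain ⟨s, h1, h2⟩ := exists_measure_inter_Iic_pos hS
  obtain ⟨g, hg⟩ := exists_ae_eq_indicator f (measurableSet_Iic (a := s))
  obtain ⟨h, hh⟩ := exists_ae_eq_indicator f (measurableSet_Ioi (a := s))
  refine ⟨g, h, ?_, fun h0 => h1 ?_, fun h0 => h2 ?_, ?_⟩
  · refine Lp.ext ?_
    filter_upwards [Lp.coeFn_add g h, hg, hh] with t h3 h4 h5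
    rw [h3, Pi.add_apply, h4, h5, ← Set.compl_Iic, Set.indicator_self_add_compl_apply]
  · refine measure_mono_null (fun t ht => ?_) (hg.symm.trans ((Lp.eq_zero_iff_ae_eq_zero).1 h0))
    have h4 := ht.1
    rwa [Set.mem_ofPred_eq, ← Set.indicator_of_mem ht.2 f] at h4
  · refine measure_mono_null (fun t ht => ?_) (hh.symm.trans ((Lp.eq_zero_iff_ae_eq_zero).1 h0))
    have h4 := ht.1
    rwa [Set.mem_ofPred_eq, ← Set.indicator_of_mem ht.2 f] at h4
  · filter_upwards [hg, hh] with t h3 h4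
    rw [h3, h4]
    rcases le_or_gt t s with h | h
    · exact Or.inr (Set.indicator_of_notMem (s := Set.Ioi s) (not_lt.2 h) _)
    · exact Or.inl (Set.indicator_of_notMem (s := Set.Iic s) (not_le.2 h) _)

/-! ### Isometries preserve the two summands -/

namespace LpSum

variable {𝕜 : Type*} [RCLike 𝕜] {p : ℝ≥0∞} [Fact (1 ≤ p)]

/-- The `n`-th standard basis vector of the summand `ℓᵖ`. -/
noncomputable def basisVec (𝕜 : Type*) [RCLike 𝕜] (p : ℝ≥0∞) [Fact (1 ≤ p)] (n : ℕ) : LpSum 𝕜 p :=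
  WithLp.toLp p (lp.single p n (1 : 𝕜), 0)

theorem basisVec_fst_self (n : ℕ) : (basisVec 𝕜 p n).fst n = 1 :=
  lp.single_apply_self p n 1

theorem basisVec_fst_of_ne {m n : ℕ} (h : m ≠ n) : (basisVec 𝕜 p n).fst m = 0 :=
  lp.single_apply_ne p n 1 h

theorem ext_fst_snd {x y : LpSum 𝕜 p} (h1 : x.fst = y.fst) (h2 : x.snd = y.snd) : x = y :=
  (WithLp.equiv p _).injective (Prod.ext h1 h2)

/-- Basis vectors are atoms: disjoint parts of `e_n` vanish wherever `e_n` does, and only one of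
them can use the coordinate `n`. -/
theorem eq_zero_or_of_disj_of_add_eq_basisVec {y z : LpSum 𝕜 p} {n : ℕ} (h : Disj y z)
    (hyz : y + z = basisVec 𝕜 p n) : y = 0 ∨ z = 0 := by
  have hfst : ∀ m, y.fst m + z.fst m = (basisVec 𝕜 p n).fst m := fun m => by
    rw [← hyz, WithLp.add_fst, lp.coeFn_add, Pi.add_apply]
  have hne : ∀ m, m ≠ n → y.fst m = 0 ∧ z.fst m = 0 := fun m hm => by
    have h1 := hfst m
    rw [basisVec_fst_of_ne hm] at h1
    rcases h.1 m with h2 | h2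
    · rw [h2, zero_add] at h1
      exact ⟨h2, h1⟩
    · rw [h2, add_zero] at h1
      exact ⟨h1, h2⟩
  have hsnd : y.snd = 0 ∧ z.snd = 0 := by
    have h1 : y.snd + z.snd = 0 := by
      rw [← WithLp.add_snd, hyz]
      rfl
    have h2 : ∀ᵐ t ∂unitMeasure, y.snd t = 0 ∧ z.snd t = 0 := by
      filter_upwards [h.2, Lp.coeFn_add y.snd z.snd, Lp.coeFn_zero 𝕜 p unitMeasure] with t h3 h4 h5
      rw [h1, h5, Pi.zero_apply, Pi.add_apply] at h4
      rcases h3 with h3 | h3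
      · rw [h3, zero_add] at h4
        exact ⟨h3, h4.symm⟩
      · rw [h3, add_zero] at h4
        exact ⟨h4.symm, h3⟩
    exact ⟨(Lp.eq_zero_iff_ae_eq_zero).2 (h2.mono fun t ht => ht.1),
      (Lp.eq_zero_iff_ae_eq_zero).2 (h2.mono fun t ht => ht.2)⟩
  have key : ∀ w : LpSum 𝕜 p, w.snd = 0 → (∀ m, m ≠ n → w.fst m = 0) → w.fst n = 0 → w = 0 := by
    intro w h1 h2 h3
    refine ext_fst_snd (lp.ext (funext fun m => ?_)) h1
    rcases eq_or_ne m n with rfl | hm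
    · exact h3
    · exact h2 m hm
  rcases h.1 n with h1 | h1
  · exact Or.inl (key y hsnd.1 (fun m hm => (hne m hm).1) h1)
  · exact Or.inr (key z hsnd.2 (fun m hm => (hne m hm).2) h1)

/-- A nonzero `Lᵖ` part of `T e_n` could be split into two nonzero disjoint parts. Pulling this
splitting back by `T.symm` would decompose the atom `e_n`. -/
theorem map_basisVec_snd (hp : p ≠ ∞) (hp_two : p ≠ 2) (T : LpSum 𝕜 p ≃ₗᵢ[𝕜] LpSum 𝕜 p)
    (n : ℕ) : (T (basisVec 𝕜 p n)).snd = 0 := by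
  by_contra hne
  obtain ⟨g, h, hgh, hg, hh, hd⟩ := exists_disjoint_splitting hne
  set y : LpSum 𝕜 p := WithLp.toLp p ((T (basisVec 𝕜 p n)).fst, g) with hy
  set z : LpSum 𝕜 p := WithLp.toLp p (0, h) with hz
  have hyz : y + z = T (basisVec 𝕜 p n) := ext_fst_snd (add_zero _) hgh
  have hdisj : Disj y z := ⟨fun n => Or.inr rfl, hd⟩
  have hadd : T.symm y + T.symm z = basisVec 𝕜 p n := by
    rw [← map_add, hyz, T.symm_apply_apply]
  rcases eq_zero_or_of_disj_of_add_eq_basisVec (hdisj.map hp hp_two T.symm) hadd with h0 | h0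
  · exact hg (congrArg WithLp.snd ((map_eq_zero_iff _ T.symm.injective).1 h0))
  · exact hh (congrArg WithLp.snd ((map_eq_zero_iff _ T.symm.injective).1 h0))

theorem hasSum_basisVec (hp : p ≠ ∞) {x : LpSum 𝕜 p} (hx : x.snd = 0) :
    HasSum (fun n => x.fst n • basisVec 𝕜 p n) x := by
  have h1 := lp.hasSum_single hp x.fst
  have h2 : HasSum (fun n => ((lp.single p n (x.fst n), 0) :
      lp (fun _ : ℕ => 𝕜) p × Lp 𝕜 p unitMeasure)) (x.fst, 0) :=
    h1.prodMk hasSum_zero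
  have h3 := h2.mapL ((WithLp.prodContinuousLinearEquiv p 𝕜 (lp (fun _ : ℕ => 𝕜) p)
    (Lp 𝕜 p unitMeasure)).symm : _ →L[𝕜] LpSum 𝕜 p)
  have h4 : x = WithLp.toLp p (x.fst, 0) := ext_fst_snd rfl hx
  have h5 : ∀ n, (WithLp.toLp p (lp.single p n (x.fst n), 0) : LpSum 𝕜 p) =
      x.fst n • basisVec 𝕜 p n := fun n => by
    refine ext_fst_snd ?_ (smul_zero _).symm
    refine lp.ext (funext fun m => ?_)
    rw [WithLp.smul_fst, lp.coeFn_smul, Pi.smul_apply]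
    rcases eq_or_ne m n with rfl | hm
    · rw [basisVec_fst_self, smul_eq_mul, mul_one]
      exact lp.single_apply_self p m _
    · rw [basisVec_fst_of_ne hm, smul_zero]
      exact lp.single_apply_ne p n _ hm
  have h6 : HasSum (fun n => (WithLp.toLp p (lp.single p n (x.fst n), 0) : LpSum 𝕜 p)) x := by
    rw [h4]
    exact h3
  exact (funext h5 : (fun n => (WithLp.toLp p (lp.single p n (x.fst n), 0) : LpSum 𝕜 p)) = _) ▸ h6

theorem map_snd_eq_zero (hp : p ≠ ∞) (hp_two : p ≠ 2) (T : LpSum 𝕜 p ≃ₗᵢ[𝕜] LpSum 𝕜 p)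
    {x : LpSum 𝕜 p} (hx : x.snd = 0) : (T x).snd = 0 := by
  have h1 : HasSum (fun n => (T (x.fst n • basisVec 𝕜 p n)).snd) (T x).snd :=
    (hasSum_basisVec hp hx).map
      (WithLp.sndₗ p 𝕜 (lp (fun _ : ℕ => 𝕜) p) (Lp 𝕜 p unitMeasure) ∘ₗ
      (T : LpSum 𝕜 p →ₗ[𝕜] LpSum 𝕜 p)).toAddMonoidHom
      ((WithLp.continuous_snd p _ _).comp T.continuous)
  refine h1.unique ?_
  simp only [map_smul, WithLp.smul_snd, map_basisVec_snd hp hp_two, smul_zero]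
  exact hasSum_zero

/-- The summand `Lᵖ` consists of vectors disjoint from `ℓᵖ`. The preimage of `e_n` lies in `ℓᵖ`, so
it is disjoint from `x`; hence `T x` is disjoint from `e_n`. -/
theorem map_fst_eq_zero (hp : p ≠ ∞) (hp_two : p ≠ 2) (T : LpSum 𝕜 p ≃ₗᵢ[𝕜] LpSum 𝕜 p)
    {x : LpSum 𝕜 p} (hx : x.fst = 0) : (T x).fst = 0 := by
  refine lp.ext (funext fun n => ?_)
  have h1 : (T.symm (basisVec 𝕜 p n)).snd = 0 := map_basisVec_snd hp hp_two T.symm n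
  have h2 : Disj x (T.symm (basisVec 𝕜 p n)) := by
    refine ⟨fun m => Or.inl (by rw [hx]; rfl), ?_⟩
    rw [h1]
    filter_upwards [Lp.coeFn_zero 𝕜 p unitMeasure] with t ht
    exact Or.inr ht
  have h3 := (h2.map hp hp_two T).1 n
  rw [T.apply_symm_apply] at h3
  refine h3.resolve_right ?_
  rw [basisVec_fst_self]
  exact one_ne_zero

end LpSum

/-! ### Nodes of the components -/

namespace LpSum

variable {𝕜 : Type*} [RCLike 𝕜] {p : ℝ≥0∞} [Fact (1 ≤ p)]

theorem disj_zero_right (x : LpSum 𝕜 p) : Disj x 0 := by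
  refine ⟨fun n => Or.inr rfl, ?_⟩
  filter_upwards [Lp.coeFn_zero 𝕜 p unitMeasure] with t ht
  exact Or.inr ht

theorem Disj.symm {x y : LpSum 𝕜 p} (h : Disj x y) : Disj y x :=
  ⟨fun n => (h.1 n).symm, h.2.mono fun _ ht => ht.symm⟩

theorem Disj.add_right {x y z : LpSum 𝕜 p} (hy : Disj x y) (hz : Disj x z) : Disj x (y + z) := by
  constructor
  · intro n
    rw [WithLp.add_fst, lp.coeFn_add, Pi.add_apply]
    rcases hy.1 n with h | h
    · exact Or.inl h
    · rw [h, zero_add]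
      exact hz.1 n
  · filter_upwards [hy.2, hz.2, Lp.coeFn_add y.snd z.snd] with t h1 h2 h3
    rw [WithLp.add_snd, h3, Pi.add_apply]
    rcases h1 with h | h
    · exact Or.inl h
    · rw [h, zero_add]
      exact h2

theorem Disj.smul_right {x y : LpSum 𝕜 p} (h : Disj x y) (c : 𝕜) : Disj x (c • y) := by
  constructor
  · intro n
    rw [WithLp.smul_fst, lp.coeFn_smul, Pi.smul_apply]
    exact (h.1 n).imp id fun h0 => by rw [h0, smul_zero]
  · filter_upwards [h.2, Lp.coeFn_smul c y.snd] with t h1 h2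
    rw [WithLp.smul_snd, h2, Pi.smul_apply]
    exact h1.imp id fun h0 => by rw [h0, smul_zero]

theorem Disj.sum_right {ι : Type*} {x : LpSum 𝕜 p} {s : Finset ι} {y : ι → LpSum 𝕜 p}
    (h : ∀ i ∈ s, Disj x (y i)) : Disj x (∑ i ∈ s, y i) := by
  classical
  induction s using Finset.induction_on with
  | empty => exact disj_zero_right x
  | insert i s hi ih =>
    rw [Finset.sum_insert hi]
    exact (h i (Finset.mem_insert_self i s)).add_right
      (ih fun j hj => h j (Finset.mem_insert_of_mem hj))

theorem norm_sum_rpow_of_pairwise_disj (hp : p ≠ ∞) {ι : Type*} {s : Finset ι}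
    {x : ι → LpSum 𝕜 p} (h : (s : Set ι).Pairwise fun i j => Disj (x i) (x j)) :
    ‖∑ i ∈ s, x i‖ ^ p.toReal = ∑ i ∈ s, ‖x i‖ ^ p.toReal := by
  classical
  induction s using Finset.induction_on with
  | empty => simp [Real.zero_rpow (toReal_pos hp).ne']
  | insert i s hi ih =>
    have hd : Disj (x i) (∑ j ∈ s, x j) := Disj.sum_right fun j hj =>
      h (Finset.mem_insert_self i s) (Finset.mem_insert_of_mem hj)
        (ne_of_mem_of_not_mem hj hi).symm
    rw [Finset.sum_insert hi, Finset.sum_insert hi, hd.norm_add_rpow hp,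
      ih (h.mono fun j hj => Finset.mem_insert_of_mem hj)]

/-- The element of `ℓᵖ ⊕ Lᵖ[0,1]` formed by the characteristic functions of a finite set and of a
measurable set. -/
noncomputable def charVec (𝕜 : Type*) [RCLike 𝕜] (p : ℝ≥0∞) [Fact (1 ≤ p)] (S : Finset ℕ)
    {A : Set ℝ} (hA : MeasurableSet A) : LpSum 𝕜 p :=
  WithLp.toLp p (∑ n ∈ S, lp.single p n (1 : 𝕜),
    indicatorConstLp p hA (measure_ne_top unitMeasure _) (1 : 𝕜))

variable {S S' : Finset ℕ} {A A' : Set ℝ} (hA : MeasurableSet A) (hA' : MeasurableSet A')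

theorem charVec_fst_apply (n : ℕ) : (charVec 𝕜 p S hA).fst n = if n ∈ S then 1 else 0 := by
  change (∑ i ∈ S, lp.single p i (1 : 𝕜) : lp (fun _ : ℕ => 𝕜) p) n = _
  rw [lp.coeFn_sum, Finset.sum_apply]
  have h : ∀ i ∈ S, (lp.single p i (1 : 𝕜) : lp (fun _ : ℕ => 𝕜) p) n = if n = i then 1 else 0 := by
    intro i _
    split_ifs with h
    · subst h
      exact lp.single_apply_self p n 1
    · exact lp.single_apply_ne p i 1 h
  rw [Finset.sum_congr rfl h, Finset.sum_ite_eq]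

theorem charVec_snd_ae : (charVec 𝕜 p S hA).snd =ᵐ[unitMeasure] A.indicator fun _ => (1 : 𝕜) :=
  indicatorConstLp_coeFn (hs := hA) (hμs := measure_ne_top unitMeasure _)

theorem charVec_congr (hS : S = S') (hAA : A = A') : charVec 𝕜 p S hA = charVec 𝕜 p S' hA' := by
  subst hS hAA
  rfl

theorem charVec_union (hS : Disjoint S S') (hAA : Disjoint A A') :
    charVec 𝕜 p (S ∪ S') (hA.union hA') = charVec 𝕜 p S hA + charVec 𝕜 p S' hA' := by
  refine ext_fst_snd ?_ ?_
  · exact Finset.sum_union hS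
  · exact indicatorConstLp_disjoint_union hA hA' (measure_ne_top unitMeasure _)
      (measure_ne_top unitMeasure _) hAA _

theorem disj_charVec (hS : Disjoint S S') (hAA : Disjoint A A') :
    Disj (charVec 𝕜 p S hA) (charVec 𝕜 p S' hA') := by
  constructor
  · intro n
    rw [charVec_fst_apply, charVec_fst_apply]
    by_cases h : n ∈ S
    · exact Or.inr (if_neg (Finset.disjoint_left.1 hS h))
    · exact Or.inl (if_neg h)
  · filter_upwards [charVec_snd_ae (𝕜 := 𝕜) (p := p) (S := S) hA,
      charVec_snd_ae (𝕜 := 𝕜) (p := p) (S := S') hA'] with t h1 h2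
    rw [h1, h2]
    by_cases h : t ∈ A
    · exact Or.inr (Set.indicator_of_notMem (Set.disjoint_left.1 hAA h) _)
    · exact Or.inl (Set.indicator_of_notMem h _)

theorem norm_charVec_rpow (hp : p ≠ ∞) :
    ‖charVec 𝕜 p S hA‖ ^ p.toReal = S.card + unitMeasure.real A := by
  have h0 := toReal_pos hp
  have h1 : ‖(charVec 𝕜 p S hA).fst‖ ^ p.toReal = S.card := by
    refine (lp.norm_sum_single h0 (fun _ : ℕ => (1 : 𝕜)) S).trans ?_
    simp
  have h2 : ‖(charVec 𝕜 p S hA).snd‖ ^ p.toReal = unitMeasure.real A := by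
    have := norm_indicatorConstLp (E := 𝕜) (μ := unitMeasure) (p := p) (s := A) (hs := hA)
      (hμs := measure_ne_top unitMeasure _) (c := 1)
      (zero_lt_one.trans_le (Fact.out : 1 ≤ p)).ne' hp
    refine (congrArg (· ^ p.toReal) this).trans ?_
    rw [norm_one, one_mul, one_div, Real.rpow_inv_rpow measureReal_nonneg h0.ne']
  rw [WithLp.prod_norm_eq_add h0, one_div, Real.rpow_inv_rpow (by positivity) h0.ne', h1, h2]

theorem norm_smul_charVec_rpow (hp : p ≠ ∞) (c : 𝕜) : ‖c • charVec 𝕜 p S hA‖ ^ p.toReal =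
    ‖c‖ ^ p.toReal * (S.card + unitMeasure.real A) := by
  rw [norm_smul, Real.mul_rpow (norm_nonneg _) (norm_nonneg _), norm_charVec_rpow hA hp]

end LpSum

/-! ### Dyadic cells -/

/-- The dyadic interval `[N / 2ⁿ, (N + 1) / 2ⁿ)`. -/
def dyadicCell (n N : ℕ) : Set ℝ := Set.Ico ((N : ℝ) / 2 ^ n) (((N : ℝ) + 1) / 2 ^ n)

theorem measurableSet_dyadicCell (n N : ℕ) : MeasurableSet (dyadicCell n N) :=
  measurableSet_Ico

theorem mem_dyadicCell {n N : ℕ} {t : ℝ} : t ∈ dyadicCell n N ↔ ⌊t * 2 ^ n⌋ = (N : ℤ) := by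
  rw [dyadicCell, Set.mem_Ico, div_le_iff₀ (by positivity), lt_div_iff₀ (by positivity),
    Int.floor_eq_iff]
  simp

theorem dyadicCell_succ (n N : ℕ) :
    dyadicCell n N = dyadicCell (n + 1) (2 * N) ∪ dyadicCell (n + 1) (2 * N + 1) := by
  ext t
  rw [Set.mem_union, mem_dyadicCell, mem_dyadicCell, mem_dyadicCell, pow_succ, ← mul_assoc]
  generalize t * 2 ^ n = y
  simp only [Int.floor_eq_iff]
  push_cast
  constructor
  · rintro ⟨h1, h2⟩
    rcases lt_or_ge (y * 2) (2 * N + 1) with h | h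
    · exact Or.inl ⟨by linarith, by linarith⟩
    · exact Or.inr ⟨by linarith, by linarith⟩
  · rintro (⟨h1, h2⟩ | ⟨h1, h2⟩) <;> constructor <;> linarith

theorem disjoint_dyadicCell {n N N' : ℕ} (h : N ≠ N') :
    Disjoint (dyadicCell n N) (dyadicCell n N') := by
  rw [Set.disjoint_left]
  intro t ht ht'
  rw [mem_dyadicCell] at ht ht'
  exact h (by exact_mod_cast ht.symm.trans ht')

theorem unitMeasure_real_dyadicCell {n N : ℕ} (h : N < 2 ^ n) :
    unitMeasure.real (dyadicCell n N) = ((2 : ℝ) ^ n)⁻¹ := by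
  have hsub : dyadicCell n N ⊆ Set.Icc 0 1 := by
    intro t ht
    refine ⟨le_trans (by positivity) ht.1, ht.2.le.trans ?_⟩
    rw [div_le_one (by positivity)]
    exact_mod_cast h
  rw [measureReal_restrict_apply (measurableSet_dyadicCell n N), Set.inter_eq_left.2 hsub,
    dyadicCell, Real.volume_real_Ico, ← sub_div, add_sub_cancel_left, one_div,
    max_eq_left (by positivity)]

/-! ### Atoms and dyadic blocks of the components -/

open Classical in
/-- The final number of splittings of an atomic component. -/
noncomputable def maxLevel (c : ℕ) : ℕ :=
  if h : IsAtomicComponent c then h.exists_level_eq_max.choose else 0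

theorem level_le_maxLevel {c : ℕ} (h : IsAtomicComponent c) (s : ℕ) : level c s ≤ maxLevel c := by
  rw [maxLevel, dif_pos h]
  exact h.exists_level_eq_max.choose_spec.1 s

theorem exists_level_eq_maxLevel {c : ℕ} (h : IsAtomicComponent c) :
    ∃ s, level c s = maxLevel c := by
  rw [maxLevel, dif_pos h]
  exact h.exists_level_eq_max.choose_spec.2

theorem nonempty_atomEquiv : Nonempty
    ((Σ c : {c // IsAtomicComponent c}, Fin (2 ^ maxLevel c)) ≃ ℕ) := by
  have : Infinite {c // IsAtomicComponent c} := infinite_isAtomicComponent.to_subtype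
  have : Infinite (Σ c : {c // IsAtomicComponent c}, Fin (2 ^ maxLevel c)) :=
    Infinite.of_injective (fun c => ⟨c, ⟨0, by positivity⟩⟩) fun a b h => (Sigma.mk.inj h).1
  obtain ⟨_⟩ := nonempty_denumerable (Σ c : {c // IsAtomicComponent c}, Fin (2 ^ maxLevel c))
  exact ⟨Denumerable.eqv _⟩

/-- An enumeration of the atoms of all the atomic components. -/
noncomputable def atomEquiv : (Σ c : {c // IsAtomicComponent c}, Fin (2 ^ maxLevel c)) ≃ ℕ :=
  nonempty_atomEquiv.some

theorem nonempty_diffuseEquiv : Nonempty ({c // ¬ IsAtomicComponent c} ≃ ℕ) := by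
  have : Infinite {c // ¬ IsAtomicComponent c} := infinite_not_isAtomicComponent.to_subtype
  obtain ⟨_⟩ := nonempty_denumerable {c // ¬ IsAtomicComponent c}
  exact ⟨Denumerable.eqv _⟩

/-- An enumeration of the components that are not atomic. -/
noncomputable def diffuseEquiv : {c // ¬ IsAtomicComponent c} ≃ ℕ :=
  nonempty_diffuseEquiv.some

/-- The `c`-th component has a level `k`. -/
def HasLevel (c k : ℕ) : Prop := IsAtomicComponent c → k ≤ maxLevel c

theorem hasLevel_level (c s : ℕ) : HasLevel c (level c s) := fun h => level_le_maxLevel h s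

theorem HasLevel.mono {c k l : ℕ} (h : HasLevel c l) (hkl : k ≤ l) : HasLevel c k :=
  fun hc => hkl.trans (h hc)

open Classical in
/-- The set of atoms below the `m`-th node of level `k` of the `c`-th component. -/
noncomputable def nodeAtoms (c k m : ℕ) : Finset ℕ :=
  if h : IsAtomicComponent c then
    (Finset.univ.filter fun j : Fin (2 ^ maxLevel c) => (j : ℕ) / 2 ^ (maxLevel c - k) = m).map
      ⟨fun j => atomEquiv ⟨⟨c, h⟩, j⟩, fun a b hab => by simpa using hab⟩
  else ∅

open Classical in
/-- The interval that corresponds to the `m`-th node of level `k` of the `c`-th component. -/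
noncomputable def nodeSet (c k m : ℕ) : Set ℝ :=
  if h : IsAtomicComponent c then ∅
  else if m < 2 ^ k then dyadicCell (k + diffuseEquiv ⟨c, h⟩ + 1) (2 ^ k + m) else ∅

open Classical in
/-- The total mass of the `c`-th component. -/
noncomputable def componentMass (c : ℕ) : ℝ :=
  if h : IsAtomicComponent c then 2 ^ maxLevel c else ((2 : ℝ) ^ (diffuseEquiv ⟨c, h⟩ + 1))⁻¹

theorem componentMass_pos (c : ℕ) : 0 < componentMass c := by
  unfold componentMass
  split_ifs <;> positivity

theorem measurableSet_nodeSet (c k m : ℕ) : MeasurableSet (nodeSet c k m) := by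
  unfold nodeSet
  split_ifs
  · exact MeasurableSet.empty
  · exact measurableSet_dyadicCell _ _
  · exact MeasurableSet.empty

theorem mem_nodeAtoms {c k m n : ℕ} : n ∈ nodeAtoms c k m ↔
    ((atomEquiv.symm n).1 : ℕ) = c ∧ ((atomEquiv.symm n).2 : ℕ) / 2 ^ (maxLevel c - k) = m := by
  obtain ⟨⟨⟨c', h'⟩, j⟩, rfl⟩ := atomEquiv.surjective n
  rw [Equiv.symm_apply_apply]
  unfold nodeAtoms
  constructor
  · intro hn
    split_ifs at hn with h
    · simp only [Finset.mem_map, Finset.mem_filter, Finset.mem_univ, true_and] at hn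
      obtain ⟨i, hi, hij⟩ := hn
      cases atomEquiv.injective hij
      exact ⟨rfl, hi⟩
    · simp at hn
  · rintro ⟨rfl, hj⟩
    rw [dif_pos h']
    simp only [Finset.mem_map, Finset.mem_filter, Finset.mem_univ, true_and]
    exact ⟨j, hj, rfl⟩

/-- Atom `j` lies below the node with index `j / 2 ^ (maxLevel c - k)`; passing to level `k` merges
indices in consecutive pairs. -/
theorem nodeAtoms_succ {c k : ℕ} (h : HasLevel c (k + 1)) (m : ℕ) :
    nodeAtoms c k m = nodeAtoms c (k + 1) (2 * m) ∪ nodeAtoms c (k + 1) (2 * m + 1) := by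
  ext n
  rw [Finset.mem_union, mem_nodeAtoms, mem_nodeAtoms, mem_nodeAtoms, ← and_or_left]
  refine and_congr_right fun hc => ?_
  have hk : k + 1 ≤ maxLevel c := h (hc ▸ (atomEquiv.symm n).1.2)
  rw [show maxLevel c - k = (maxLevel c - (k + 1)) + 1 by omega, pow_succ, ← Nat.div_div_eq_div_mul]
  omega

theorem nodeSet_succ (c k m : ℕ) :
    nodeSet c k m = nodeSet c (k + 1) (2 * m) ∪ nodeSet c (k + 1) (2 * m + 1) := by
  unfold nodeSet
  split_ifs with h h1 h2 h3 h4 <;> try (rw [pow_succ] at *; omega)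
  · simp
  · rw [dyadicCell_succ]
    congr 2 <;> omega
  · simp

theorem disjoint_nodeAtoms {c c' k k' m m' : ℕ} (hk : c = c' → k = k')
    (hne : c ≠ c' ∨ m ≠ m') : Disjoint (nodeAtoms c k m) (nodeAtoms c' k' m') := by
  rw [Finset.disjoint_left]
  intro n h1 h2
  rw [mem_nodeAtoms] at h1 h2
  have hc : c = c' := h1.1.symm.trans h2.1
  subst hc
  rw [hk rfl] at h1
  exact hne.elim (fun h => h rfl) fun h => h (h1.2.symm.trans h2.2)

/-- With `i` the number of the diffuse component, all its cells lie in the block `[2⁻⁽ⁱ⁺¹⁾, 2⁻ⁱ)`.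
These blocks are disjoint for different `i` and together fill `(0,1)`. -/
theorem nodeSet_subset {c k m : ℕ} (h : ¬ IsAtomicComponent c) {t : ℝ} (ht : t ∈ nodeSet c k m) :
    1 ≤ t * 2 ^ (diffuseEquiv ⟨c, h⟩ + 1) ∧ t * 2 ^ diffuseEquiv ⟨c, h⟩ < 1 := by
  rw [nodeSet, dif_neg h] at ht
  split_ifs at ht with hm
  · obtain ⟨h1, h2⟩ := ht
    generalize diffuseEquiv ⟨c, h⟩ = i at *
    rw [div_le_iff₀ (by positivity)] at h1
    rw [lt_div_iff₀ (by positivity)] at h2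
    have hm' : (m : ℝ) + 1 ≤ 2 ^ k := by exact_mod_cast hm
    have h2k : (0 : ℝ) < 2 ^ k := by positivity
    push_cast at h1 h2
    have e : (2 : ℝ) ^ (k + i + 1) = 2 ^ k * (2 ^ i * 2) := by ring
    rw [e] at h1 h2
    rw [pow_succ]
    constructor
    · by_contra hcon
      have : t * (2 ^ k * (2 ^ i * 2)) = 2 ^ k * (t * (2 ^ i * 2)) := by ring
      nlinarith [m.cast_nonneg (α := ℝ)]
    · have : t * (2 ^ k * (2 ^ i * 2)) = 2 * (2 ^ k * (t * 2 ^ i)) := by ring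
      by_contra hcon
      nlinarith
  · simp at ht

theorem disjoint_nodeSet {c c' k k' m m' : ℕ} (hk : c = c' → k = k')
    (hne : c ≠ c' ∨ m ≠ m') : Disjoint (nodeSet c k m) (nodeSet c' k' m') := by
  have hempty : ∀ {c k m : ℕ}, IsAtomicComponent c → nodeSet c k m = ∅ := fun h => dif_pos h
  by_cases h : IsAtomicComponent c
  · rw [hempty h]
    exact Set.empty_disjoint _
  by_cases h' : IsAtomicComponent c'
  · rw [hempty h']
    exact Set.disjoint_empty _
  by_cases hc : c = c'
  · subst hc
    obtain rfl := hk rfl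
    have hm := hne.resolve_left fun h => h rfl
    simp only [nodeSet, dif_neg h]
    split_ifs
    · exact disjoint_dyadicCell (by omega)
    all_goals simp
  · rw [Set.disjoint_left]
    intro t h1 h2
    obtain ⟨a1, a2⟩ := nodeSet_subset h h1
    obtain ⟨b1, b2⟩ := nodeSet_subset h' h2
    have hi : diffuseEquiv ⟨c, h⟩ ≠ diffuseEquiv ⟨c', h'⟩ := fun he =>
      hc (congrArg Subtype.val (diffuseEquiv.injective he))
    have ht : 0 < t := by
      by_contra hcon
      have : t * 2 ^ (diffuseEquiv ⟨c, h⟩ + 1) ≤ 0 :=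
        mul_nonpos_of_nonpos_of_nonneg (not_lt.1 hcon) (by positivity)
      linarith
    have key : ∀ {i j : ℕ}, i < j → t * 2 ^ (i + 1) ≤ t * 2 ^ j := fun hij =>
      mul_le_mul_of_nonneg_left (pow_le_pow_right₀ one_le_two hij) ht.le
    rcases hi.lt_or_gt with hlt | hlt
    · linarith [key hlt]
    · linarith [key hlt]

theorem card_filter_fin_div_eq {a d m : ℕ} (hd : 0 < d) (hm : m < a) :
    (Finset.univ.filter fun j : Fin (a * d) => (j : ℕ) / d = m).card = d := by
  rw [← Finset.card_map Fin.valEmbedding]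
  have : (Finset.univ.filter fun j : Fin (a * d) => (j : ℕ) / d = m).map Fin.valEmbedding =
      Finset.Ico (m * d) ((m + 1) * d) := by
    ext x
    simp only [Finset.mem_map, Finset.mem_filter, Finset.mem_univ, true_and, Fin.valEmbedding_apply,
      Finset.mem_Ico]
    rw [add_mul, one_mul]
    constructor
    · rintro ⟨j, hj, rfl⟩
      rwa [Nat.div_eq_iff hd, ← Nat.lt_iff_le_pred (by positivity)] at hj
    · intro hx
      have hlt : x < a * d := by
        have := Nat.mul_le_mul_right d hm
        rw [Nat.succ_mul] at this
        exact hx.2.trans_le this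
      refine ⟨⟨x, hlt⟩, ?_, rfl⟩
      change x / d = m
      rw [Nat.div_eq_iff hd]
      have := hx.1
      have := hx.2
      constructor <;> omega
  rw [this, Nat.card_Ico]
  rw [add_mul, one_mul, Nat.add_sub_cancel_left]

/-- Counting atoms and measuring cells obey the same law: each splitting halves the mass. This makes
the two kinds of component indistinguishable by norms. -/
theorem nodeAtoms_card_add_nodeSet {c k m : ℕ} (h : HasLevel c k) (hm : m < 2 ^ k) :
    ((nodeAtoms c k m).card : ℝ) + unitMeasure.real (nodeSet c k m) = componentMass c / 2 ^ k := by
  by_cases hc : IsAtomicComponent c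
  · have hk : maxLevel c = k + (maxLevel c - k) := (Nat.add_sub_cancel' (h hc)).symm
    have hcard : (Finset.univ.filter fun j : Fin (2 ^ maxLevel c) =>
        (j : ℕ) / 2 ^ (maxLevel c - k) = m).card = 2 ^ (maxLevel c - k) := by
      have h1 := card_filter_fin_div_eq (a := 2 ^ k) (d := 2 ^ (maxLevel c - k)) (by positivity) hm
      have e : 2 ^ k * 2 ^ (maxLevel c - k) = 2 ^ maxLevel c := by rw [← pow_add, ← hk]
      rwa [e] at h1
    rw [nodeAtoms, dif_pos hc, nodeSet, dif_pos hc, componentMass, dif_pos hc, Finset.card_map,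
      hcard, measureReal_empty, add_zero, eq_div_iff (by positivity)]
    push_cast
    rw [← pow_add, Nat.sub_add_cancel (h hc)]
  · have hlt : 2 ^ k + m < 2 ^ (k + diffuseEquiv ⟨c, hc⟩ + 1) := by
      calc 2 ^ k + m < 2 ^ (k + 1) := by rw [pow_succ]; omega
        _ ≤ _ := Nat.pow_le_pow_right two_pos (by omega)
    rw [nodeAtoms, dif_neg hc, nodeSet, dif_neg hc, if_pos hm, componentMass, dif_neg hc,
      unitMeasure_real_dyadicCell hlt, Finset.card_empty, Nat.cast_zero, zero_add, div_eq_mul_inv,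
      ← mul_inv, ← pow_add]
    congr 2
    omega

/-! ### Nodes as vectors -/

namespace LpSum

variable (𝕜 : Type*) [RCLike 𝕜] (p : ℝ≥0∞) [Fact (1 ≤ p)]

/-- The `m`-th node of level `k` of the `c`-th component, normalized so that the root of the
component has norm `1`. -/
noncomputable def node (c k m : ℕ) : LpSum 𝕜 p :=
  ((((componentMass c)⁻¹ ^ (p.toReal)⁻¹ : ℝ)) : 𝕜) •
    charVec 𝕜 p (nodeAtoms c k m) (measurableSet_nodeSet c k m)

theorem norm_node_rpow (hp : p ≠ ∞) {c k m : ℕ} (h : HasLevel c k) (hm : m < 2 ^ k) :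
    ‖node 𝕜 p c k m‖ ^ p.toReal = ((2 : ℝ) ^ k)⁻¹ := by
  have hc := componentMass_pos c
  rw [node, norm_smul_charVec_rpow _ hp, nodeAtoms_card_add_nodeSet h hm, RCLike.norm_ofReal,
    abs_of_nonneg (by positivity), Real.rpow_inv_rpow (by positivity) (toReal_pos hp).ne']
  field_simp

theorem disj_node {c c' k k' m m' : ℕ} (hk : c = c' → k = k') (hne : c ≠ c' ∨ m ≠ m') :
    Disj (node 𝕜 p c k m) (node 𝕜 p c' k' m') :=
  (((disj_charVec _ _ (disjoint_nodeAtoms hk hne) (disjoint_nodeSet hk hne)).smul_right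
    _).symm.smul_right _).symm

theorem node_succ {c k : ℕ} (h : HasLevel c (k + 1)) (m : ℕ) :
    node 𝕜 p c k m = node 𝕜 p c (k + 1) (2 * m) + node 𝕜 p c (k + 1) (2 * m + 1) := by
  have hne : c ≠ c ∨ 2 * m ≠ 2 * m + 1 := Or.inr (by omega)
  rw [node, node, node, ← smul_add, ← charVec_union _ _ (disjoint_nodeAtoms (fun _ => rfl) hne)
    (disjoint_nodeSet (fun _ => rfl) hne)]
  exact congrArg _ (charVec_congr _ _ (nodeAtoms_succ h m) (nodeSet_succ c k m))

theorem fst_charVec_empty {A : Set ℝ} (hA : MeasurableSet A) : (charVec 𝕜 p ∅ hA).fst = 0 :=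
  Finset.sum_empty (f := fun n : ℕ => (lp.single p n (1 : 𝕜) : lp (fun _ : ℕ => 𝕜) p))

theorem charVec_empty : charVec 𝕜 p ∅ MeasurableSet.empty = 0 :=
  ext_fst_snd (fst_charVec_empty 𝕜 p _) indicatorConstLp_empty

theorem node_eq_zero {c k m : ℕ} (h : HasLevel c k) (hm : 2 ^ k ≤ m) : node 𝕜 p c k m = 0 := by
  have h1 : nodeAtoms c k m = ∅ := by
    rw [Finset.eq_empty_iff_forall_notMem]
    intro n hn
    rw [mem_nodeAtoms] at hn
    obtain ⟨hc, hn⟩ := hn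
    have hk : k ≤ maxLevel c := h (hc ▸ (atomEquiv.symm n).1.2)
    have hlt : ((atomEquiv.symm n).2 : ℕ) < 2 ^ maxLevel c :=
      (atomEquiv.symm n).2.2.trans_eq (by rw [hc])
    have : ((atomEquiv.symm n).2 : ℕ) / 2 ^ (maxLevel c - k) < 2 ^ k := by
      rw [Nat.div_lt_iff_lt_mul (by positivity), ← pow_add, Nat.add_sub_cancel' hk]
      exact hlt
    omega
  have h2 : nodeSet c k m = ∅ := by
    unfold nodeSet
    split_ifs
    · rfl
    · omega
    · rfl
  rw [node, charVec_congr _ MeasurableSet.empty h1 h2, charVec_empty, smul_zero]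

/-- The indices on the finer level are grouped into even and odd neighbours, that is, into the two
children of each node. -/
theorem sum_filter_div_eq {M : Type*} [AddCommMonoid M] (f : ℕ → M) (k d m : ℕ) :
    ∑ i ∈ (Finset.range (2 ^ (k + (d + 1)))).filter (fun i => i / 2 ^ (d + 1) = m), f i =
      ∑ i ∈ (Finset.range (2 ^ (k + d))).filter (fun i => i / 2 ^ d = m),
        (f (2 * i) + f (2 * i + 1)) := by
  have e : 2 ^ (k + (d + 1)) = 2 * 2 ^ (k + d) := by ring
  rw [Finset.sum_filter, Finset.sum_filter, e]
  generalize 2 ^ (k + d) = N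
  induction N with
  | zero => simp
  | succ N ih =>
    rw [Finset.sum_range_succ, mul_add, mul_one, Finset.sum_range_succ, Finset.sum_range_succ, ih,
      add_assoc]
    have h1 : 2 * N / 2 ^ (d + 1) = N / 2 ^ d := by
      rw [pow_succ', ← Nat.div_div_eq_div_mul, Nat.mul_div_cancel_left _ two_pos]
    have h2 : (2 * N + 1) / 2 ^ (d + 1) = N / 2 ^ d := by
      rw [pow_succ', ← Nat.div_div_eq_div_mul]
      congr 1
      omega
    rw [h1, h2]
    split_ifs <;> simp

theorem node_eq_sum {c k d : ℕ} (h : HasLevel c (k + d)) (m : ℕ) :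
    node 𝕜 p c k m = ∑ i ∈ (Finset.range (2 ^ (k + d))).filter (fun i => i / 2 ^ d = m),
      node 𝕜 p c (k + d) i := by
  rcases le_or_gt (2 ^ k) m with hm | hm
  · rw [node_eq_zero 𝕜 p (h.mono (Nat.le_add_right k d)) hm, Finset.filter_false_of_mem,
      Finset.sum_empty]
    intro i hi he
    rw [Finset.mem_range, pow_add, ← Nat.div_lt_iff_lt_mul (by positivity)] at hi
    omega
  induction d with
  | zero => simp [hm]
  | succ d ih =>
    rw [sum_filter_div_eq, ih (h.mono (by omega))]
    exact Finset.sum_congr rfl fun i _ => node_succ 𝕜 p h i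

theorem snd_node {c : ℕ} (h : IsAtomicComponent c) (k m : ℕ) : (node 𝕜 p c k m).snd = 0 := by
  have h2 : nodeSet c k m = ∅ := dif_pos h
  rw [node, charVec_congr (S' := nodeAtoms c k m) _ MeasurableSet.empty rfl h2, WithLp.smul_snd]
  exact (congrArg _ indicatorConstLp_empty).trans (smul_zero _)

theorem fst_node {c : ℕ} (h : ¬ IsAtomicComponent c) (k m : ℕ) : (node 𝕜 p c k m).fst = 0 := by
  have h1 : nodeAtoms c k m = ∅ := dif_neg h
  rw [node, charVec_congr _ (measurableSet_nodeSet c k m) h1 rfl, WithLp.smul_fst,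
    fst_charVec_empty, smul_zero]

/-- The sequence that presents `ℓᵖ ⊕ Lᵖ[0,1]`: it lists the nodes of the components. -/
noncomputable def nodeSeq (n : ℕ) : LpSum 𝕜 p :=
  node 𝕜 p n.unpair.1 (level n.unpair.1 n.unpair.2.unpair.1) n.unpair.2.unpair.2

theorem nodeSeq_pair (c s m : ℕ) :
    nodeSeq 𝕜 p (Nat.pair c (Nat.pair s m)) = node 𝕜 p c (level c s) m := by
  simp [nodeSeq]

end LpSum

/-! ### The linear span of the nodes is dense -/

namespace LpSum

variable {𝕜 : Type*} [RCLike 𝕜] {p : ℝ≥0∞} [Fact (1 ≤ p)]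

theorem tendsto_charVec (hp : p ≠ ∞) {t : ℕ → Set ℝ} {A : Set ℝ} (ht : ∀ n, MeasurableSet (t n))
    (hA : MeasurableSet A)
    (h : Filter.Tendsto (fun n => unitMeasure (symmDiff (t n) A)) Filter.atTop (𝓝 0)) :
    Filter.Tendsto (fun n => charVec 𝕜 p ∅ (ht n)) Filter.atTop (𝓝 (charVec 𝕜 p ∅ hA)) := by
  have h1 := tendsto_indicatorConstLp_set (μ := unitMeasure) (c := (1 : 𝕜)) (ht := ht) (hs := hA)
    (hμs := measure_ne_top unitMeasure _) (hμt := fun n => measure_ne_top unitMeasure _) hp h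
  exact ((WithLp.prod_continuous_toLp p _ _).tendsto _).comp (tendsto_const_nhds.prodMk_nhds h1)

/-- Intervals start at `1 / 2ⁿ` because the cell at the origin belongs to no block; this loss
disappears in the limit. -/
theorem charVec_Ico_mem {K : Submodule 𝕜 (LpSum 𝕜 p)}
    (hK : ∀ n N, 1 ≤ N → N < 2 ^ n → charVec 𝕜 p ∅ (measurableSet_dyadicCell n N) ∈ K) (n M : ℕ)
    (hM : M ≤ 2 ^ n) :
    charVec 𝕜 p ∅ (measurableSet_Ico (a := (1 : ℝ) / 2 ^ n) (b := (M : ℝ) / 2 ^ n)) ∈ K := by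
  have hempty : M ≤ 1 → Set.Ico ((1 : ℝ) / 2 ^ n) ((M : ℝ) / 2 ^ n) = ∅ := fun h =>
    Set.Ico_eq_empty_of_le (by gcongr; exact_mod_cast h)
  induction M with
  | zero =>
    rw [charVec_congr _ MeasurableSet.empty rfl (hempty (by omega)), charVec_empty]
    exact K.zero_mem
  | succ M ih =>
    rcases Nat.eq_zero_or_pos M with rfl | hM0
    · rw [charVec_congr _ MeasurableSet.empty rfl (hempty (by omega)), charVec_empty]
      exact K.zero_mem
    have h1 : (1 : ℝ) / 2 ^ n ≤ (M : ℝ) / 2 ^ n := by gcongr; exact_mod_cast hM0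
    have h2 : (M : ℝ) / 2 ^ n ≤ ((M : ℝ) + 1) / 2 ^ n := by gcongr; linarith
    have hd : Disjoint (Set.Ico ((1 : ℝ) / 2 ^ n) ((M : ℝ) / 2 ^ n)) (dyadicCell n M) := by
      rw [Set.disjoint_left]
      exact fun t ht ht' => absurd ht.2 (not_lt.2 ht'.1)
    have hu : Set.Ico ((1 : ℝ) / 2 ^ n) (((M + 1 : ℕ) : ℝ) / 2 ^ n) =
        Set.Ico ((1 : ℝ) / 2 ^ n) ((M : ℝ) / 2 ^ n) ∪ dyadicCell n M := by
      rw [dyadicCell, Set.Ico_union_Ico_eq_Ico h1 h2]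
      push_cast
      rfl
    rw [charVec_congr (S' := ∅ ∪ ∅) _ (measurableSet_Ico.union (measurableSet_dyadicCell n M))
      (Finset.empty_union ∅).symm hu,
      charVec_union measurableSet_Ico (measurableSet_dyadicCell n M) (Finset.disjoint_empty_left ∅) hd]
    exact K.add_mem (ih (by omega) fun h => Set.Ico_eq_empty_of_le (by gcongr; exact_mod_cast h))
      (hK n M hM0 (by omega))

/-- The set `A` is an initial segment of `[0,1]` up to its endpoint. It is approximated by unions of
cells with numbers `1, …, M n - 1`. -/
theorem charVec_mem_of_initial (hp : p ≠ ∞) {K : Submodule 𝕜 (LpSum 𝕜 p)}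
    (hclosed : IsClosed (K : Set (LpSum 𝕜 p)))
    (hK : ∀ n N, 1 ≤ N → N < 2 ^ n → charVec 𝕜 p ∅ (measurableSet_dyadicCell n N) ∈ K)
    {A : Set ℝ} (hA : MeasurableSet A) {x : ℝ} (hx : x ∈ Set.Icc (0 : ℝ) 1)
    (h1 : ∀ t ∈ Set.Icc (0 : ℝ) 1, t < x → t ∈ A) (h2 : ∀ t ∈ Set.Icc (0 : ℝ) 1, t ∈ A → t ≤ x) :
    charVec 𝕜 p ∅ hA ∈ K := by
  let M : ℕ → ℕ := fun n => ⌊x * 2 ^ n⌋₊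
  have hM : ∀ n, M n ≤ 2 ^ n := fun n => by
    refine Nat.floor_le_of_le ?_
    push_cast
    exact mul_le_of_le_one_left (by positivity) hx.2
  refine hclosed.mem_of_tendsto (tendsto_charVec hp (t := fun n =>
    Set.Ico ((1 : ℝ) / 2 ^ n) ((M n : ℝ) / 2 ^ n)) (fun n => measurableSet_Ico) hA ?_)
    (Filter.Eventually.of_forall fun n => charVec_Ico_mem hK n (M n) (hM n))
  have hlim : Filter.Tendsto (fun n : ℕ => ENNReal.ofReal (((2 : ℝ) ^ n)⁻¹) +
      ENNReal.ofReal (((2 : ℝ) ^ n)⁻¹)) Filter.atTop (𝓝 0) := by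
    have h : Filter.Tendsto (fun n : ℕ => ((2 : ℝ) ^ n)⁻¹) Filter.atTop (𝓝 0) :=
      tendsto_inv_atTop_zero.comp (tendsto_pow_atTop_atTop_of_one_lt one_lt_two)
    have h' := ENNReal.tendsto_ofReal h
    rw [ENNReal.ofReal_zero] at h'
    simpa using h'.add h'
  refine tendsto_of_tendsto_of_tendsto_of_le_of_le tendsto_const_nhds hlim (fun n => zero_le)
    fun n => ?_
  have hpos : (0 : ℝ) < 2 ^ n := by positivity
  have hMx : (M n : ℝ) / 2 ^ n ≤ x := by
    rw [div_le_iff₀ hpos]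
    exact Nat.floor_le (mul_nonneg hx.1 hpos.le)
  have hxM : x < (M n : ℝ) / 2 ^ n + ((2 : ℝ) ^ n)⁻¹ := by
    rw [← one_div, ← add_div, lt_div_iff₀ hpos]
    exact Nat.lt_floor_add_one _
  -- The error consists of the missing cell at the origin and of the last incomplete cell, each of
  -- length `2⁻ⁿ`.
  have hsub : symmDiff (Set.Ico ((1 : ℝ) / 2 ^ n) ((M n : ℝ) / 2 ^ n)) A ∩ Set.Icc 0 1 ⊆
      Set.Icc 0 ((2 : ℝ) ^ n)⁻¹ ∪ Set.Icc ((M n : ℝ) / 2 ^ n) ((M n : ℝ) / 2 ^ n + ((2 : ℝ) ^ n)⁻¹) := by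
    rintro t ⟨ht | ht, ht01⟩
    · exact absurd (h1 t ht01 (ht.1.2.trans_le hMx)) ht.2
    · by_cases hlt : t ≤ ((2 : ℝ) ^ n)⁻¹
      · exact Or.inl ⟨ht01.1, hlt⟩
      · refine Or.inr ⟨?_, (h2 t ht01 ht.1).trans hxM.le⟩
        by_contra hcon
        exact ht.2 ⟨by rw [one_div]; exact (not_le.1 hlt).le, not_le.1 hcon⟩
  calc unitMeasure (symmDiff (Set.Ico ((1 : ℝ) / 2 ^ n) ((M n : ℝ) / 2 ^ n)) A)
      = volume (symmDiff (Set.Ico ((1 : ℝ) / 2 ^ n) ((M n : ℝ) / 2 ^ n)) A ∩ Set.Icc 0 1) :=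
        Measure.restrict_apply (measurableSet_Ico.symmDiff hA)
    _ ≤ _ := measure_mono hsub
    _ ≤ _ := measure_union_le _ _
    _ = _ := by rw [Real.volume_Icc, Real.volume_Icc, sub_zero, add_sub_cancel_left]

/-- Dynkin's argument: the sets whose characteristic vectors lie in a closed subspace are closed
under complements and countable disjoint unions, and they include the generating half-lines. -/
theorem charVec_mem (hp : p ≠ ∞) {K : Submodule 𝕜 (LpSum 𝕜 p)}
    (hclosed : IsClosed (K : Set (LpSum 𝕜 p)))
    (hK : ∀ n N, 1 ≤ N → N < 2 ^ n → charVec 𝕜 p ∅ (measurableSet_dyadicCell n N) ∈ K)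
    {A : Set ℝ} (hA : MeasurableSet A) : charVec 𝕜 p ∅ hA ∈ K := by
  induction A, hA using MeasurableSpace.induction_on_inter
    ((BorelSpace.measurable_eq (α := ℝ)).trans (borel_eq_generateFrom_Iio ℝ)) isPiSystem_Iio with
  | empty =>
    rw [charVec_empty]
    exact K.zero_mem
  | basic t ht =>
    obtain ⟨x, rfl⟩ := ht
    -- Only the trace on `[0,1]` matters, so the endpoint is clamped to this interval.
    refine charVec_mem_of_initial hp hclosed hK _ (x := max 0 (min x 1))
      ⟨le_max_left _ _, max_le zero_le_one (min_le_right _ _)⟩ (fun t ht htx => ?_)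
      fun t ht htx => ?_
    · rcases lt_max_iff.1 htx with h | h
      · exact absurd h (not_lt.2 ht.1)
      · exact h.trans_le (min_le_left _ _)
    · exact le_max_of_le_right (le_min (Set.mem_Iio.1 htx).le ht.2)
  | compl A hA ih =>
    have huniv : charVec 𝕜 p ∅ (MeasurableSet.univ : MeasurableSet (Set.univ : Set ℝ)) ∈ K :=
      charVec_mem_of_initial hp hclosed hK _ (x := 1) ⟨zero_le_one, le_rfl⟩
        (fun t _ _ => Set.mem_univ t) fun t ht _ => ht.2
    have h := charVec_union (𝕜 := 𝕜) (p := p) hA hA.compl (Finset.disjoint_empty_left ∅)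
      disjoint_compl_right
    rw [charVec_congr (S' := ∅) _ MeasurableSet.univ (Finset.empty_union ∅)
      (Set.union_compl_self A)] at h
    rw [← add_sub_cancel_left (charVec 𝕜 p ∅ hA) (charVec 𝕜 p ∅ hA.compl), ← h]
    exact K.sub_mem huniv ih
  | iUnion f hd hf ih =>
    have hfin : ∀ n, MeasurableSet (⋃ i ∈ Finset.range n, f i) := fun n =>
      Finset.measurableSet_biUnion _ fun i _ => hf i
    have hmem : ∀ n, charVec 𝕜 p ∅ (hfin n) ∈ K := fun n => by
      induction n with
      | zero =>
        rw [charVec_congr _ MeasurableSet.empty rfl (by simp), charVec_empty]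
        exact K.zero_mem
      | succ n ihn =>
        have hdn : Disjoint (⋃ i ∈ Finset.range n, f i) (f n) := by
          simp only [Set.disjoint_iUnion_left]
          exact fun i hi => hd (Finset.mem_range.1 hi).ne
        rw [charVec_congr (S' := ∅ ∪ ∅) _ ((hfin n).union (hf n)) (Finset.empty_union ∅).symm
          (by rw [Finset.range_add_one, Finset.set_biUnion_insert, Set.union_comm]),
          charVec_union (hfin n) (hf n) (Finset.disjoint_empty_left ∅) hdn]
        exact K.add_mem ihn (ih n)
    refine hclosed.mem_of_tendsto (tendsto_charVec hp hfin (MeasurableSet.iUnion hf) ?_)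
      (Filter.Eventually.of_forall hmem)
    refine tendsto_of_tendsto_of_tendsto_of_le_of_le tendsto_const_nhds
      (tendsto_measure_biUnion_Ici_zero_of_pairwise_disjoint (μ := unitMeasure)
        (fun i => (hf i).nullMeasurableSet) hd) (fun n => zero_le) fun n => measure_mono ?_
    rintro t (⟨ht, ht'⟩ | ⟨ht, ht'⟩)
    · simp only [Set.mem_iUnion] at ht ht'
      obtain ⟨i, -, hi⟩ := ht
      exact absurd ⟨i, hi⟩ ht'
    · simp only [Set.mem_iUnion, Finset.mem_range] at ht ht' ⊢
      obtain ⟨i, hi⟩ := ht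
      exact ⟨i, not_lt.1 fun hlt => ht' ⟨i, hlt, hi⟩, hi⟩

theorem toLp_zero_mem (hp : p ≠ ∞) {K : Submodule 𝕜 (LpSum 𝕜 p)}
    (hclosed : IsClosed (K : Set (LpSum 𝕜 p)))
    (hK : ∀ n N, 1 ≤ N → N < 2 ^ n → charVec 𝕜 p ∅ (measurableSet_dyadicCell n N) ∈ K)
    (f : Lp 𝕜 p unitMeasure) : (WithLp.toLp p (0, f) : LpSum 𝕜 p) ∈ K := by
  induction f using Lp.induction hp with
  | @indicatorConst c A hs hμs =>
    have h : (WithLp.toLp p (0, (Lp.simpleFunc.indicatorConst p hs hμs.ne c : Lp 𝕜 p unitMeasure)) :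
        LpSum 𝕜 p) = c • charVec 𝕜 p ∅ hs := by
      refine ext_fst_snd ?_ ?_
      · rw [WithLp.smul_fst, fst_charVec_empty, smul_zero]
        rfl
      · refine Lp.ext ?_
        rw [WithLp.smul_snd]
        change (Lp.simpleFunc.indicatorConst p hs hμs.ne c : Lp 𝕜 p unitMeasure) =ᵐ[_] _
        rw [Lp.simpleFunc.coe_indicatorConst]
        filter_upwards [indicatorConstLp_coeFn (hs := hs) (hμs := hμs.ne) (p := p) (c := c),
          Lp.coeFn_smul c (charVec 𝕜 p ∅ hs).snd, charVec_snd_ae (𝕜 := 𝕜) (p := p) (S := ∅) hs]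
          with t h1 h2 h3
        rw [h1, h2, Pi.smul_apply, h3]
        by_cases ht : t ∈ A
        · rw [Set.indicator_of_mem ht, Set.indicator_of_mem ht, smul_eq_mul, mul_one]
        · rw [Set.indicator_of_notMem ht, Set.indicator_of_notMem ht, smul_zero]
    rw [h]
    exact K.smul_mem c (charVec_mem hp hclosed hK hs)
  | add hf hg _ h1 h2 =>
    have := K.add_mem h1 h2
    rwa [← WithLp.toLp_add, Prod.mk_add_mk, add_zero] at this
  | isClosed =>
    exact hclosed.preimage ((WithLp.prod_continuous_toLp p _ _).comp
      (continuous_const.prodMk continuous_id))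

theorem smul_charVec_mem {K : Submodule 𝕜 (LpSum 𝕜 p)} (hK : ∀ n, nodeSeq 𝕜 p n ∈ K) {c k m : ℕ}
    (hk : ∃ s, level c s = k) : charVec 𝕜 p (nodeAtoms c k m) (measurableSet_nodeSet c k m) ∈ K := by
  obtain ⟨s, rfl⟩ := hk
  have h := hK (Nat.pair c (Nat.pair s m))
  rw [nodeSeq_pair, node] at h
  have hc := componentMass_pos c
  refine (K.smul_mem_iff ?_).1 h
  rw [Ne, RCLike.ofReal_eq_zero]
  exact (by positivity : (0 : ℝ) < (componentMass c)⁻¹ ^ (p.toReal)⁻¹).ne'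

theorem charVec_dyadicCell_mem {K : Submodule 𝕜 (LpSum 𝕜 p)} (hK : ∀ n, nodeSeq 𝕜 p n ∈ K)
    (n N : ℕ) (hN : 1 ≤ N) (hNn : N < 2 ^ n) :
    charVec 𝕜 p ∅ (measurableSet_dyadicCell n N) ∈ K := by
  -- The leading binary digit of `N` gives the level `k` of the cell in its tree, and `n - k - 1` is
  -- the number of its block.
  obtain ⟨k, hk⟩ : ∃ k, k = Nat.log 2 N := ⟨_, rfl⟩
  have hk1 : 2 ^ k ≤ N := hk ▸ Nat.pow_log_le_self 2 (by omega)
  have hk2 : N < 2 ^ (k + 1) := hk ▸ Nat.lt_pow_succ_log_self one_lt_two N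
  have hkn : k < n := (Nat.pow_lt_pow_iff_right one_lt_two).1 (hk1.trans_lt hNn)
  obtain ⟨⟨c, hc⟩, hi⟩ := diffuseEquiv.surjective (n - k - 1)
  obtain ⟨s, hs⟩ : ∃ s, k ≤ level c s := by
    by_contra! h
    exact hc ⟨k, fun s => (h s).le⟩
  have hset : nodeSet c k (N - 2 ^ k) = dyadicCell n N := by
    rw [nodeSet, dif_neg hc, if_pos (by rw [pow_succ] at hk2; omega), hi]
    congr 1 <;> omega
  have hatoms : nodeAtoms c k (N - 2 ^ k) = ∅ := dif_neg hc
  have h := smul_charVec_mem hK (m := N - 2 ^ k) (exists_level_eq hs)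
  rwa [charVec_congr _ (measurableSet_dyadicCell n N) hatoms hset] at h

/-- On the final level of an atomic component each node carries exactly one atom, and this level is
reached at some stage. -/
theorem basisVec_mem {K : Submodule 𝕜 (LpSum 𝕜 p)} (hK : ∀ n, nodeSeq 𝕜 p n ∈ K) (n : ℕ) :
    basisVec 𝕜 p n ∈ K := by
  obtain ⟨⟨⟨c, hc⟩, j⟩, rfl⟩ := atomEquiv.surjective n
  have hatoms : nodeAtoms c (maxLevel c) j = {atomEquiv ⟨⟨c, hc⟩, j⟩} := by
    ext i
    obtain ⟨⟨⟨c', hc'⟩, j'⟩, rfl⟩ := atomEquiv.surjective i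
    rw [mem_nodeAtoms, Equiv.symm_apply_apply, Nat.sub_self, pow_zero, Nat.div_one,
      Finset.mem_singleton, atomEquiv.injective.eq_iff]
    constructor
    · rintro ⟨h1, h2⟩
      dsimp only at h1 h2
      subst h1
      rw [Fin.ext h2]
    · intro h
      cases h
      exact ⟨rfl, rfl⟩
  have h := smul_charVec_mem hK (m := j) (exists_level_eq_maxLevel hc)
  rw [charVec_congr _ MeasurableSet.empty hatoms (dif_pos hc)] at h
  have e : charVec 𝕜 p {atomEquiv ⟨⟨c, hc⟩, j⟩} MeasurableSet.empty =
      basisVec 𝕜 p (atomEquiv ⟨⟨c, hc⟩, j⟩) := by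
    refine ext_fst_snd ?_ indicatorConstLp_empty
    exact Finset.sum_singleton _ _
  rwa [e] at h

theorem isPresentation_nodeSeq (hp : p ≠ ∞) : IsPresentation 𝕜 (nodeSeq 𝕜 p) := by
  have hK : ∀ n, nodeSeq 𝕜 p n ∈ (Submodule.span 𝕜 (Set.range (nodeSeq 𝕜 p))).topologicalClosure :=
    fun n => Submodule.le_topologicalClosure _ (Submodule.subset_span ⟨n, rfl⟩)
  have hclosed := Submodule.isClosed_topologicalClosure
    (Submodule.span 𝕜 (Set.range (nodeSeq 𝕜 p)))
  rw [IsPresentation, Submodule.dense_iff_topologicalClosure_eq_top, eq_top_iff]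
  intro x _
  have hx : x = WithLp.toLp p (x.fst, 0) + WithLp.toLp p (0, x.snd) :=
    ext_fst_snd (add_zero _).symm (zero_add _).symm
  rw [hx]
  refine Submodule.add_mem _ ?_ (toLp_zero_mem hp hclosed (charVec_dyadicCell_mem hK) _)
  refine hclosed.mem_of_tendsto (hasSum_basisVec hp (x := WithLp.toLp p (x.fst, 0)) rfl)
    (Filter.Eventually.of_forall fun s => Submodule.sum_mem _ fun n _ =>
      Submodule.smul_mem _ _ (basisVec_mem hK n))

end LpSum

/-! ### The presentation by nodes is computable -/

namespace ScalarCode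

/-- A code for the sum of two rational scalars. -/
def add (z w : ScalarCode) : ScalarCode := (RatCode.add z.1 w.1, RatCode.add z.2 w.2)

/-- A code for zero. -/
def zero : ScalarCode := ((0, 0, 0), (0, 0, 0))

theorem val_add (𝕜 : Type*) [RCLike 𝕜] (z w : ScalarCode) :
    ScalarCode.val 𝕜 (add z w) = ScalarCode.val 𝕜 z + ScalarCode.val 𝕜 w := by
  simp only [ScalarCode.val, add, RatCode.val_add]
  push_cast
  ring

theorem val_zero (𝕜 : Type*) [RCLike 𝕜] : ScalarCode.val 𝕜 zero = 0 := by
  simp [ScalarCode.val, zero, RatCode.val]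

theorem primrec_add : Primrec₂ add := by
  have h1 : Primrec fun q : ScalarCode × ScalarCode => RatCode.add q.1.1 q.2.1 :=
    RatCode.primrec_add.comp (Primrec.fst.comp .fst) (Primrec.fst.comp .snd)
  have h2 : Primrec fun q : ScalarCode × ScalarCode => RatCode.add q.1.2 q.2.2 :=
    RatCode.primrec_add.comp (Primrec.snd.comp .fst) (Primrec.snd.comp .snd)
  exact h1.pair h2

end ScalarCode

theorem ratVec_eq_sum_range (𝕜 : Type*) [RCLike 𝕜] {E : Type*} [NormedAddCommGroup E]
    [NormedSpace 𝕜 E] (R : ℕ → E) (α : VectorCode) : ratVec 𝕜 R α =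
      ∑ j ∈ Finset.range α.length, ScalarCode.val 𝕜 (α.getD j ScalarCode.zero) • R j := by
  rw [ratVec, Finset.sum_range]
  refine Finset.sum_congr rfl fun j _ => ?_
  rw [List.getD_eq_getElem _ _ j.2]
  rfl

/-- The node of level `level c N` with index `i` is below the `j`-th node in the list. -/
def IsBelow (N c i j : ℕ) : Prop :=
  j.unpair.1 = c ∧ i / 2 ^ (level c N - level c j.unpair.2.unpair.1) = j.unpair.2.unpair.2

noncomputable instance (N c i j : ℕ) : Decidable (IsBelow N c i j) := by
  unfold IsBelow; infer_instance

theorem primrecPred_isBelow :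
    PrimrecPred fun q : (ℕ × ℕ × ℕ) × ℕ => IsBelow q.1.1 q.1.2.1 q.1.2.2 q.2 := by
  have hN : Primrec fun q : (ℕ × ℕ × ℕ) × ℕ => q.1.1 := Primrec.fst.comp .fst
  have hc : Primrec fun q : (ℕ × ℕ × ℕ) × ℕ => q.1.2.1 :=
    Primrec.fst.comp (Primrec.snd.comp .fst)
  have hi : Primrec fun q : (ℕ × ℕ × ℕ) × ℕ => q.1.2.2 :=
    Primrec.snd.comp (Primrec.snd.comp .fst)
  have hj : Primrec fun q : (ℕ × ℕ × ℕ) × ℕ => q.2.unpair := Primrec.unpair.comp .snd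
  have hj1 : Primrec fun q : (ℕ × ℕ × ℕ) × ℕ => q.2.unpair.1 := Primrec.fst.comp hj
  have hj2 : Primrec fun q : (ℕ × ℕ × ℕ) × ℕ => q.2.unpair.2.unpair :=
    Primrec.unpair.comp (Primrec.snd.comp hj)
  have hl1 := primrec_level.comp hc hN
  have hl2 := primrec_level.comp hc (Primrec.fst.comp hj2)
  have hpow := Primrec.nat_pow.comp (Primrec.const 2) (Primrec.nat_sub.comp hl1 hl2)
  have h1 := Primrec.eq.comp hj1 hc
  have h2 := Primrec.eq.comp (Primrec.nat_div.comp hi hpow) (Primrec.snd.comp hj2)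
  exact h1.and h2

/-- A code for the coefficient of a node in the refinement of a rational vector. -/
noncomputable def coefCode (α : VectorCode) (c i : ℕ) : ScalarCode :=
  (List.range α.length).foldl (fun z j => if IsBelow α.length c i j then
    ScalarCode.add z (α.getD j ScalarCode.zero) else z) ScalarCode.zero

theorem val_coefCode (𝕜 : Type*) [RCLike 𝕜] (α : VectorCode) (c i : ℕ) :
    ScalarCode.val 𝕜 (coefCode α c i) = ∑ j ∈ Finset.range α.length,
      if IsBelow α.length c i j then ScalarCode.val 𝕜 (α.getD j ScalarCode.zero) else 0 := by
  have key : ∀ n, ScalarCode.val 𝕜 ((List.range n).foldl (fun z j => if IsBelow α.length c i j then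
    ScalarCode.add z (α.getD j ScalarCode.zero) else z) ScalarCode.zero) = ∑ j ∈ Finset.range n,
      if IsBelow α.length c i j then ScalarCode.val 𝕜 (α.getD j ScalarCode.zero) else 0 := by
    intro n
    induction n with
    | zero => exact ScalarCode.val_zero 𝕜
    | succ n ih =>
      rw [List.range_succ, List.foldl_append, List.foldl_cons, List.foldl_nil,
        Finset.sum_range_succ, ← ih]
      split_ifs
      · rw [ScalarCode.val_add]
      · rw [add_zero]
  exact key _

theorem primrec_coefCode : Primrec fun q : VectorCode × ℕ × ℕ => coefCode q.1 q.2.1 q.2.2 := by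
  have hlen : Primrec fun q : VectorCode × ℕ × ℕ => q.1.length := Primrec.list_length.comp .fst
  have hl : Primrec fun q : VectorCode × ℕ × ℕ => List.range q.1.length :=
    Primrec.list_range.comp hlen
  have hq : Primrec fun t : (VectorCode × ℕ × ℕ) × ScalarCode × ℕ =>
      ((t.1.1.length, t.1.2.1, t.1.2.2), t.2.2) := by
    have h1 : Primrec fun t : (VectorCode × ℕ × ℕ) × ScalarCode × ℕ => t.1.1.length :=
      hlen.comp .fst
    have h2 : Primrec fun t : (VectorCode × ℕ × ℕ) × ScalarCode × ℕ => t.1.2 :=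
      Primrec.snd.comp .fst
    exact (h1.pair h2).pair (Primrec.snd.comp .snd)
  have hget : Primrec fun t : (VectorCode × ℕ × ℕ) × ScalarCode × ℕ =>
      t.1.1.getD t.2.2 ScalarCode.zero := by
    have h1 : Primrec fun t : (VectorCode × ℕ × ℕ) × ScalarCode × ℕ => t.1.1 :=
      Primrec.fst.comp .fst
    have h2 : Primrec fun t : (VectorCode × ℕ × ℕ) × ScalarCode × ℕ => t.2.2 :=
      Primrec.snd.comp .snd
    have h := (Primrec.list_getD ScalarCode.zero).comp h1 h2
    exact h
  have hz : Primrec fun t : (VectorCode × ℕ × ℕ) × ScalarCode × ℕ => t.2.1 :=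
    Primrec.fst.comp .snd
  have hstep := Primrec.ite (primrecPred_isBelow.comp hq) (ScalarCode.primrec_add.comp hz hget) hz
  have hstep' : Primrec₂ fun (q : VectorCode × ℕ × ℕ) (t : ScalarCode × ℕ) =>
      if IsBelow q.1.length q.2.1 q.2.2 t.2 then
        ScalarCode.add t.1 (q.1.getD t.2 ScalarCode.zero) else t.1 :=
    hstep.of_eq fun t => by congr
  exact Primrec.list_foldl hl (Primrec.const ScalarCode.zero) hstep'

/-- The refinement of a rational vector into disjoint nodes, as a list of pairs of a coefficient and
a level. -/
noncomputable def refinement (α : VectorCode) : List (ScalarCode × ℕ) :=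
  (List.range α.length).flatMap fun c =>
    (List.range (2 ^ level c α.length)).map fun i => (coefCode α c i, level c α.length)

theorem primrec_refinement : Primrec refinement := by
  have hlen : Primrec fun q : VectorCode × ℕ => level q.2 q.1.length :=
    primrec_level.comp .snd (Primrec.list_length.comp .fst)
  have hr : Primrec fun q : VectorCode × ℕ => List.range (2 ^ level q.2 q.1.length) :=
    Primrec.list_range.comp (Primrec.nat_pow.comp (Primrec.const 2) hlen)
  have hc : Primrec fun q : (VectorCode × ℕ) × ℕ => (q.1.1, q.1.2, q.2) :=
    (Primrec.fst.comp .fst).pair ((Primrec.snd.comp .fst).pair .snd)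
  have hm : Primrec₂ fun (q : VectorCode × ℕ) (i : ℕ) =>
      (coefCode q.1 q.2 i, level q.2 q.1.length) := by
    have h1 := primrec_coefCode.comp hc
    exact h1.pair (hlen.comp .fst)
  have h := Primrec.list_map hr hm
  exact Primrec.list_flatMap (Primrec.list_range.comp Primrec.list_length) h

namespace LpSum

variable (𝕜 : Type*) [RCLike 𝕜] (p : ℝ≥0∞) [Fact (1 ≤ p)]

/-- Both the component and the stage encoded in `j` are bounded by `j`. Hence stage `N` refines all
the vectors with numbers below `N` at once, in components below `N`. -/
theorem nodeSeq_eq_sum {N j : ℕ} (hj : j < N) : nodeSeq 𝕜 p j =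
    ∑ q ∈ (Finset.range N).sigma fun c => Finset.range (2 ^ level c N),
      if IsBelow N q.1 q.2 j then node 𝕜 p q.1 (level q.1 N) q.2 else 0 := by
  obtain ⟨c, hc⟩ : ∃ c, j.unpair.1 = c := ⟨_, rfl⟩
  have hcN : c < N := hc ▸ (Nat.unpair_left_le j).trans_lt hj
  have hs : j.unpair.2.unpair.1 ≤ N :=
    ((Nat.unpair_left_le _).trans (Nat.unpair_right_le j)).trans hj.le
  have hle : level c j.unpair.2.unpair.1 ≤ level c N := level_mono c hs
  obtain ⟨d, hd⟩ := Nat.exists_eq_add_of_le hle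
  rw [Finset.sum_sigma, Finset.sum_eq_single_of_mem c (Finset.mem_range.2 hcN)]
  · have hl : HasLevel c (level c j.unpair.2.unpair.1 + d) := hd ▸ hasLevel_level c N
    rw [nodeSeq, hc, node_eq_sum 𝕜 p hl, Finset.sum_filter, ← hd]
    refine Finset.sum_congr rfl fun i _ => if_congr ?_ rfl rfl
    rw [IsBelow, hd, Nat.add_sub_cancel_left]
    exact (and_iff_right hc).symm
  · intro c' _ hc'
    exact Finset.sum_eq_zero fun i _ => if_neg fun h => hc' (h.1.symm.trans hc)

theorem ratVec_nodeSeq (α : VectorCode) : ratVec 𝕜 (nodeSeq 𝕜 p) α =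
    ∑ q ∈ (Finset.range α.length).sigma fun c => Finset.range (2 ^ level c α.length),
      ScalarCode.val 𝕜 (coefCode α q.1 q.2) • node 𝕜 p q.1 (level q.1 α.length) q.2 := by
  rw [ratVec_eq_sum_range]
  simp only [val_coefCode, Finset.sum_smul]
  rw [Finset.sum_comm]
  refine Finset.sum_congr rfl fun j hj => ?_
  rw [nodeSeq_eq_sum 𝕜 p (Finset.mem_range.1 hj), Finset.smul_sum]
  refine Finset.sum_congr rfl fun q _ => ?_
  split_ifs
  · rfl
  · rw [smul_zero, zero_smul]

theorem _root_.sum_range_eq_list_sum {M : Type*} [AddCommMonoid M] (f : ℕ → M) (n : ℕ) :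
    ∑ i ∈ Finset.range n, f i = ((List.range n).map f).sum := rfl

/-- After refinement only one level occurs in each component, so all terms are pairwise disjoint and
their `p`-th power norms add up. The resulting list is computable from the coefficients. -/
theorem norm_ratVec_nodeSeq (hp : p ≠ ∞) (α : VectorCode) :
    ‖ratVec 𝕜 (nodeSeq 𝕜 p) α‖ = weightedNorm 𝕜 p.toReal (refinement α) := by
  have h0 := toReal_pos hp
  rw [← Real.rpow_rpow_inv (norm_nonneg (ratVec 𝕜 (nodeSeq 𝕜 p) α)) h0.ne', weightedNorm]
  congr 1
  rw [ratVec_nodeSeq, norm_sum_rpow_of_pairwise_disj hp]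
  · rw [Finset.sum_sigma, refinement, List.map_flatMap, List.flatMap_def, List.sum_flatten, List.map_map,
      sum_range_eq_list_sum]
    refine congrArg List.sum (List.map_congr_left fun c _ => ?_)
    rw [Function.comp_apply, List.map_map, sum_range_eq_list_sum]
    refine congrArg List.sum (List.map_congr_left fun i hi => ?_)
    rw [norm_smul, Real.mul_rpow (norm_nonneg _) (norm_nonneg _), norm_node_rpow 𝕜 p hp
      (hasLevel_level _ _) (List.mem_range.1 hi), ← div_eq_mul_inv]
    rfl
  · rintro ⟨c, i⟩ - ⟨c', i'⟩ - hne
    refine ((Disj.smul_right ?_ _).symm.smul_right _).symm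
    refine disj_node 𝕜 p (fun h => by rw [h]) ?_
    by_contra! h
    obtain ⟨rfl, rfl⟩ : c = c' ∧ i = i' := h
    exact hne rfl

theorem isComputablePresentation_nodeSeq (hp : p ≠ ∞) (hp_comp : IsComputableReal p.toReal) :
    IsComputablePresentation 𝕜 (nodeSeq 𝕜 p) := by
  have hp1 : 1 ≤ p.toReal := by
    have h := (ENNReal.toReal_le_toReal ENNReal.one_ne_top hp).2 Fact.out
    rwa [ENNReal.toReal_one] at h
  obtain ⟨f, hf, hf'⟩ := (computableRealFun_weightedNorm 𝕜 hp_comp hp1).comp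
    primrec_refinement.to_comp
  refine ⟨isPresentation_nodeSeq hp, f, hf, fun α k => ?_⟩
  rw [norm_ratVec_nodeSeq 𝕜 p hp, abs_sub_comm]
  exact hf' α k

end LpSum

/-! ### Deciding the second jump -/

section

open OracleCode

/-- The ball code with a given number. -/
def toBallCode (n : ℕ) : BallCode := Denumerable.ofNat BallCode n

theorem toBallCode_encode (B : BallCode) : toBallCode (Encodable.encode B) = B :=
  Denumerable.ofNat_encode B

theorem encode_toBallCode (n : ℕ) : Encodable.encode (toBallCode n) = n :=
  Denumerable.encode_ofNat n

theorem primrec_toBallCode : Primrec toBallCode := by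
  have h : Primrec fun n : ℕ => ((Encodable.decode n : Option BallCode)).getD ([], 0, 0) :=
    Primrec.option_getD.comp Primrec.decode (Primrec.const _)
  exact h.of_eq fun n => by rw [Denumerable.decode_eq_ofNat]; rfl

/-- A code for `-1`. -/
def ScalarCode.negOne : ScalarCode := ((0, 1, 0), (0, 0, 0))

theorem ScalarCode.val_negOne (𝕜 : Type*) [RCLike 𝕜] : ScalarCode.val 𝕜 negOne = -1 := by
  simp [ScalarCode.val, negOne, RatCode.val]

/-- A code for a rational vector minus the `i`-th vector of the presentation. -/
def subSingle (α : VectorCode) (i : ℕ) : VectorCode :=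
  (List.range (α.length + i + 1)).map fun j =>
    ScalarCode.add (α.getD j ScalarCode.zero) (if j = i then ScalarCode.negOne else ScalarCode.zero)

theorem ratVec_subSingle (𝕜 : Type*) [RCLike 𝕜] {E : Type*} [NormedAddCommGroup E]
    [NormedSpace 𝕜 E] (R : ℕ → E) (α : VectorCode) (i : ℕ) :
    ratVec 𝕜 R (subSingle α i) = ratVec 𝕜 R α - R i := by
  have hlen : (subSingle α i).length = α.length + i + 1 := by simp [subSingle]
  have hget : ∀ j ∈ Finset.range (α.length + i + 1),
      ScalarCode.val 𝕜 ((subSingle α i).getD j ScalarCode.zero) • R j =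
        ScalarCode.val 𝕜 (α.getD j ScalarCode.zero) • R j + if j = i then - R i else 0 := by
    intro j hj
    rw [List.getD_eq_getElem _ _ (by rw [hlen]; exact Finset.mem_range.1 hj)]
    simp only [subSingle, List.getElem_map, List.getElem_range, ScalarCode.val_add, add_smul]
    congr 1
    split_ifs with h
    · rw [ScalarCode.val_negOne, neg_one_smul, h]
    · rw [ScalarCode.val_zero, zero_smul]
  rw [ratVec_eq_sum_range, hlen, Finset.sum_congr rfl hget, Finset.sum_add_distrib,
    Finset.sum_ite_eq', if_pos (Finset.mem_range.2 (by omega)), ← sub_eq_add_neg,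
    ratVec_eq_sum_range]
  congr 1
  refine (Finset.sum_subset (Finset.range_subset_range.2 (by omega)) fun j _ hj => ?_).symm
  rw [List.getD_eq_default _ _ (not_lt.1 fun h => hj (Finset.mem_range.2 h)), ScalarCode.val_zero,
    zero_smul]

theorem primrec_subSingle : Primrec₂ subSingle := by
  have h1 : Primrec fun q : VectorCode × ℕ => List.range (q.1.length + q.2 + 1) :=
    Primrec.list_range.comp (Primrec.succ.comp
      (Primrec.nat_add.comp (Primrec.list_length.comp .fst) .snd))
  have ha : Primrec fun t : (VectorCode × ℕ) × ℕ => t.1.1 := Primrec.fst.comp .fst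
  have hi : Primrec fun t : (VectorCode × ℕ) × ℕ => t.1.2 := Primrec.snd.comp .fst
  have h2 := (Primrec.list_getD ScalarCode.zero).comp ha Primrec.snd
  have h3 := Primrec.ite (Primrec.eq.comp Primrec.snd hi) (Primrec.const ScalarCode.negOne)
    (Primrec.const ScalarCode.zero)
  have h4 := ScalarCode.primrec_add.comp h2 h3
  exact Primrec.list_map h1 h4

/-- The coefficients of a rational vector at the even places, with weight one. -/
def evenCoeffs (α : VectorCode) : List (ScalarCode × ℕ) :=
  (List.range α.length).map fun n => (α.getD (2 * n) ScalarCode.zero, 0)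

theorem primrec_evenCoeffs : Primrec evenCoeffs := by
  have h1 := (Primrec.list_getD ScalarCode.zero).comp (Primrec.fst (α := VectorCode) (β := ℕ))
    (Primrec.nat_mul.comp (Primrec.const 2) Primrec.snd)
  have h2 := h1.pair (Primrec.const 0)
  exact Primrec.list_map (Primrec.list_range.comp Primrec.list_length) h2

namespace RatCode

theorem le_val_iff {x : RatCode} : (1 / 2 : ℝ) ≤ (x.val : ℝ) ↔ x.2.2 + 1 + 2 * x.2.1 ≤ 2 * x.1 := by
  rw [RatCode.val]
  push_cast
  rw [div_le_div_iff₀ two_pos (by positivity), ← Nat.cast_le (α := ℝ)]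
  push_cast
  constructor <;> intro h <;> linarith

theorem val_lt_iff {x : RatCode} : (x.val : ℝ) < 1 / 8 ↔ 8 * x.1 < x.2.2 + 1 + 8 * x.2.1 := by
  rw [RatCode.val]
  push_cast
  rw [div_lt_div_iff₀ (by positivity) (by positivity), ← Nat.cast_lt (α := ℝ)]
  push_cast
  constructor <;> intro h <;> linarith

end RatCode

namespace LpSum

variable (𝕜 : Type*) [RCLike 𝕜] (p : ℝ≥0∞) [Fact (1 ≤ p)]

/-- The vectors in the odd places have no `ℓᵖ` part. The norm of the `ℓᵖ` part is thus read off from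
the even coefficients, and norms in `Lᵖ` of dyadic step functions are not needed. -/
theorem fst_ratVec_standardSeq_apply (α : VectorCode) (n : ℕ) :
    (ratVec 𝕜 (standardSeq 𝕜 p) α).fst n = ScalarCode.val 𝕜 (α.getD (2 * n) ScalarCode.zero) := by
  have hfst : ∀ j, (standardSeq 𝕜 p j).fst n = if j = 2 * n then 1 else 0 := by
    intro j
    rw [standardSeq]
    split_ifs with h1 h2 h2
    · have : n = j / 2 := by omega
      subst this
      exact lp.single_apply_self p _ 1
    · exact lp.single_apply_ne p _ 1 (by omega)
    · omega
    · rfl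
  have hmap : ∀ s : Finset ℕ, (∑ j ∈ s, ScalarCode.val 𝕜 (α.getD j ScalarCode.zero) •
      standardSeq 𝕜 p j).fst n = ∑ j ∈ s, ScalarCode.val 𝕜 (α.getD j ScalarCode.zero) *
        (standardSeq 𝕜 p j).fst n := by
    intro s
    induction s using Finset.induction_on with
    | empty => rfl
    | insert i s hi ih =>
      rw [Finset.sum_insert hi, Finset.sum_insert hi, WithLp.add_fst, lp.coeFn_add, Pi.add_apply, ih,
        WithLp.smul_fst, lp.coeFn_smul, Pi.smul_apply, smul_eq_mul]
  rw [ratVec_eq_sum_range, hmap]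
  simp only [hfst, mul_ite, mul_one, mul_zero, Finset.sum_ite_eq']
  split_ifs with h
  · rfl
  · rw [List.getD_eq_default _ _ (not_lt.1 fun h' => h (Finset.mem_range.2 h')),
      ScalarCode.val_zero]

theorem norm_fst_ratVec_standardSeq (hp : p ≠ ∞) (α : VectorCode) :
    ‖(ratVec 𝕜 (standardSeq 𝕜 p) α).fst‖ = weightedNorm 𝕜 p.toReal (evenCoeffs α) := by
  have h0 := toReal_pos hp
  set u := (ratVec 𝕜 (standardSeq 𝕜 p) α).fst with hu
  have h1 := lp.norm_rpow_eq_tsum h0 u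
  rw [← Real.rpow_rpow_inv (norm_nonneg u) h0.ne', weightedNorm, h1,
    tsum_eq_sum (s := Finset.range α.length)]
  · congr 1
    rw [sum_range_eq_list_sum, evenCoeffs, List.map_map]
    refine congrArg List.sum (List.map_congr_left fun n _ => ?_)
    rw [hu, fst_ratVec_standardSeq_apply, Function.comp_apply, pow_zero, div_one]
  · intro n hn
    rw [Finset.mem_range, not_lt] at hn
    rw [hu, fst_ratVec_standardSeq_apply, List.getD_eq_default _ _ (by omega), ScalarCode.val_zero,
      norm_zero, Real.zero_rpow h0.ne']

theorem norm_fst_le (hp : p ≠ ∞) (x : LpSum 𝕜 p) : ‖x.fst‖ ≤ ‖x‖ := by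
  have h0 := toReal_pos hp
  have h := WithLp.prod_norm_eq_add h0 x
  rw [h]
  calc ‖x.fst‖ = (‖x.fst‖ ^ p.toReal) ^ (1 / p.toReal) := by
        rw [one_div, Real.rpow_rpow_inv (norm_nonneg _) h0.ne']
    _ ≤ _ := by gcongr; exact le_add_of_nonneg_right (by positivity)

theorem norm_fst_eq (hp : p ≠ ∞) {x : LpSum 𝕜 p} (hx : x.snd = 0) : ‖x.fst‖ = ‖x‖ := by
  have h0 := toReal_pos hp
  rw [WithLp.prod_norm_eq_add h0 x, hx, norm_zero, Real.zero_rpow h0.ne', add_zero, one_div,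
    Real.rpow_rpow_inv (norm_nonneg _) h0.ne']

/-- The number of the root of the component that is atomic if and only if `e ∈ ∅''`. -/
def rootIndex (e : ℕ) : ℕ := Nat.pair (3 * e) (Nat.pair 0 0)

theorem nodeSeq_rootIndex (e : ℕ) : nodeSeq 𝕜 p (rootIndex e) = node 𝕜 p (3 * e) 0 0 := by
  rw [rootIndex, nodeSeq_pair, level_zero]

theorem norm_nodeSeq_rootIndex (hp : p ≠ ∞) (e : ℕ) : ‖nodeSeq 𝕜 p (rootIndex e)‖ = 1 := by
  have h := norm_node_rpow 𝕜 p hp (c := 3 * e) (k := 0) (m := 0) (fun _ => Nat.zero_le _)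
    (by norm_num)
  rw [pow_zero, inv_one] at h
  rw [nodeSeq_rootIndex, ← Real.rpow_rpow_inv (norm_nonneg (node 𝕜 p (3 * e) 0 0))
    (toReal_pos hp).ne', h, Real.one_rpow]

theorem primrec_rootIndex : Primrec rootIndex :=
  Primrec₂.natPair.comp (Primrec.nat_mul.comp (Primrec.const 3) .id) (Primrec.const _)

/-- Convergence of the algorithm only gives an inclusion of balls, whereas the test inspects the
coded radius. In a nonzero normed space the inclusion bounds that radius. -/
theorem radius_le_of_ball_subset {E : Type*} [NormedAddCommGroup E] [NormedSpace 𝕜 E] {u c x : E}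
    (hu : ‖u‖ = 1) {r s : ℝ} (hr : 0 < r) (h : Metric.ball c r ⊆ Metric.ball x s) : r ≤ 2 * s := by
  refine le_of_forall_lt_imp_le_of_dense fun t ht => ?_
  rcases le_or_gt t 0 with h0 | h0
  · have := h (Metric.mem_ball_self hr)
    rw [Metric.mem_ball] at this
    linarith [dist_nonneg (x := c) (y := x)]
  · have h1 := h (Metric.mem_ball_self hr)
    have hn : ‖((t : ℝ) : 𝕜) • u‖ = t := by
      rw [norm_smul, hu, mul_one, RCLike.norm_ofReal, abs_of_pos h0]
    have h2 : c + ((t : ℝ) : 𝕜) • u ∈ Metric.ball x s := h (by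
      rw [Metric.mem_ball, dist_eq_norm, add_sub_cancel_left, hn]
      exact ht)
    have h3 := dist_triangle_right (c + ((t : ℝ) : 𝕜) • u) c x
    rw [dist_eq_norm (c + _) c, add_sub_cancel_left, hn] at h3
    rw [Metric.mem_ball] at h1 h2
    linarith

end LpSum

/-- If the rational numbers `x` and `(r.1 + 1) / (r.2 + 1)` are small, then decide whether the
rational number `y` is at least `1/2`. -/
def guardedTest (x y : RatCode) (r : ℕ × ℕ) : Option ℕ :=
  if 8 * x.1 < x.2.2 + 1 + 8 * x.2.1 ∧ 8 * (r.1 + 1) ≤ r.2 + 1 then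
    if y.2.2 + 1 + 2 * y.2.1 ≤ 2 * y.1 then some 1 else some 0
  else none

theorem primrec_guardedTest :
    Primrec fun t : (RatCode × RatCode) × ℕ × ℕ => guardedTest t.1.1 t.1.2 t.2 := by
  have hx : Primrec fun t : (RatCode × RatCode) × ℕ × ℕ => t.1.1 := Primrec.fst.comp .fst
  have hy : Primrec fun t : (RatCode × RatCode) × ℕ × ℕ => t.1.2 := Primrec.snd.comp .fst
  have hmul : ∀ n, Primrec fun m : ℕ => n * m := fun n => Primrec.nat_mul.comp (Primrec.const n) .id
  have hsum : ∀ n, Primrec fun x : RatCode => x.2.2 + 1 + n * x.2.1 := fun n =>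
    Primrec.nat_add.comp (Primrec.succ.comp (Primrec.snd.comp .snd))
      ((hmul n).comp (Primrec.fst.comp .snd))
  have h1 := Primrec.nat_lt.comp ((hmul 8).comp (Primrec.fst.comp hx)) ((hsum 8).comp hx)
  have hr1 : Primrec fun t : (RatCode × RatCode) × ℕ × ℕ => 8 * (t.2.1 + 1) :=
    (hmul 8).comp (Primrec.succ.comp (Primrec.fst.comp .snd))
  have hr2 : Primrec fun t : (RatCode × RatCode) × ℕ × ℕ => t.2.2 + 1 :=
    Primrec.succ.comp (Primrec.snd.comp .snd)
  have h2 := Primrec.nat_le.comp hr1 hr2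
  have h3 := Primrec.nat_le.comp ((hsum 2).comp hy) ((hmul 2).comp (Primrec.fst.comp hy))
  have h := Primrec.ite (h1.and h2)
    (Primrec.ite h3 (Primrec.const (some 1)) (Primrec.const (some 0))) (Primrec.const none)
  exact h

/-- Compare a ball with the root vector with number `e`, given another ball whose centre is close to
the preimage of that vector if the test succeeds. -/
noncomputable def compareBalls (q : List (ScalarCode × ℕ) × ℕ → RatCode) (e : ℕ) (B C : BallCode) :
    Option ℕ :=
  guardedTest (q (refinement (subSingle C.1 (LpSum.rootIndex e)), 4)) (q (evenCoeffs B.1, 4)) C.2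

theorem computable_compareBalls {q : List (ScalarCode × ℕ) × ℕ → RatCode} (hq : Computable q) :
    Computable fun t : ℕ × BallCode × BallCode => compareBalls q t.1 t.2.1 t.2.2 := by
  have hB : Primrec fun t : ℕ × BallCode × BallCode => t.2.1.1 :=
    Primrec.fst.comp (Primrec.fst.comp .snd)
  have hC : Primrec fun t : ℕ × BallCode × BallCode => t.2.2.1 :=
    Primrec.fst.comp (Primrec.snd.comp .snd)
  have hr : Primrec fun t : ℕ × BallCode × BallCode => t.2.2.2 :=
    Primrec.snd.comp (Primrec.snd.comp .snd)
  have he : Primrec fun t : ℕ × BallCode × BallCode => LpSum.rootIndex t.1 :=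
    LpSum.primrec_rootIndex.comp .fst
  have h1 : Primrec fun t : ℕ × BallCode × BallCode =>
      refinement (subSingle t.2.2.1 (LpSum.rootIndex t.1)) :=
    primrec_refinement.comp (primrec_subSingle.comp hC he)
  have h2 : Primrec fun t : ℕ × BallCode × BallCode => evenCoeffs t.2.1.1 :=
    primrec_evenCoeffs.comp hB
  have h3 := hq.comp (h1.to_comp.pair (Computable.const 4))
  have h4 := hq.comp (h2.to_comp.pair (Computable.const 4))
  have h := primrec_guardedTest.to_comp.comp ((h3.pair h4).pair hr.to_comp)
  exact h

/-- Decide whether the component with number `3 * e` is atomic, by means of a prefix of the oracle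
and a program for a linear isometric isomorphism. The function `q` approximates weighted norms. -/
noncomputable def decideAtomic (q : List (ScalarCode × ℕ) × ℕ → RatCode) (e₀ e : ℕ)
    (l : List ℕ) : Option ℕ :=
  (evalList e₀ l.length.unpair.1 (l.take l.length.unpair.2)).bind fun c =>
    compareBalls q e (toBallCode l.length.unpair.1) (toBallCode c)

theorem computable_decideAtomic {q : List (ScalarCode × ℕ) × ℕ → RatCode} (hq : Computable q)
    (e₀ : ℕ) : Computable₂ (decideAtomic q e₀) := by
  have hb : Primrec fun t : ℕ × List ℕ => t.2.length.unpair.1 :=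
    Primrec.fst.comp (Primrec.unpair.comp (Primrec.list_length.comp .snd))
  have hn : Primrec fun t : ℕ × List ℕ => t.2.length.unpair.2 :=
    Primrec.snd.comp (Primrec.unpair.comp (Primrec.list_length.comp .snd))
  have htake : Primrec fun t : ℕ × List ℕ => t.2.take t.2.length.unpair.2 :=
    primrec_list_take.comp .snd hn
  have hpair : Primrec fun t : ℕ × List ℕ =>
      ((e₀, t.2.length.unpair.1), t.2.take t.2.length.unpair.2) :=
    ((Primrec.const e₀).pair hb).pair htake
  have hev := (primrec_evalList.comp hpair).to_comp
  have hc : Primrec fun t : (ℕ × List ℕ) × ℕ => toBallCode t.2 := primrec_toBallCode.comp .snd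
  have hB : Primrec fun t : (ℕ × List ℕ) × ℕ => toBallCode t.1.2.length.unpair.1 :=
    primrec_toBallCode.comp (hb.comp .fst)
  have he : Primrec fun t : (ℕ × List ℕ) × ℕ => t.1.1 := Primrec.fst.comp .fst
  have h1 : Computable₂ fun (t : ℕ × List ℕ) (c : ℕ) =>
      compareBalls q t.1 (toBallCode t.2.length.unpair.1) (toBallCode c) := by
    have h := (computable_compareBalls hq).comp (he.pair (hB.pair hc)).to_comp
    exact h
  have h := Computable.option_bind hev h1
  exact h

namespace LpSum

variable (𝕜 : Type*) [RCLike 𝕜] (p : ℝ≥0∞) [Fact (1 ≤ p)]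

/-- The root has norm one and lies wholly in one summand, which `T.symm` preserves. -/
theorem norm_fst_symm_rootIndex (hp : p ≠ ∞) (hp_two : p ≠ 2)
    (T : LpSum 𝕜 p ≃ₗᵢ[𝕜] LpSum 𝕜 p) (e : ℕ) :
    ‖(T.symm (nodeSeq 𝕜 p (rootIndex e))).fst‖ =
      _root_.charFun (turingJump (turingJump ∅)) e := by
  rw [_root_.charFun, nodeSeq_rootIndex]
  split_ifs with h
  · rw [norm_fst_eq 𝕜 p hp (map_snd_eq_zero hp hp_two T.symm
      (snd_node 𝕜 p (isAtomicComponent_three_mul.2 h) _ _)), LinearIsometryEquiv.norm_map,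
      ← nodeSeq_rootIndex, norm_nodeSeq_rootIndex 𝕜 p hp, Nat.cast_one]
  · rw [map_fst_eq_zero hp hp_two T.symm
      (fst_node 𝕜 p (fun hc => h (isAtomicComponent_three_mul.1 hc)) _ _), norm_zero, Nat.cast_zero]

variable {𝕜 p} in
theorem computes_of_oracleComputesMap (hp : p ≠ ∞) (hp_two : p ≠ 2)
    (hp_comp : IsComputableReal p.toReal) {X : Set ℕ} {T : LpSum 𝕜 p ≃ₗᵢ[𝕜] LpSum 𝕜 p}
    (hT : OracleComputesMap 𝕜 X (standardSeq 𝕜 p) (nodeSeq 𝕜 p) T) :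
    Computes X (turingJump (turingJump ∅)) := by
  have hp1 : 1 ≤ p.toReal := by
    have h := (ENNReal.toReal_le_toReal ENNReal.one_ne_top hp).2 Fact.out
    rwa [ENNReal.toReal_one] at h
  obtain ⟨q, hq, hq'⟩ := computableRealFun_weightedNorm 𝕜 hp_comp hp1
  obtain ⟨P, hP, happrox, hconv⟩ := hT
  obtain ⟨e₀, he₀⟩ := hP.exists_evalList
  -- The length `n` of the segment codes both the ball to be tried and the amount of oracle to be
  -- used; the latter is at most `n`, so the segment is long enough.
  have hF : ∀ e n, decideAtomic q e₀ e ((List.range n).map (_root_.charFun X)) =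
      (evalList e₀ n.unpair.1 ((List.range n.unpair.2).map (_root_.charFun X))).bind fun c =>
        compareBalls q e (toBallCode n.unpair.1) (toBallCode c) := by
    intro e n
    rw [decideAtomic, List.length_map, List.length_range, ← List.map_take, List.take_range,
      min_eq_left (Nat.unpair_right_le n)]
  have hrange : ∀ e (C : BallCode),
      |((q (refinement (subSingle C.1 (rootIndex e)), 4)).val : ℝ) -
        ‖ratVec 𝕜 (nodeSeq 𝕜 p) C.1 - nodeSeq 𝕜 p (rootIndex e)‖| < 1 / 16 := by
    intro e C
    rw [← ratVec_subSingle, norm_ratVec_nodeSeq 𝕜 p hp]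
    refine (hq' _ 4).trans_eq (by norm_num)
  have hdomain : ∀ B : BallCode, |((q (evenCoeffs B.1, 4)).val : ℝ) -
      ‖(ratVec 𝕜 (standardSeq 𝕜 p) B.1).fst‖| < 1 / 16 := by
    intro B
    rw [norm_fst_ratVec_standardSeq 𝕜 p hp]
    refine (hq' _ 4).trans_eq (by norm_num)
  refine RecursiveIn.iff_nat.2 (recursiveIn_of_initialSegments (computable_decideAtomic hq e₀) ?_ ?_)
  · intro e
    -- With `1/16` for the neighbourhood and `1/16` for the approximation of the norm, the computed
    -- distance is below `1/8`; the radius is at most `2 * (1/16) = 1/8`. So the test succeeds.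
    obtain ⟨B, C, hC, -, hsub⟩ := hconv (T.symm (nodeSeq 𝕜 p (rootIndex e)))
      (Metric.ball (nodeSeq 𝕜 p (rootIndex e)) (1 / 16))
      (by rw [LinearIsometryEquiv.apply_symm_apply]; exact Metric.ball_mem_nhds _ (by norm_num))
    obtain ⟨n, hn⟩ := (he₀ B C).1 hC
    refine ⟨Nat.pair (Encodable.encode B) n, ?_⟩
    have hpos : 0 < ((C.2.1 : ℝ) + 1) / ((C.2.2 : ℝ) + 1) := by positivity
    have hcentre : ‖ratVec 𝕜 (nodeSeq 𝕜 p) C.1 - nodeSeq 𝕜 p (rootIndex e)‖ < 1 / 16 := by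
      rw [← dist_eq_norm]
      exact hsub (Metric.mem_ball_self hpos)
    have hradius := radius_le_of_ball_subset 𝕜 (norm_nodeSeq_rootIndex 𝕜 p hp e) hpos hsub
    have h1 := RatCode.val_lt_iff.1
      (by linarith [(abs_lt.1 (hrange e C)).2] :
        ((q (refinement (subSingle C.1 (rootIndex e)), 4)).val : ℝ) < 1 / 8)
    have h2 : 8 * (C.2.1 + 1) ≤ C.2.2 + 1 := by
      rw [div_le_iff₀ (by positivity)] at hradius
      rw [← Nat.cast_le (α := ℝ)]
      push_cast
      linarith
    rw [hF, Nat.unpair_pair, hn, Option.bind_some, toBallCode_encode, toBallCode_encode, compareBalls,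
      guardedTest, if_pos ⟨h1, h2⟩]
    split_ifs <;> rfl
  · intro e n v hv
    rw [hF, Option.bind_eq_some_iff] at hv
    obtain ⟨c, hc, hv⟩ := hv
    have hC : toBallCode c ∈ P (toBallCode n.unpair.1) := by
      refine (he₀ _ _).2 ⟨n.unpair.2, ?_⟩
      rwa [encode_toBallCode, encode_toBallCode]
    generalize toBallCode n.unpair.1 = B at hC hv
    generalize toBallCode c = C at hC hv
    rw [compareBalls, guardedTest] at hv
    split_ifs at hv with h h'
    all_goals
      have h1 := RatCode.val_lt_iff.2 h.1
      have h2 : ((C.2.1 : ℝ) + 1) / ((C.2.2 : ℝ) + 1) ≤ 1 / 8 := by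
        rw [div_le_div_iff₀ (by positivity) (by norm_num)]
        have := (Nat.cast_le (α := ℝ)).2 h.2
        push_cast at this
        linarith
      -- The centre of `B` is itself a point of `B`, so its image lies in the ball `C`.
      have hb : T (ratVec 𝕜 (standardSeq 𝕜 p) B.1) ∈ ratBall 𝕜 (nodeSeq 𝕜 p) C :=
        happrox B C hC ⟨_, Metric.mem_ball_self (by positivity), rfl⟩
      rw [ratBall, Metric.mem_ball, dist_eq_norm] at hb
      -- The radius contributes `1/8`, and the distance of the centre of `C` from the root is less
      -- than `1/8 + 1/16`. With a further `1/16` for the last approximation, the total error `6/16`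
      -- is below `1/2`, so the threshold `1/2` separates the values `0` and `1`.
      have hdist : ‖ratVec 𝕜 (standardSeq 𝕜 p) B.1 - T.symm (nodeSeq 𝕜 p (rootIndex e))‖ <
          5 / 16 := by
        rw [← T.norm_map, map_sub, LinearIsometryEquiv.apply_symm_apply]
        have h3 := norm_sub_le_norm_sub_add_norm_sub (T (ratVec 𝕜 (standardSeq 𝕜 p) B.1))
          (ratVec 𝕜 (nodeSeq 𝕜 p) C.1) (nodeSeq 𝕜 p (rootIndex e))
        linarith [(abs_lt.1 (hrange e C)).1]
      have hfst := (norm_fst_le 𝕜 p hp _).trans_lt hdist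
      rw [WithLp.sub_fst] at hfst
      have habs := (abs_norm_sub_norm_le _ _).trans_lt hfst
      rw [norm_fst_symm_rootIndex 𝕜 p hp hp_two T e, abs_lt] at habs
      have hdom := abs_lt.1 (hdomain B)
    · have hy := RatCode.le_val_iff.2 h'
      have hv' : v = 1 := by simpa using hv.symm
      rw [hv', _root_.charFun] at *
      split_ifs at habs ⊢
      · rfl
      · norm_num at habs
        linarith
    · have hy := not_le.1 (mt RatCode.le_val_iff.1 h')
      have hv' : v = 0 := by simpa using hv.symm
      rw [hv', _root_.charFun] at *
      split_ifs at habs ⊢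
      · norm_num at habs
        linarith
      · rfl

end LpSum

end

theorem theorem6p5 (𝕜 : Type*) [RCLike 𝕜] (p : ℝ≥0∞) [Fact (1 ≤ p)] (hp_top : p ≠ ∞)
    (hp_two : p ≠ 2) (hp_comp : IsComputableReal p.toReal) :
    ∃ R : ℕ → LpSum 𝕜 p, IsComputablePresentation 𝕜 R ∧
      ∀ (X : Set ℕ) (T : LpSum 𝕜 p ≃ₗᵢ[𝕜] LpSum 𝕜 p),
        OracleComputesMap 𝕜 X (standardSeq 𝕜 p) R T →
          Computes X (turingJump (turingJump ∅)) :=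
  ⟨LpSum.nodeSeq 𝕜 p, LpSum.isComputablePresentation_nodeSeq 𝕜 p hp_top hp_comp, fun _ _ hT =>
    LpSum.computes_of_oracleComputesMap hp_top hp_two hp_comp hT⟩
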